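/- Let $G=(V,E)$ be a finite simple undirected graph with $n$ vertices. A token-placement of $G$ (with two colors) is a surjective map $f\colon V\to\{1,2\}$. Two distinct token-placements are adjacent if one arises from the other by exchanging the values at the two ends of an edge of $G$. A swapping sequence between $f$ and $f'$ is a sequence $\langle f_1,\dots,f_h\rangle$ of token-placements with $f_1=f$, $f_h=f'$ and $f_{k-1},f_k$ adjacent for $2\le k\le h$; its length is $h-1$. Let $\mathrm{OPT}(f,f')$ be the minimum length of a swapping sequence between $f$ and $f'$ ($\infty$ if there is none). Two-color token swapping is the problem to decide, given $G$, token-placements $f_0,f_t$ and an integer $\ell\ge 0$, whether $\mathrm{OPT}(f_0,f_t)\le \ell$. **Theorem.** (1) Two-color token swapping can be solved in $O(n^3)$ time on general graphs (on a word RAM with words of $O(\log (n+\ell))$ bits, the graph being given by its adjacency matrix). (2) Given $G,f_0,f_t$, a swapping sequence between $f_0$ and $f_t$ of minimum length can be constructed in $O(n^3)$ time on a word RAM with words of $O(\log n)$ bits (if there is no swapping sequence, this is reported). (3) Let $X=\{v: f_0(v)=1\}$ and $Y=\{v: f_t(v)=1\}$, and let $G_B$ be the complete bipartite graph between (disjoint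 copies of) $X$ and $Y$ in which the edge between $x\in X$ and $y\in Y$ has as its weight the length of a shortest path from $x$ to $y$ in $G$ ($\infty$ if there is none). Then $\mathrm{OPT}(f_0,f_t)$ equals the minimum weight of a perfect matching of $G_B$ (both are $\infty$ if $|X|\neq|Y|$). Suppose moreover that in every component of $G$ each color occurs equally often in $f_0$ and in $f_t$. Then this value is finite, and it is attained by color shifts along shortest paths: for every perfect matching $M$ of $G_B$ of minimum weight, the edges of $M$ can be ordered such that, for every choice of a shortest path in $G$ between the two ends of each edge of $M$, carrying out the color shifts along these paths one after the other in this order is a swapping sequence between $f_0$ and $f_t$ whose length is the weight of $M$. Here the color shift along a path $\langle p_1,\dots,p_q\rangle$, where $p_1$ is the end in $Y$ and $p_q$ the end in $X$, does nothing if $q=1$; otherwise it finds the smallest $i>1$ such that $p_i$ currently carries color $1$, moves this token along the path to $p_1$ by $i-1$ swaps, and repeats this with the path $\langle p_i,\dots,p_q\rangle$. -/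

import Mathlib

/-! ### Token placements and swapping sequences -/

/-- A token-placement of a vertex set `V` with `c` colors: a surjective map from `V` to the set of
colors.  The colors `1, …, c` are represented by the elements `0, …, c - 1` of `Fin c`. -/
@[ext]
structure TokenPlacement (V : Type*) (c : ℕ) where
  /-- the color of the token on a vertex -/
  color : V → Fin c
  /-- every color occurs -/
  surj : Function.Surjective color

namespace TokenPlacement

/-- Two distinct token-placements are adjacent if one arises from the other by swapping the two
tokens on the ends of an edge of `G`. -/
def Adjacent {V : Type*} {c : ℕ} (G : SimpleGraph V) (f f' : TokenPlacement V c) : Prop :=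
  f ≠ f' ∧ ∃ u v : V, G.Adj u v ∧ f'.color u = f.color v ∧ f'.color v = f.color u ∧
    ∀ w : V, w ≠ u → w ≠ v → f'.color w = f.color w

/-- `S = ⟨f₁, …, f_h⟩` is a swapping sequence between `f` and `f'`. -/
def IsSwappingSeq {V : Type*} {c : ℕ} (G : SimpleGraph V) (f f' : TokenPlacement V c)
    (S : List (TokenPlacement V c)) : Prop :=
  S.head? = some f ∧ S.getLast? = some f' ∧ S.IsChain (Adjacent G)

/-- The length of a swapping sequence: the number of its token-placements minus one, that is, the
number of swaps. -/
def seqLen {V : Type*} {c : ℕ} (S : List (TokenPlacement V c)) : ℕ := S.length - 1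

/-- The minimum length of a swapping sequence between `f` and `f'`; it is `⊤` if there is none. -/
noncomputable def opt {V : Type*} {c : ℕ} (G : SimpleGraph V) (f f' : TokenPlacement V c) : ℕ∞ :=
  ⨅ (S : List (TokenPlacement V c)) (_ : IsSwappingSeq G f f' S), (seqLen S : ℕ∞)

/-- `f ≃ f'`: in every component of `G`, every color occurs equally often in `f` and in `f'`. -/
def SameColorCounts {V : Type*} {c : ℕ} (G : SimpleGraph V) (f f' : TokenPlacement V c) : Prop :=
  ∀ (K : G.ConnectedComponent) (i : Fin c),
    {v : V | G.connectedComponentMk v = K ∧ f.color v = i}.ncard =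
      {v : V | G.connectedComponentMk v = K ∧ f'.color v = i}.ncard

/-! ### The weighted bipartite graph of a two-color instance -/

/-- The vertices that carry a token of color 1 (which is `0 : Fin 2`). -/
abbrev ColorOne {V : Type*} (f : TokenPlacement V 2) : Type _ := {v : V // f.color v = 0}

/-- A perfect matching of the complete bipartite graph between the initial and the target positions
of color 1, given by the bijection of its two sides that it induces. -/
abbrev ColorOneMatching {V : Type*} (f₀ fₜ : TokenPlacement V 2) : Type _ :=
  ColorOne f₀ ≃ ColorOne fₜ

/-- The weight of a perfect matching, where the edge between `x` and `y` weighs the length of a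
shortest path of `G` from `x` to `y` (`⊤` if there is none). -/
noncomputable def matchingWeight {V : Type*} [Fintype V] (G : SimpleGraph V)
    {f₀ fₜ : TokenPlacement V 2} (M : ColorOneMatching f₀ fₜ) : ℕ∞ :=
  ∑ x : ColorOne f₀, G.edist (x : V) (M x : V)

/-- `M` is a perfect matching of minimum weight. -/
def IsMinWeight {V : Type*} [Fintype V] (G : SimpleGraph V)
    {f₀ fₜ : TokenPlacement V 2} (M : ColorOneMatching f₀ fₜ) : Prop :=
  ∀ M' : ColorOneMatching f₀ fₜ, matchingWeight G M ≤ matchingWeight G M'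

/-! ### Color shifts -/

/-- The token-placement that results from swapping the tokens on the two vertices of `e`. -/
def swapTokens {V : Type*} [DecidableEq V] {c : ℕ} (f : TokenPlacement V c) (e : V × V) :
    TokenPlacement V c where
  color := f.color ∘ Equiv.swap e.1 e.2
  surj := f.surj.comp (Equiv.swap e.1 e.2).surjective

/-- The token-placements that are passed when a list of swaps is carried out one after the other
from `f` on, `f` included. -/
def placements {V : Type*} [DecidableEq V] {c : ℕ} (f : TokenPlacement V c) (es : List (V × V)) :
    List (TokenPlacement V c) :=
  es.scanl swapTokens f

/-- Auxiliary function for `colorShift`.  The list `acc` holds the edges between the vertex which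
next receives a token of color 1 and the head of the path, the last edge first. -/
def colorShiftAux {V : Type*} (f : TokenPlacement V 2) : List (V × V) → List V → List (V × V)
  | acc, a :: b :: l =>
      if f.color b = 0 then ((a, b) :: acc) ++ colorShiftAux f [] (b :: l)
      else colorShiftAux f ((a, b) :: acc) (b :: l)
  | _, _ => []

/-- The list of swaps of the color shift along a path `⟨p₁, …, p_q⟩` whose first vertex carries
color 2 and whose last vertex carries color 1: find the first `p_i` after `p₁` with a token of
color 1, move this token along the path to `p₁` by the swaps on
`p_{i-1} p_i`, …, `p₂ p₃`, `p₁ p₂`, and repeat with the path `⟨p_i, …, p_q⟩`. -/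
def colorShift {V : Type*} (f : TokenPlacement V 2) (p : List V) : List (V × V) :=
  colorShiftAux f [] p

/-- The list of swaps of the color shifts along the given paths, one path after the other. -/
def colorShifts {V : Type*} [DecidableEq V] (f : TokenPlacement V 2) :
    List (List V) → List (V × V)
  | [] => []
  | p :: ps => colorShift f p ++ colorShifts ((colorShift f p).foldl swapTokens f) ps

end TokenPlacement

/-! ### A word RAM

Programs are finite, fixed texts (the same for inputs of all sizes) of a structured language over a
random access memory: finitely many variables and finitely many arrays, indexed by computed
addresses, all cells holding natural numbers.  Every operation on words costs one unit of time. All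
numbers that occur have to stay below a given bound `W`: otherwise the execution fails. -/

namespace WordRAM

/-- The binary operations on words: sum, truncated difference, product, and the comparisons with
value `1` (true) or `0` (false). -/
inductive BinOp
  | add | sub | mul | lt | eq

/-- The value of a binary operation. -/
def BinOp.eval : BinOp → ℕ → ℕ → ℕ
  | .add, a, b => a + b
  | .sub, a, b => a - b
  | .mul, a, b => a * b
  | .lt, a, b => if a < b then 1 else 0
  | .eq, a, b => if a = b then 1 else 0

/-- Expressions: literals, variables, array cells at a computed address, and operations. -/
inductive Expr
  | const (k : ℕ)
  | var (x : ℕ)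
  | read (a : ℕ) (i : Expr)
  | op (o : BinOp) (e₁ e₂ : Expr)

/-- Programs. The tests in `ite` and `loop` (a while-loop) ask whether the value is nonzero. -/
inductive Prog
  | skip
  | assign (x : ℕ) (e : Expr)
  | write (a : ℕ) (i e : Expr)
  | seq (p q : Prog)
  | ite (e : Expr) (p q : Prog)
  | loop (e : Expr) (p : Prog)

/-- The contents of the memory: the variables, and the cells of the arrays. -/
@[ext]
structure Store where
  /-- the value of a variable -/
  var : ℕ → ℕ
  /-- the value of a cell of an array -/
  arr : ℕ → ℕ → ℕ

/-- Set the variable `x` to `k`. -/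
def Store.setVar (s : Store) (x k : ℕ) : Store where
  var := Function.update s.var x k
  arr := s.arr

/-- Set the cell `i` of the array `a` to `k`. -/
def Store.setArr (s : Store) (a i k : ℕ) : Store where
  var := s.var
  arr := Function.update s.arr a (Function.update (s.arr a) i k)

/-- The value of an expression. -/
def Expr.eval (s : Store) : Expr → ℕ
  | .const k => k
  | .var x => s.var x
  | .read a i => s.arr a (i.eval s)
  | .op o e₁ e₂ => o.eval (e₁.eval s) (e₂.eval s)

/-- The time for the evaluation of an expression: one unit per node. -/
def Expr.cost : Expr → ℕ
  | .const _ => 1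
  | .var _ => 1
  | .read _ i => i.cost + 1
  | .op _ e₁ e₂ => e₁.cost + e₂.cost + 1

/-- All values (also addresses) that occur in the evaluation of an expression are at most `W`. -/
def Expr.Fits (W : ℕ) (s : Store) : Expr → Prop
  | .const k => k ≤ W
  | .var x => s.var x ≤ W
  | .read a i => i.Fits W s ∧ s.arr a (i.eval s) ≤ W
  | .op o e₁ e₂ => e₁.Fits W s ∧ e₂.Fits W s ∧ o.eval (e₁.eval s) (e₂.eval s) ≤ W

/-- `Exec W p s t s'`: started with memory `s`, the program `p` halts after `t` units of time with
memory `s'`, and all numbers that it computes are at most `W`. -/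
inductive Exec (W : ℕ) : Prog → Store → ℕ → Store → Prop
  | skip (s : Store) : Exec W .skip s 1 s
  | assign (x : ℕ) (e : Expr) (s : Store) (he : e.Fits W s) :
      Exec W (.assign x e) s (e.cost + 1) (s.setVar x (e.eval s))
  | write (a : ℕ) (i e : Expr) (s : Store) (hi : i.Fits W s) (he : e.Fits W s) :
      Exec W (.write a i e) s (i.cost + e.cost + 1) (s.setArr a (i.eval s) (e.eval s))
  | seq (p q : Prog) (s s' s'' : Store) (t t' : ℕ) (hp : Exec W p s t s')
      (hq : Exec W q s' t' s'') : Exec W (.seq p q) s (t + t') s''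
  | ite_true (e : Expr) (p q : Prog) (s s' : Store) (t : ℕ) (he : e.Fits W s)
      (h : e.eval s ≠ 0) (hp : Exec W p s t s') : Exec W (.ite e p q) s (e.cost + 1 + t) s'
  | ite_false (e : Expr) (p q : Prog) (s s' : Store) (t : ℕ) (he : e.Fits W s)
      (h : e.eval s = 0) (hq : Exec W q s t s') : Exec W (.ite e p q) s (e.cost + 1 + t) s'
  | loop_true (e : Expr) (p : Prog) (s s' s'' : Store) (t t' : ℕ) (he : e.Fits W s)
      (h : e.eval s ≠ 0) (hp : Exec W p s t s') (hl : Exec W (.loop e p) s' t' s'') :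
      Exec W (.loop e p) s (e.cost + 1 + t + t') s''
  | loop_false (e : Expr) (p : Prog) (s : Store) (he : e.Fits W s) (h : e.eval s = 0) :
      Exec W (.loop e p) s (e.cost + 1) s

open Classical in
/-- The memory that holds a two-color instance on the vertices `0, …, n - 1`: variable `0` holds
`n`, array `0` the adjacency matrix row by row, arrays `1` and `2` the colors of the initial and the
target token-placement.  All other variables and cells are `0`. -/
noncomputable def inputStore {n : ℕ} (G : SimpleGraph (Fin n))
    (f₀ fₜ : TokenPlacement (Fin n) 2) : Store where
  var x := if x = 0 then n else 0
  arr a k :=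
    if a = 0 then (if ∃ i j : Fin n, k = (i : ℕ) * n + (j : ℕ) ∧ G.Adj i j then 1 else 0)
    else if a = 1 then (if h : k < n then (f₀.color ⟨k, h⟩ : ℕ) else 0)
    else if a = 2 then (if h : k < n then (fₜ.color ⟨k, h⟩ : ℕ) else 0)
    else 0

/-- The memory holds the list `S` of token-placements: variable `1` holds their number, and array
`3` their colors, one token-placement after the other. -/
def HoldsPlacements {n c : ℕ} (s : Store) (S : List (TokenPlacement (Fin n) c)) : Prop :=
  s.var 1 = S.length ∧
    ∀ (k : ℕ) (hk : k < S.length) (v : Fin n), s.arr 3 (k * n + (v : ℕ)) = (S[k].color v : ℕ)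

open Classical in
/-- The program `p` decides, in at most `C * n ^ 3` units of time and with numbers bounded by
`C * (n + 1) ^ C + ℓ`, whether the minimum length of a swapping sequence is at most the number `ℓ`
given in variable `1`.  The answer is left in variable `0`. -/
def DecidesInCubicTime (p : Prog) (C : ℕ) : Prop :=
  ∀ (n : ℕ) (G : SimpleGraph (Fin n)) (f₀ fₜ : TokenPlacement (Fin n) 2) (ℓ : ℕ),
    ∃ (t : ℕ) (s : Store),
      Exec (C * (n + 1) ^ C + ℓ) p ((inputStore G f₀ fₜ).setVar 1 ℓ) t s ∧
      t ≤ C * n ^ 3 ∧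
      s.var 0 = if TokenPlacement.opt G f₀ fₜ ≤ (ℓ : ℕ∞) then 1 else 0

/-- The program `p` constructs, in at most `C * n ^ 3` units of time and with numbers bounded by
`C * (n + 1) ^ C`, a swapping sequence of minimum length, or reports (by the value `0` of variable
`0`) that there is no swapping sequence at all. -/
def ConstructsInCubicTime (p : Prog) (C : ℕ) : Prop :=
  ∀ (n : ℕ) (G : SimpleGraph (Fin n)) (f₀ fₜ : TokenPlacement (Fin n) 2),
    ∃ (t : ℕ) (s : Store),
      Exec (C * (n + 1) ^ C) p (inputStore G f₀ fₜ) t s ∧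
      t ≤ C * n ^ 3 ∧
      ((s.var 0 = 0 ∧ ¬ ∃ S, TokenPlacement.IsSwappingSeq G f₀ fₜ S) ∨
        (s.var 0 = 1 ∧ ∃ S, TokenPlacement.IsSwappingSeq G f₀ fₜ S ∧
          (TokenPlacement.seqLen S : ℕ∞) = TokenPlacement.opt G f₀ fₜ ∧ HoldsPlacements s S))

end WordRAM

/-!
Call a vertex occupied if its token has color 2; on the word RAM these are the vertices whose
stored color is `1`. For lower bounds and matchings the tokens of color 1 are followed, for the
algorithm those of color 2; by symmetry this makes no difference.

**Matchings.** A swap changes a token-placement only if it moves exactly one token of color 1, by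
one edge. So a swapping sequence induces a perfect matching of weight at most its length
(`exists_matching_of_isChain`), which gives one inequality. For the other one, a color shift along
a path whose first vertex has color 2 and whose last vertex has color 1 exchanges these two colors
with as many swaps as the path has edges (`legal_colorShift`). The color shifts of a matching `M`
can be carried out one after the other if each of them finds its target free, that is, if the
token that was there at the beginning has already left. Such an order exists when `M` has minimum
weight (`IsMinWeight.exists_free`): otherwise some nonempty set of edges would permute its set of
sources without fixed points, and matching these sources with themselves would be cheaper.

**The algorithm.** It avoids both the distances and the matching and computes a minimum cost flow
on `G` itself, in which every edge has unit cost and unbounded capacity, the initially occupied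
vertices are the supply and the finally occupied ones the demand. The primal-dual method maintains
a potential `π` that differs by at most one along edges and a flow on arcs along which `π` drops
by exactly one (`IsPartialFlow`). All remaining supply sits at the maximal potential `K`, and all
remaining demand at potential `0`. A search along the residual arcs of reduced cost zero either
finds a vertex with remaining demand, and then the flow is augmented, or it finds a set whose
potential can be raised by one (`IsPartialFlow.raise`). If `K` reaches `n`, then one of the
potentials below `n` does not occur, and the vertices above it form a union of components with too
much supply (`IsPartialFlow.exists_closed`): there is no swapping sequence. Hence there are at
most `2 * n` rounds, each with a search in quadratic time.

The flow is realized by swaps one at a time: the unoccupied vertex with inflow that has the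
largest potential receives its inflow from occupied vertices only (`occupied_of_flow`), and a
token can be moved to it. Every such swap lowers the sum of the potentials of the occupied
vertices by one, and no swap can lower it by more, so the sequence is optimal
(`IsSwappingSeq.seqLen_eq_opt`). There are at most `n * n` swaps, each of which takes linear time
to find and to write down.

**Programs.** `Run` expresses total correctness with a time bound. All programs keep the numbers
in the memory below a quadratic bound, and since their expressions have bounded size, the values
of all subexpressions stay below a fixed power of it. `Prog.wp` handles code without loops,
`Run.loop` and `Run.forLoop` handle loops, and `Frame` records what a program leaves unchanged.
-/

namespace TokenPlacement

open SimpleGraph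

/-! ### Lower bound: a swapping sequence induces a matching -/

section LowerBound

variable {V : Type*} {G : SimpleGraph V}

theorem color_eq_one_of_ne_zero {f : TokenPlacement V 2} {v : V} (h : f.color v ≠ 0) :
    f.color v = 1 := by
  have := f.color v |>.isLt
  ext
  have h' : (f.color v : ℕ) ≠ 0 := fun h0 => h (Fin.ext h0)
  simp only [Fin.val_one]
  omega

theorem Adjacent.color_ne {c : ℕ} {f f' : TokenPlacement V c} {u v : V}
    (hne : f ≠ f') (hu : f'.color u = f.color v) (hv : f'.color v = f.color u)
    (hw : ∀ w : V, w ≠ u → w ≠ v → f'.color w = f.color w) : f.color u ≠ f.color v := by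
  intro h
  apply hne
  ext1
  funext w
  by_cases h1 : w = u
  · rw [h1, hu, h]
  by_cases h2 : w = v
  · rw [h2, hv, h]
  exact (hw w h1 h2).symm

theorem Adjacent.color_eq_swap [DecidableEq V] {c : ℕ} {f f' : TokenPlacement V c} {u v : V}
    (hu : f'.color u = f.color v) (hv : f'.color v = f.color u)
    (hw : ∀ w : V, w ≠ u → w ≠ v → f'.color w = f.color w) (x : V) :
    f'.color (Equiv.swap u v x) = f.color x := by
  by_cases h1 : x = u
  · rw [h1, Equiv.swap_apply_left, hv]
  by_cases h2 : x = v
  · rw [h2, Equiv.swap_apply_right, hu]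
  rw [Equiv.swap_apply_of_ne_of_ne h1 h2, hw x h1 h2]

variable [Fintype V]

theorem matchingWeight_trans_le {f g h : TokenPlacement V 2} (M : ColorOneMatching f g)
    (N : ColorOneMatching g h) :
    matchingWeight G (M.trans N) ≤ matchingWeight G M + matchingWeight G N := by
  have : matchingWeight G N = ∑ x : ColorOne f, G.edist (M x : V) (N (M x) : V) :=
    (Equiv.sum_comp M fun y => G.edist (y : V) (N y : V)).symm
  rw [this, matchingWeight, matchingWeight, ← Finset.sum_add_distrib]
  exact Finset.sum_le_sum fun x _ => SimpleGraph.edist_triangle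

/-- A single swap moves exactly one token of color 1, and moves it along an edge. -/
theorem Adjacent.exists_matching {f f' : TokenPlacement V 2} (h : Adjacent G f f') :
    ∃ M : ColorOneMatching f f', matchingWeight G M ≤ 1 := by
  classical
  obtain ⟨hne, u, v, huv, hu, hv, hw⟩ := h
  have hc := Adjacent.color_ne hne hu hv hw
  have hcol := Adjacent.color_eq_swap hu hv hw
  refine ⟨(Equiv.swap u v).subtypeEquiv fun x => by rw [hcol], ?_⟩
  obtain ⟨z, hz, hzo⟩ : ∃ z : V, f.color z = 0 ∧ ∀ x, x ≠ z → f.color x = 0 →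
      Equiv.swap u v x = x := by
    by_cases h0 : f.color u = 0
    · refine ⟨u, h0, fun x hx hx0 => Equiv.swap_apply_of_ne_of_ne hx ?_⟩
      rintro rfl
      exact hc (h0.trans hx0.symm)
    · refine ⟨v, ?_, fun x hx hx0 => Equiv.swap_apply_of_ne_of_ne ?_ hx⟩
      · by_contra h1
        exact hc ((color_eq_one_of_ne_zero h0).trans (color_eq_one_of_ne_zero h1).symm)
      · rintro rfl
        exact h0 hx0
  rw [matchingWeight, Finset.sum_eq_single (⟨z, hz⟩ : ColorOne f)]
  · show G.edist z (Equiv.swap u v z) ≤ 1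
    by_cases h1 : z = u
    · rw [h1, Equiv.swap_apply_left, SimpleGraph.edist_eq_one_iff_adj.mpr huv]
    by_cases h2 : z = v
    · rw [h2, Equiv.swap_apply_right, SimpleGraph.edist_eq_one_iff_adj.mpr huv.symm]
    rw [Equiv.swap_apply_of_ne_of_ne h1 h2]
    simp
  · intro x _ hx
    show G.edist (x : V) (Equiv.swap u v x) = 0
    rw [hzo x (fun h => hx (Subtype.ext h)) x.2]
    simp
  · simp

theorem exists_matching_of_isChain {S : List (TokenPlacement V 2)} :
    ∀ {f f' : TokenPlacement V 2}, IsSwappingSeq G f f' S →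
      ∃ M : ColorOneMatching f f', matchingWeight G M ≤ (seqLen S : ℕ∞) := by
  induction S with
  | nil => intro f f' h; simp [IsSwappingSeq] at h
  | cons a T ih =>
    rintro f f' ⟨h1, h2, h3⟩
    obtain rfl : a = f := by simpa using h1
    cases T with
    | nil =>
      obtain rfl : a = f' := by simpa using h2
      exact ⟨Equiv.refl _, by simp [matchingWeight]⟩
    | cons b R =>
      rw [List.isChain_cons_cons] at h3
      obtain ⟨N, hN⟩ := ih (f := b) (f' := f')
        ⟨by simp, by simpa [List.getLast?_cons_cons] using h2, h3.2⟩
      obtain ⟨M, hM⟩ := h3.1.exists_matching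
      refine ⟨M.trans N, (matchingWeight_trans_le M N).trans ?_⟩
      have : (seqLen (a :: b :: R) : ℕ∞) = 1 + (seqLen (b :: R) : ℕ∞) := by
        simp [seqLen, add_comm]
      rw [this]
      exact add_le_add hM hN

theorem iInf_matchingWeight_le_opt (f f' : TokenPlacement V 2) :
    (⨅ M : ColorOneMatching f f', matchingWeight G M) ≤ opt G f f' := by
  refine le_iInf₂ fun S hS => ?_
  obtain ⟨M, hM⟩ := exists_matching_of_isChain hS
  exact (iInf_le _ M).trans hM

end LowerBound

/-! ### Sequences of swaps -/

section Legal

variable {V : Type*} [DecidableEq V] {c : ℕ} {G : SimpleGraph V}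

/-- The swaps in the list `es`, carried out one after the other from `f` on, lead to `f'`, and each
of them leads from a token-placement to an adjacent one. -/
def Legal (G : SimpleGraph V) : TokenPlacement V c → List (V × V) → TokenPlacement V c → Prop
  | f, [], f' => f = f'
  | f, e :: es, f' => Adjacent G f (swapTokens f e) ∧ Legal G (swapTokens f e) es f'

theorem Legal.append {es es' : List (V × V)} : ∀ {f f' f'' : TokenPlacement V c},
    Legal G f es f' → Legal G f' es' f'' → Legal G f (es ++ es') f'' := by
  induction es with
  | nil => rintro f f' f'' rfl h; exact h
  | cons e es ih => rintro f f' f'' ⟨h1, h2⟩ h; exact ⟨h1, ih h2 h⟩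

theorem Legal.foldl_eq {es : List (V × V)} : ∀ {f f' : TokenPlacement V c},
    Legal G f es f' → es.foldl swapTokens f = f' := by
  induction es with
  | nil => rintro f f' rfl; rfl
  | cons e es ih => rintro f f' ⟨h1, h2⟩; exact ih h2

theorem Legal.isSwappingSeq {es : List (V × V)} : ∀ {f f' : TokenPlacement V c},
    Legal G f es f' → IsSwappingSeq G f f' (placements f es) := by
  induction es with
  | nil => rintro f f' rfl; simp [placements, IsSwappingSeq]
  | cons e es ih =>
    rintro f f' ⟨h1, h2⟩
    obtain ⟨ha, hb, hc⟩ := ih h2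
    have hp : placements f (e :: es) = f :: placements (swapTokens f e) es := by
      simp [placements]
    rw [hp]
    refine ⟨rfl, ?_, ?_⟩
    · cases hT : placements (swapTokens f e) es with
      | nil => rw [hT] at ha; simp at ha
      | cons b R => rw [hT] at hb; rw [List.getLast?_cons_cons]; exact hb
    · rw [List.isChain_cons]
      refine ⟨fun y hy => ?_, hc⟩
      rw [ha] at hy
      obtain rfl : swapTokens f e = y := by simpa using hy
      exact h1

theorem seqLen_placements (f : TokenPlacement V c) (es : List (V × V)) :
    seqLen (placements f es) = es.length := by
  simp [seqLen, placements]

theorem adjacent_swapTokens {f : TokenPlacement V c} {u v : V} (h : G.Adj u v)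
    (hc : f.color u ≠ f.color v) : Adjacent G f (swapTokens f (u, v)) := by
  refine ⟨fun he => hc ?_, u, v, h, ?_, ?_, fun w hu hv => ?_⟩
  · have := congrArg (fun g : TokenPlacement V c => g.color u) he
    simpa [swapTokens] using this
  · simp [swapTokens]
  · simp [swapTokens]
  · simp [swapTokens, Equiv.swap_apply_of_ne_of_ne hu hv]

end Legal

/-! ### Color shifts -/

section Shift

variable {V : Type*}

/-- The swaps that carry a token along the vertices of a list, from its first vertex to its last. -/
def carry : List V → List (V × V)
  | x :: y :: r => (y, x) :: carry (y :: r)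
  | _ => []

theorem length_carry : ∀ q : List V, (carry q).length = q.length - 1
  | [] => rfl
  | [_] => rfl
  | x :: y :: r => by simp [carry, length_carry (y :: r)]

variable [DecidableEq V] {G : SimpleGraph V}

/-- Carrying a token of color 1 over tokens of color 2 exchanges the two ends of the list. -/
theorem legal_carry : ∀ (r : List V) (x : V) (h : TokenPlacement V 2),
    (x :: r).IsChain G.Adj → (x :: r).Nodup → h.color x = 0 → (∀ y ∈ r, h.color y ≠ 0) →
    ∃ h' : TokenPlacement V 2, Legal G h (carry (x :: r)) h' ∧
      ∀ v, h'.color v = if v = (x :: r).getLast (by simp) then 0 else if v = x then 1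
        else h.color v
  | [], x, h, _, _, hx, _ => ⟨h, rfl, fun v => by
      by_cases hv : v = x <;> simp [hv, hx]⟩
  | y :: r, x, h, hch, hnd, hx, hr => by
    rw [List.isChain_cons_cons] at hch
    have hxy : x ≠ y := fun e => by simp [e] at hnd
    have hy : h.color y = 1 := color_eq_one_of_ne_zero (hr y (by simp))
    have hnd' := (List.nodup_cons.mp hnd).2
    have hxr : x ∉ y :: r := (List.nodup_cons.mp hnd).1
    have hyr : y ∉ r := (List.nodup_cons.mp hnd').1
    have hcol : ∀ v, (swapTokens h (y, x)).color v =
        if v = y then 0 else if v = x then 1 else h.color v := by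
      intro v
      by_cases h1 : v = y
      · simp [swapTokens, h1, hx]
      by_cases h2 : v = x
      · simp [swapTokens, h2, hy, hxy]
      simp [swapTokens, h1, h2, Equiv.swap_apply_of_ne_of_ne h1 h2]
    obtain ⟨h', hl, hc⟩ := legal_carry r y (swapTokens h (y, x)) hch.2 hnd'
      (by rw [hcol]; simp) (fun z hz => by
        have h1 : z ≠ y := fun e => hyr (e ▸ hz)
        have h2 : z ≠ x := fun e => hxr (e ▸ List.mem_cons_of_mem _ hz)
        rw [hcol, if_neg h1, if_neg h2]
        exact hr z (List.mem_cons_of_mem _ hz))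
    refine ⟨h', ⟨adjacent_swapTokens hch.1.symm (by rw [hx, hy]; decide), hl⟩, fun v => ?_⟩
    have hlast : (x :: y :: r).getLast (by simp) = (y :: r).getLast (by simp) :=
      List.getLast_cons (by simp)
    rw [hc, hlast, hcol]
    by_cases h1 : v = (y :: r).getLast (by simp)
    · rw [if_pos h1, if_pos h1]
    rw [if_neg h1, if_neg h1]
    by_cases h2 : v = y
    · rw [if_pos h2, if_neg (by rw [h2]; exact hxy.symm), h2, hy]
    · rw [if_neg h2, if_neg h2]

/-- The effect of `colorShiftAux`: `q` is the part of the path that has been read, in reverse order,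
and only agreement of `f` with the current token-placement `h` on the unread part `l` matters. -/
theorem legal_colorShiftAux (f : TokenPlacement V 2) : ∀ (l q : List V) (a : V)
    (h : TokenPlacement V 2),
    (a :: l).IsChain G.Adj → (a :: q).IsChain G.Adj → (l.reverse ++ a :: q).Nodup →
    (∀ y ∈ a :: q, h.color y ≠ 0) → (∀ y ∈ l, f.color y = h.color y) →
    (∀ hl : l ≠ [], f.color (l.getLast hl) = 0) → l ≠ [] →
    ∃ h' : TokenPlacement V 2, Legal G h (colorShiftAux f (carry (a :: q)) (a :: l)) h' ∧
      (colorShiftAux f (carry (a :: q)) (a :: l)).length = q.length + l.length ∧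
      ∀ v, h'.color v = if v = (a :: q).getLast (by simp) then 0
        else if v = (a :: l).getLast (by simp) then 1 else h.color v
  | [], _, _, _, _, _, _, _, _, _, hne => absurd rfl hne
  | b :: l, q, a, h, hl, hq, hnd, hcol, hfh, hlast, _ => by
    have hab : G.Adj a b := (List.isChain_cons_cons.mp hl).1
    have hbl : (b :: l).IsChain G.Adj := (List.isChain_cons_cons.mp hl).2
    have hbq : (b :: a :: q).IsChain G.Adj := List.isChain_cons_cons.mpr ⟨hab.symm, hq⟩
    have hnd1 : (l.reverse ++ b :: a :: q).Nodup := by simpa using hnd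
    have hnd2 := (List.nodup_append.mp hnd1).2.1
    have hdis := (List.nodup_append.mp hnd1).2.2
    have hbaq : b ∉ a :: q := (List.nodup_cons.mp hnd2).1
    have hlastl : ((a :: b :: l).getLast (by simp)) = (b :: l).getLast (by simp) :=
      List.getLast_cons (by simp)
    have hlastq : ((b :: a :: q).getLast (by simp)) = (a :: q).getLast (by simp) :=
      List.getLast_cons (by simp)
    by_cases hb : f.color b = 0
    · have hhb : h.color b = 0 := by rw [← hfh b (by simp), hb]
      obtain ⟨h1, hleg1, hc1⟩ := legal_carry (a :: q) b h hbq hnd2 hhb hcol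
      have hes : colorShiftAux f (carry (a :: q)) (a :: b :: l) =
          carry (b :: a :: q) ++ colorShiftAux f [] (b :: l) := by
        simp [colorShiftAux, hb, carry]
      rw [hes]
      rw [hlastq] at hc1
      have htop : (a :: q).getLast (by simp) ∈ a :: q := List.getLast_mem _
      by_cases hl0 : l = []
      · subst hl0
        refine ⟨h1, by simpa [colorShiftAux] using hleg1, ?_, fun v => ?_⟩
        · simp [colorShiftAux, length_carry]
        · rw [hc1, hlastl]; rfl
      · have hbt : b ≠ (a :: q).getLast (by simp) := fun e => hbaq (e.symm ▸ htop)
        have hb1 : h1.color b = 1 := by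
          rw [hc1, if_neg hbt, if_pos rfl]
        have hbll : b ∉ l := fun hm => hdis b (by simpa using hm) b (by simp) rfl
        have hfh1 : ∀ y ∈ l, f.color y = h1.color y := by
          intro y hy
          rw [hc1, if_neg, if_neg]
          · exact hfh y (by simp [hy])
          · rintro rfl; exact hbll hy
          · rintro rfl
            exact hdis _ (by simpa using hy) _ (List.mem_cons_of_mem _ htop) rfl
        obtain ⟨h2, hleg2, hlen2, hc2⟩ := legal_colorShiftAux f l [] b h1 hbl (by simp)
          (by
            have : (l.reverse ++ [b]).Sublist (l.reverse ++ b :: a :: q) := by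
              apply List.Sublist.append_left; simp
            exact hnd1.sublist this)
          (by simp [hb1]) hfh1 (fun hne => by
            rw [← hlast (by simp), List.getLast_cons hne]) hl0
        refine ⟨h2, hleg1.append hleg2, ?_, fun v => ?_⟩
        · simp only [carry] at hlen2
          simp only [List.length_append, hlen2, length_carry, List.length_cons, List.length_nil]
          omega
        · have hc2' : ∀ v, h2.color v = if v = b then 0 else
              if v = (b :: l).getLast (by simp) then 1 else h1.color v := hc2
          rw [hc2', hlastl]
          have hlm : (b :: l).getLast (by simp) ∈ l := by
            rw [List.getLast_cons hl0]; exact List.getLast_mem _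
          have hlb : (b :: l).getLast (by simp) ≠ b := fun e => hbll (e ▸ hlm)
          have hlt : (b :: l).getLast (by simp) ≠ (a :: q).getLast (by simp) := fun e =>
            hdis _ (by simpa using hlm) _ (List.mem_cons_of_mem _ htop) e
          by_cases hv1 : v = b
          · rw [if_pos hv1, if_neg (hv1 ▸ hbt), if_neg (hv1 ▸ hlb.symm), hv1, hhb]
          rw [if_neg hv1]
          by_cases hv2 : v = (b :: l).getLast (by simp)
          · rw [if_pos hv2, if_neg (hv2 ▸ hlt), if_pos hv2]
          · rw [if_neg hv2, if_neg hv2, hc1, if_neg hv1]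
    · have hes : colorShiftAux f (carry (a :: q)) (a :: b :: l) =
          colorShiftAux f (carry (b :: a :: q)) (b :: l) := by
        simp [colorShiftAux, hb, carry]
      have hl0 : l ≠ [] := by
        rintro rfl
        exact hb (by simpa using hlast (by simp))
      obtain ⟨h', hleg, hlen, hc⟩ := legal_colorShiftAux f l (a :: q) b h hbl hbq hnd1
        (fun y hy => by
          rcases List.mem_cons.mp hy with rfl | hy
          · rw [← hfh y (by simp)]; exact hb
          · exact hcol y hy)
        (fun y hy => hfh y (by simp [hy]))
        (fun hne => by rw [← hlast (by simp), List.getLast_cons hne]) hl0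
      rw [hes]
      refine ⟨h', hleg, ?_, fun v => ?_⟩
      · rw [hlen]; simp only [List.length_cons]; omega
      · rw [hc, hlastq, hlastl]

/-- The color shift along a path from `y` (color 2) to `x` (color 1) exchanges the colors of its
ends and makes as many swaps as the path has edges. -/
theorem legal_colorShift {x y : V} (p : G.Walk y x) (hp : p.IsPath) (hne : y ≠ x)
    (f : TokenPlacement V 2) (hy : f.color y ≠ 0) (hx : f.color x = 0) :
    ∃ f' : TokenPlacement V 2, Legal G f (colorShift f p.support) f' ∧
      (colorShift f p.support).length = p.length ∧
      ∀ v, f'.color v = if v = y then 0 else if v = x then 1 else f.color v := by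
  cases p with
  | nil => exact absurd rfl hne
  | @cons _ w _ hadj r =>
    have hsup : (Walk.cons hadj r).support = y :: r.support := Walk.support_cons ..
    have hnd := hp.support_nodup
    rw [hsup] at hnd
    have hch : (y :: r.support).IsChain G.Adj := by
      rw [← hsup]; exact Walk.isChain_adj_support _
    have hrl : r.support.getLast (Walk.support_ne_nil _) = x := Walk.getLast_support _
    obtain ⟨f', hl, hlen, hc⟩ := legal_colorShiftAux (G := G) f r.support [] y f hch (by simp)
      (by
        rw [← List.nodup_reverse]
        simpa using hnd)
      (by simpa using hy) (fun _ _ => rfl) (fun hl => by rw [hrl]; exact hx)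
      (Walk.support_ne_nil _)
    refine ⟨f', ?_, ?_, fun v => ?_⟩
    · rw [hsup]; exact hl
    · rw [hsup]
      have : (colorShift f (y :: r.support)).length = [].length + r.support.length := hlen
      rw [this]; simp
    · rw [hc, List.getLast_cons (Walk.support_ne_nil _), hrl]; rfl

end Shift

end TokenPlacement

namespace TokenPlacement

open SimpleGraph

/-! ### Matchings of finite weight -/

/-- Two families over `γ` with equinumerous fibres are isomorphic over `γ`. -/
theorem exists_equiv_of_card_fiber_eq {α β γ : Type*} [Finite α] [Finite β] (a : α → γ) (b : β → γ)
    (h : ∀ k, Nat.card {x // a x = k} = Nat.card {y // b y = k}) :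
    ∃ e : α ≃ β, ∀ x, b (e x) = a x := by
  have E : ∀ k, Nonempty ({x // a x = k} ≃ {y // b y = k}) := fun k =>
    Finite.card_eq.mp (h k)
  refine ⟨(Equiv.sigmaFiberEquiv a).symm.trans
    ((Equiv.sigmaCongrRight fun k => (E k).some).trans (Equiv.sigmaFiberEquiv b)), fun x => ?_⟩
  exact ((E (a x)).some ⟨x, rfl⟩).2

section

variable {V : Type*} [Fintype V] {G : SimpleGraph V} {f₀ fₜ : TokenPlacement V 2}

theorem matchingWeight_ne_top_iff {M : ColorOneMatching f₀ fₜ} :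
    matchingWeight G M ≠ ⊤ ↔ ∀ x : ColorOne f₀, G.edist (x : V) (M x : V) ≠ ⊤ := by
  have h : (∑ x : ColorOne f₀, G.edist (x : V) (M x : V)) = ⊤ ↔ _ := WithTop.sum_eq_top
  rw [matchingWeight, ne_eq, h]
  simp only [Finset.mem_univ, true_and, not_exists]
  rfl

theorem SameColorCounts.exists_matching (h : SameColorCounts G f₀ fₜ) :
    ∃ M : ColorOneMatching f₀ fₜ, matchingWeight G M ≠ ⊤ := by
  classical
  obtain ⟨M, hM⟩ := exists_equiv_of_card_fiber_eq
    (fun x : ColorOne f₀ => G.connectedComponentMk (x : V))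
    (fun x : ColorOne fₜ => G.connectedComponentMk (x : V)) (fun K => by
      have key : ∀ f : TokenPlacement V 2,
          Nat.card {x : ColorOne f // G.connectedComponentMk (x : V) = K} =
            {v : V | G.connectedComponentMk v = K ∧ f.color v = 0}.ncard := by
        intro f
        rw [← Nat.card_coe_set_eq]
        exact Nat.card_congr ((Equiv.subtypeSubtypeEquivSubtypeInter
          (fun v : V => f.color v = 0) (fun v => G.connectedComponentMk v = K)).trans
          (Equiv.subtypeEquivRight fun v => and_comm))
      rw [key, key]
      exact h K 0)
  refine ⟨M, ?_⟩
  rw [matchingWeight_ne_top_iff]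
  intro x
  exact SimpleGraph.edist_ne_top_iff_reachable.mpr
    (SimpleGraph.ConnectedComponent.exact (hM x)).symm

end

/-! ### The order of the color shifts -/

section FreeOrder

variable {V : Type*} [DecidableEq V] {G : SimpleGraph V} {f₀ fₜ : TokenPlacement V 2}

/-- In the order `L`, after the edges in `D`, each edge finds its target free. -/
def IsFreeOrder (M : ColorOneMatching f₀ fₜ) :
    Finset (ColorOne f₀) → List (ColorOne f₀) → Prop
  | _, [] => True
  | D, x :: L => x ∉ D ∧ (∀ x' : ColorOne f₀, (x' : V) = M x → x' ∈ D ∨ x' = x) ∧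
      IsFreeOrder M (insert x D) L

theorem IsFreeOrder.nodup {M : ColorOneMatching f₀ fₜ} {L : List (ColorOne f₀)} :
    ∀ {D : Finset (ColorOne f₀)}, IsFreeOrder M D L → L.Nodup ∧ ∀ x ∈ L, x ∉ D := by
  induction L with
  | nil => intro D _; simp
  | cons x L ih =>
    rintro D ⟨h1, _, h3⟩
    obtain ⟨hn, hd⟩ := ih h3
    refine ⟨List.nodup_cons.mpr ⟨fun hx => hd x hx (Finset.mem_insert_self _ _), hn⟩,
      fun y hy => ?_⟩
    rcases List.mem_cons.mp hy with rfl | hy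
    · exact h1
    · exact fun hyD => hd y hy (Finset.mem_insert_of_mem hyD)

/-- Carrying out the color shifts of a free order: `D` is the set of edges that are done. -/
theorem IsFreeOrder.legal_colorShifts {M : ColorOneMatching f₀ fₜ}
    (P : (x : ColorOne f₀) → G.Walk (M x : V) (x : V)) (hP : ∀ x, (P x).IsPath)
    (L : List (ColorOne f₀)) : ∀ (D : Finset (ColorOne f₀)) (h : TokenPlacement V 2),
      IsFreeOrder M D L →
      (∀ z ∈ D, ∀ x' : ColorOne f₀, (x' : V) = M z → x' ∈ D) →
      (∀ v, h.color v = 0 ↔ (∃ x : ColorOne f₀, x ∉ D ∧ (x : V) = v) ∨ ∃ x ∈ D, (M x : V) = v) →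
      ∃ h' : TokenPlacement V 2,
        Legal G h (colorShifts h (L.map fun x => (P x).support)) h' ∧
        (colorShifts h (L.map fun x => (P x).support)).length =
          (L.map fun x => (P x).length).sum ∧
        ∀ v, h'.color v = 0 ↔
          (∃ x : ColorOne f₀, (x ∉ D ∧ x ∉ L) ∧ (x : V) = v) ∨
            ∃ x : ColorOne f₀, (x ∈ D ∨ x ∈ L) ∧ (M x : V) = v := by
  induction L with
  | nil => intro D h _ _ hD; exact ⟨h, rfl, rfl, by simpa using hD⟩
  | cons x L ih =>
    rintro D h ⟨hxD, hfree, hL⟩ hcl hD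
    have hx0 : h.color (x : V) = 0 := (hD x).mpr (Or.inl ⟨x, hxD, rfl⟩)
    -- the effect of the color shift along the path of `x`
    obtain ⟨h1, hleg, hlen, hcol⟩ : ∃ h1 : TokenPlacement V 2,
        Legal G h (colorShift h (P x).support) h1 ∧
        (colorShift h (P x).support).length = (P x).length ∧
        ∀ v, h1.color v = 0 ↔ v = M x ∨ (v ≠ x ∧ h.color v = 0) := by
      by_cases hxy : (M x : V) = x
      · have hlen0 : (P x).length = 0 := by
          have := hP x
          generalize P x = p at this
          revert p
          rw [hxy]
          intro p hp
          rw [Walk.isPath_iff_nil] at hp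
          exact Walk.length_eq_zero_iff.mpr hp
        have hsup : ∃ a, (P x).support = [a] :=
          List.length_eq_one_iff.mp (by rw [Walk.length_support, hlen0])
        obtain ⟨a, ha⟩ := hsup
        refine ⟨h, by rw [ha]; rfl, by rw [ha, hlen0]; rfl, fun v => ?_⟩
        by_cases hv : v = x
        · simp [hv, hxy, hx0]
        · simp [hv, hxy]
      · have hy1 : h.color (M x : V) ≠ 0 := by
          rw [ne_eq, hD]
          rintro (⟨z, hz, hzv⟩ | ⟨z, hz, hzv⟩)
          · rcases hfree z hzv with h1 | h1
            · exact hz h1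
            · exact hxy (by rw [← hzv, h1])
          · have : z = x := M.injective (Subtype.ext hzv)
            exact hxD (this ▸ hz)
        obtain ⟨h1, hl, hlen, hc⟩ := legal_colorShift (P x) (hP x) hxy h hy1 hx0
        refine ⟨h1, hl, hlen, fun v => ?_⟩
        rw [hc]
        by_cases hv : v = M x
        · simp [hv]
        · by_cases hv' : v = x
          · simp [hv', Ne.symm hxy]
          · simp [hv, hv']
    obtain ⟨h2, hleg2, hlen2, hcol2⟩ := ih (insert x D) h1 hL (fun z hz x' hx' => by
      rcases Finset.mem_insert.mp hz with rfl | hz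
      · rcases hfree x' hx' with h | rfl
        · exact Finset.mem_insert_of_mem h
        · exact Finset.mem_insert_self _ _
      · exact Finset.mem_insert_of_mem (hcl z hz x' hx')) (fun v => by
      rw [hcol, hD]
      constructor
      · rintro (rfl | ⟨hv, ⟨z, hz, rfl⟩ | ⟨z, hz, rfl⟩⟩)
        · exact Or.inr ⟨x, by simp, rfl⟩
        · refine Or.inl ⟨z, ?_, rfl⟩
          rw [Finset.mem_insert]
          rintro (rfl | h)
          · exact hv rfl
          · exact hz h
        · exact Or.inr ⟨z, by simp [hz], rfl⟩
      · rintro (⟨z, hz, rfl⟩ | ⟨z, hz, rfl⟩)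
        · rw [Finset.mem_insert, not_or] at hz
          exact Or.inr ⟨fun e => hz.1 (Subtype.ext e), Or.inl ⟨z, hz.2, rfl⟩⟩
        · rcases Finset.mem_insert.mp hz with rfl | hz
          · exact Or.inl rfl
          · exact Or.inr ⟨fun hzx => hxD (hcl z hz x hzx.symm), Or.inr ⟨z, hz, rfl⟩⟩)
    refine ⟨h2, ?_, ?_, fun v => ?_⟩
    · simp only [List.map_cons, colorShifts]
      rw [hleg.foldl_eq]
      exact hleg.append hleg2
    · simp only [List.map_cons, colorShifts, List.length_append, List.sum_cons]
      rw [hleg.foldl_eq, hlen, hlen2]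
    · rw [hcol2]
      simp only [Finset.mem_insert, List.mem_cons, not_or]
      constructor
      · rintro (⟨z, ⟨⟨h1, h2⟩, h3⟩, rfl⟩ | ⟨z, h, rfl⟩)
        · exact Or.inl ⟨z, ⟨h2, h1, h3⟩, rfl⟩
        · exact Or.inr ⟨z, by tauto, rfl⟩
      · rintro (⟨z, ⟨h2, h1, h3⟩, rfl⟩ | ⟨z, h, rfl⟩)
        · exact Or.inl ⟨z, ⟨⟨h1, h2⟩, h3⟩, rfl⟩
        · exact Or.inr ⟨z, by tauto, rfl⟩

end FreeOrder

section

variable {V : Type*} [Fintype V] {G : SimpleGraph V} {f₀ fₜ : TokenPlacement V 2}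

/-- A matching of minimum weight has no cyclic chain of conflicts: if some edges are still to be
carried out, one of them has a free target.  Otherwise the targets of these edges would be their
sources again, and matching each source with itself would be cheaper. -/
theorem IsMinWeight.exists_free {M : ColorOneMatching f₀ fₜ} (hM : IsMinWeight G M)
    (hw : matchingWeight G M ≠ ⊤) (D : Finset (ColorOne f₀)) (hD : ∃ x, x ∉ D) :
    ∃ x, x ∉ D ∧ ∀ x' : ColorOne f₀, (x' : V) = M x → x' ∈ D ∨ x' = x := by
  classical
  by_contra hcon
  push Not at hcon
  choose! σ hσ1 hσ2 hσ3 using hcon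
  -- `σ` permutes the complement of `D`
  have hinj : Set.InjOn σ (Dᶜ : Finset (ColorOne f₀)) := by
    intro x hx y hy hxy
    simp only [Finset.coe_compl, Set.mem_compl_iff, Finset.mem_coe] at hx hy
    apply M.injective
    apply Subtype.ext
    rw [← hσ1 x hx, ← hσ1 y hy, hxy]
  have hmaps : Set.MapsTo σ (Dᶜ : Finset (ColorOne f₀)) (Dᶜ : Finset (ColorOne f₀)) := by
    intro x hx
    simp only [Finset.coe_compl, Set.mem_compl_iff, Finset.mem_coe] at hx ⊢
    exact hσ2 x hx
  have hsurj := Finset.surjOn_of_injOn_of_card_le σ hmaps hinj le_rfl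
  have htgt : ∀ x, x ∉ D → ∃ z, z ∉ D ∧ (M z : V) = x := by
    intro x hx
    obtain ⟨z, hz, rfl⟩ := hsurj (show x ∈ ((Dᶜ : Finset (ColorOne f₀)) : Set _) by simpa using hx)
    have hz' : z ∉ D := by simpa using hz
    exact ⟨z, hz', (hσ1 z hz').symm⟩
  have hcol : ∀ x : ColorOne f₀, x ∉ D → fₜ.color (x : V) = 0 := by
    intro x hx
    obtain ⟨z, _, hz⟩ := htgt x hx
    rw [← hz]; exact (M z).2
  let F : ColorOne f₀ → ColorOne fₜ := fun x => if hx : x ∈ D then M x else ⟨x, hcol x hx⟩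
  have hF1 : ∀ x ∈ D, F x = M x := fun x hx => dif_pos hx
  have hF2 : ∀ x, x ∉ D → (F x : V) = x := fun x hx => by
    simp only [F, dif_neg hx]
  have hcross : ∀ x y, x ∈ D → y ∉ D → F x ≠ F y := by
    intro x y hx hy he
    obtain ⟨z, hz, hzy⟩ := htgt y hy
    have : M x = M z := by
      apply Subtype.ext
      rw [← hF1 x hx, he, hF2 y hy, hzy]
    exact hz (M.injective this ▸ hx)
  have hFinj : Function.Injective F := by
    intro x y hxy
    by_cases hx : x ∈ D <;> by_cases hy : y ∈ D
    · rw [hF1 x hx, hF1 y hy] at hxy; exact M.injective hxy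
    · exact absurd hxy (hcross x y hx hy)
    · exact absurd hxy.symm (hcross y x hy hx)
    · apply Subtype.ext
      rw [← hF2 x hx, ← hF2 y hy, hxy]
  have hbij : Function.Bijective F :=
    (Fintype.bijective_iff_injective_and_card F).mpr ⟨hFinj, Fintype.card_congr M⟩
  have hle := hM (Equiv.ofBijective F hbij)
  obtain ⟨x₀, hx₀⟩ := hD
  refine absurd hle (not_le.mpr ?_)
  rw [matchingWeight_ne_top_iff] at hw
  choose d hd using fun x => ENat.ne_top_iff_exists.mp (hw x)
  have h1 : matchingWeight G M = ((∑ x, d x : ℕ) : ℕ∞) := by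
    rw [matchingWeight, Nat.cast_sum]
    exact Finset.sum_congr rfl fun x _ => (hd x).symm
  have h2 : matchingWeight G (Equiv.ofBijective F hbij) =
      ((∑ x, (if x ∈ D then d x else 0) : ℕ) : ℕ∞) := by
    rw [matchingWeight, Nat.cast_sum]
    refine Finset.sum_congr rfl fun x _ => ?_
    show G.edist (x : V) (F x : V) = _
    by_cases hx : x ∈ D
    · rw [if_pos hx, hF1 x hx, hd]
    · rw [if_neg hx, hF2 x hx]; simp
  rw [h1, h2, Nat.cast_lt]
  refine Finset.sum_lt_sum (fun x _ => ?_) ⟨x₀, Finset.mem_univ _, ?_⟩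
  · split_ifs <;> simp
  · rw [if_neg hx₀, Nat.pos_iff_ne_zero]
    intro h0
    have he : G.edist (x₀ : V) (M x₀ : V) = 0 := by rw [← hd, h0]; rfl
    rw [SimpleGraph.edist_eq_zero_iff] at he
    exact hσ3 x₀ hx₀ (Subtype.ext ((hσ1 x₀ hx₀).trans he.symm))

theorem IsMinWeight.exists_isFreeOrder [DecidableEq V] {M : ColorOneMatching f₀ fₜ}
    (hM : IsMinWeight G M) (hw : matchingWeight G M ≠ ⊤) : ∀ (k : ℕ) (D : Finset (ColorOne f₀)),
      Dᶜ.card = k → ∃ L : List (ColorOne f₀), IsFreeOrder M D L ∧ ∀ x, x ∈ D ∨ x ∈ L := by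
  intro k
  induction k with
  | zero =>
    intro D hD
    refine ⟨[], trivial, fun x => Or.inl ?_⟩
    rw [Finset.card_eq_zero, Finset.compl_eq_empty_iff] at hD
    rw [hD]; exact Finset.mem_univ x
  | succ k ih =>
    intro D hD
    have hne : ∃ x, x ∉ D := by
      obtain ⟨x, hx⟩ := Finset.card_pos.mp (by rw [hD]; exact Nat.succ_pos k)
      exact ⟨x, Finset.mem_compl.mp hx⟩
    obtain ⟨x, hx, hfree⟩ := hM.exists_free hw D hne
    obtain ⟨L, hL, hall⟩ := ih (insert x D) (by
      rw [Finset.compl_insert, Finset.card_erase_of_mem (Finset.mem_compl.mpr hx), hD]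
      rfl)
    refine ⟨x :: L, ⟨hx, hfree, hL⟩, fun y => ?_⟩
    rcases hall y with h | h
    · rcases Finset.mem_insert.mp h with rfl | h
      · exact Or.inr (by simp)
      · exact Or.inl h
    · exact Or.inr (List.mem_cons_of_mem _ h)

/-- The color shifts along shortest paths realize every matching of minimum weight. -/
theorem IsMinWeight.exists_order [DecidableEq V] {M : ColorOneMatching f₀ fₜ}
    (hM : IsMinWeight G M) (hw : matchingWeight G M ≠ ⊤) :
    ∃ L : List (ColorOne f₀), L.Nodup ∧ (∀ x, x ∈ L) ∧
      ∀ P : (x : ColorOne f₀) → G.Walk (M x : V) (x : V),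
        (∀ x, ((P x).length : ℕ∞) = G.edist (x : V) (M x : V)) →
        IsSwappingSeq G f₀ fₜ
          (placements f₀ (colorShifts f₀ (L.map fun x => (P x).support))) ∧
        (seqLen (placements f₀ (colorShifts f₀ (L.map fun x => (P x).support))) : ℕ∞) =
          matchingWeight G M := by
  obtain ⟨L, hL, hall⟩ := hM.exists_isFreeOrder hw _ ∅ rfl
  have hmem : ∀ x, x ∈ L := fun x => (hall x).resolve_left (Finset.notMem_empty x)
  refine ⟨L, hL.nodup.1, hmem, fun P hP => ?_⟩
  obtain ⟨h', hleg, hlen, hcol⟩ := hL.legal_colorShifts P (fun x => by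
    apply Walk.isPath_of_length_eq_dist
    rw [SimpleGraph.dist_comm, SimpleGraph.dist, ← hP, ENat.toNat_natCast]) L ∅ f₀ (by simp)
    (fun v => by simp)
  have hfin : h' = fₜ := by
    ext1
    funext v
    have h0 : h'.color v = 0 ↔ fₜ.color v = 0 := by
      rw [hcol]
      constructor
      · rintro (⟨x, hx, _⟩ | ⟨x, _, rfl⟩)
        · exact absurd (hmem x) hx.2
        · exact (M x).2
      · intro hv
        exact Or.inr ⟨M.symm ⟨v, hv⟩, Or.inr (hmem _), by simp⟩
    by_cases hv : fₜ.color v = 0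
    · rw [hv, h0.mpr hv]
    · rw [color_eq_one_of_ne_zero hv, color_eq_one_of_ne_zero (fun h => hv (h0.mp h))]
  subst hfin
  refine ⟨hleg.isSwappingSeq, ?_⟩
  rw [seqLen_placements, hlen, matchingWeight]
  have huniv : L.toFinset = Finset.univ := Finset.eq_univ_iff_forall.mpr fun x => by
    simpa using hmem x
  rw [← List.sum_toFinset _ hL.nodup.1, huniv, Nat.cast_sum]
  exact Finset.sum_congr rfl fun x _ => hP x

theorem IsMinWeight.matchingWeight_eq_iInf {M : ColorOneMatching f₀ fₜ} (hM : IsMinWeight G M) :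
    matchingWeight G M = ⨅ M' : ColorOneMatching f₀ fₜ, matchingWeight G M' :=
  le_antisymm (le_iInf hM) (iInf_le _ M)

theorem opt_eq_iInf_matchingWeight (G : SimpleGraph V) (f₀ fₜ : TokenPlacement V 2) :
    opt G f₀ fₜ = ⨅ M : ColorOneMatching f₀ fₜ, matchingWeight G M := by
  classical
  refine le_antisymm ?_ (iInf_matchingWeight_le_opt f₀ fₜ)
  by_cases hne : Nonempty (ColorOneMatching f₀ fₜ)
  · obtain ⟨M, hM⟩ : ∃ M : ColorOneMatching f₀ fₜ, IsMinWeight G M :=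
      Finite.exists_min fun M : ColorOneMatching f₀ fₜ => matchingWeight G M
    rw [← hM.matchingWeight_eq_iInf]
    by_cases hw : matchingWeight G M = ⊤
    · rw [hw]; exact le_top
    obtain ⟨L, _, _, hL⟩ := hM.exists_order hw
    have hP : ∀ x : ColorOne f₀, ∃ p : G.Walk (M x : V) (x : V),
        (p.length : ℕ∞) = G.edist (x : V) (M x : V) := fun x => by
      rw [SimpleGraph.edist_comm]
      apply SimpleGraph.exists_walk_of_edist_ne_top
      rw [SimpleGraph.edist_comm]
      exact matchingWeight_ne_top_iff.mp hw x
    choose P hP using hP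
    obtain ⟨hS, hlen⟩ := hL P hP
    rw [← hlen]
    exact iInf₂_le _ hS
  · rw [not_nonempty_iff] at hne
    rw [iInf_of_empty]; exact le_top

end

end TokenPlacement

namespace WordRAM

/-! ### Reasoning about word RAM programs -/

/-- The number of nodes of an expression, a bound for the degree of its value. -/
def Expr.size : Expr → ℕ
  | .const _ => 1
  | .var _ => 1
  | .read _ i => i.size + 1
  | .op _ e₁ e₂ => e₁.size + e₂.size + 1

/-- The expression has no literals but `0` and `1`. -/
def Expr.lit : Expr → Bool
  | .const k => k ≤ 1
  | .var _ => true
  | .read _ i => i.lit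
  | .op _ e₁ e₂ => e₁.lit && e₂.lit

/-- The expression has at most `30` nodes and no literals but `0` and `1`, so that its value is at
most `B ^ 30` in a memory whose entries are at most `B`. -/
def Expr.ok (e : Expr) : Bool := e.lit && e.size ≤ 30

/-- All expressions of the program satisfy `Expr.ok`. -/
def Prog.ok : Prog → Bool
  | .skip => true
  | .assign _ e => e.ok
  | .write _ i e => i.ok && e.ok
  | .seq p q => p.ok && q.ok
  | .ite e p q => e.ok && p.ok && q.ok
  | .loop e p => e.ok && p.ok

/-- The program has an assignment to the variable `x`. -/
def Prog.setsVar (x : ℕ) : Prog → Bool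
  | .skip => false
  | .assign y _ => y == x
  | .write _ _ _ => false
  | .seq p q => p.setsVar x || q.setsVar x
  | .ite _ p q => p.setsVar x || q.setsVar x
  | .loop _ p => p.setsVar x

/-- The program writes to the array `a`. -/
def Prog.setsArr (a : ℕ) : Prog → Bool
  | .skip => false
  | .assign _ _ => false
  | .write b _ _ => b == a
  | .seq p q => p.setsArr a || q.setsArr a
  | .ite _ p q => p.setsArr a || q.setsArr a
  | .loop _ p => p.setsArr a

/-- All variables and all cells hold numbers that are at most `B`. -/
structure Bounded (B : ℕ) (s : Store) : Prop where
  var : ∀ x, s.var x ≤ B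
  arr : ∀ a i, s.arr a i ≤ B

/-- The memories `s` and `s'` differ only in places that the program `p` changes. -/
structure Frame (p : Prog) (s s' : Store) : Prop where
  var : ∀ x, p.setsVar x = false → s'.var x = s.var x
  arr : ∀ a, p.setsArr a = false → s'.arr a = s.arr a

theorem Frame.refl (p : Prog) (s : Store) : Frame p s s := ⟨fun _ _ => rfl, fun _ _ => rfl⟩

theorem Frame.trans {p : Prog} {s s' s'' : Store} (h : Frame p s s') (h' : Frame p s' s'') :
    Frame p s s'' :=
  ⟨fun x hx => (h'.var x hx).trans (h.var x hx), fun a ha => (h'.arr a ha).trans (h.arr a ha)⟩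

theorem Exec.frame {W : ℕ} {p : Prog} {s s' : Store} {t : ℕ} (h : Exec W p s t s') :
    Frame p s s' := by
  induction h with
  | skip s => exact Frame.refl _ _
  | assign x e s he =>
    refine ⟨fun y hy => ?_, fun _ _ => rfl⟩
    have : y ≠ x := by rintro rfl; simp [Prog.setsVar] at hy
    simp [Store.setVar, Function.update_of_ne this]
  | write a i e s hi he =>
    refine ⟨fun _ _ => rfl, fun b hb => ?_⟩
    have : b ≠ a := by rintro rfl; simp [Prog.setsArr] at hb
    simp [Store.setArr, Function.update_of_ne this]
  | seq p q s s' s'' t t' hp hq ihp ihq =>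
    refine ⟨fun x hx => ?_, fun a ha => ?_⟩
    · simp only [Prog.setsVar, Bool.or_eq_false_iff] at hx
      rw [ihq.var x hx.2, ihp.var x hx.1]
    · simp only [Prog.setsArr, Bool.or_eq_false_iff] at ha
      rw [ihq.arr a ha.2, ihp.arr a ha.1]
  | ite_true e p q s s' t he h hp ih =>
    refine ⟨fun x hx => ?_, fun a ha => ?_⟩
    · simp only [Prog.setsVar, Bool.or_eq_false_iff] at hx
      exact ih.var x hx.1
    · simp only [Prog.setsArr, Bool.or_eq_false_iff] at ha
      exact ih.arr a ha.1
  | ite_false e p q s s' t he h hp ih =>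
    refine ⟨fun x hx => ?_, fun a ha => ?_⟩
    · simp only [Prog.setsVar, Bool.or_eq_false_iff] at hx
      exact ih.var x hx.2
    · simp only [Prog.setsArr, Bool.or_eq_false_iff] at ha
      exact ih.arr a ha.2
  | loop_true e p s s' s'' t t' he h hp hl ihp ihl =>
    exact ⟨fun x hx => (ihl.var x hx).trans (ihp.var x hx),
      fun a ha => (ihl.arr a ha).trans (ihp.arr a ha)⟩
  | loop_false e p s he h => exact Frame.refl _ _

theorem Expr.eval_le_and_fits {B : ℕ} (hB : 2 ≤ B) {s : Store} (hs : Bounded B s) (e : Expr)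
    (he : e.lit = true) : e.eval s ≤ B ^ e.size ∧ ∀ W, B ^ e.size ≤ W → e.Fits W s := by
  induction e with
  | const k =>
    have : k ≤ 1 := by simpa [Expr.lit] using he
    simp only [Expr.eval, Expr.size, Expr.Fits, pow_one]
    exact ⟨by omega, fun W hW => by omega⟩
  | var x =>
    simp only [Expr.eval, Expr.size, Expr.Fits, pow_one]
    exact ⟨hs.var x, fun W hW => (hs.var x).trans hW⟩
  | read a i ih =>
    obtain ⟨_, h2⟩ := ih he
    have h3 : B ^ i.size ≤ B ^ (i.size + 1) := Nat.pow_le_pow_right (by omega) (by omega)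
    have h4 : B ≤ B ^ (i.size + 1) := Nat.le_self_pow (by omega) _
    exact ⟨(hs.arr a _).trans h4,
      fun W hW => ⟨h2 W (h3.trans hW), (hs.arr a _).trans (h4.trans hW)⟩⟩
  | op o e₁ e₂ ih₁ ih₂ =>
    simp only [Expr.lit, Bool.and_eq_true] at he
    obtain ⟨h1, h1'⟩ := ih₁ he.1
    obtain ⟨h2, h2'⟩ := ih₂ he.2
    have ha : B ^ e₁.size ≤ B ^ (e₁.size + e₂.size) := Nat.pow_le_pow_right (by omega) (by omega)
    have hb : B ^ e₂.size ≤ B ^ (e₁.size + e₂.size) := Nat.pow_le_pow_right (by omega) (by omega)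
    have hc : 2 * B ^ (e₁.size + e₂.size) ≤ B ^ (e₁.size + e₂.size + 1) := by
      rw [pow_succ, mul_comm]; exact Nat.mul_le_mul_left _ hB
    have hone : 1 ≤ B ^ (e₁.size + e₂.size) := Nat.one_le_pow _ _ (by omega)
    have hval : o.eval (e₁.eval s) (e₂.eval s) ≤ B ^ (e₁.size + e₂.size + 1) := by
      cases o with
      | add => simp only [BinOp.eval]; omega
      | sub => simp only [BinOp.eval]; omega
      | mul =>
        have : e₁.eval s * e₂.eval s ≤ B ^ (e₁.size + e₂.size) := by
          rw [pow_add]; exact Nat.mul_le_mul h1 h2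
        simp only [BinOp.eval]; omega
      | lt => simp only [BinOp.eval]; split_ifs <;> omega
      | eq => simp only [BinOp.eval]; split_ifs <;> omega
    exact ⟨hval, fun W hW => ⟨h1' W (by simp only [Expr.size] at hW; omega),
      h2' W (by simp only [Expr.size] at hW; omega), hval.trans hW⟩⟩

theorem Expr.fits_of_ok {B : ℕ} (hB : 2 ≤ B) {s : Store} (hs : Bounded B s) {e : Expr}
    (he : e.ok = true) : e.Fits (B ^ 30) s := by
  simp only [Expr.ok, Bool.and_eq_true, decide_eq_true_eq] at he
  exact (e.eval_le_and_fits hB hs he.1).2 _ (Nat.pow_le_pow_right (by omega) he.2)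

/-- The value of the expression is at most `B`. This holds without a proof where the expression
only copies or compares. -/
def Expr.Small (B : ℕ) (s : Store) : Expr → Prop
  | .const _ => True
  | .var _ => True
  | .read _ _ => True
  | .op .lt _ _ => True
  | .op .eq _ _ => True
  | .op .sub e₁ _ => e₁.Small B s
  | .op .add e₁ e₂ => e₁.eval s + e₂.eval s ≤ B
  | .op .mul e₁ e₂ => e₁.eval s * e₂.eval s ≤ B

theorem Expr.Small.eval_le {B : ℕ} (hB : 2 ≤ B) {s : Store} (hs : Bounded B s) {e : Expr}
    (he : e.lit = true) (h : e.Small B s) : e.eval s ≤ B := by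
  induction e with
  | const k =>
    have : k ≤ 1 := by simpa [Expr.lit] using he
    simp only [Expr.eval]; omega
  | var x => exact hs.var x
  | read a i => exact hs.arr a _
  | op o e₁ e₂ ih₁ ih₂ =>
    simp only [Expr.lit, Bool.and_eq_true] at he
    cases o with
    | add => exact h
    | mul => exact h
    | sub => exact (Nat.sub_le _ _).trans (ih₁ he.1 h)
    | lt => simp only [Expr.eval, BinOp.eval]; split_ifs <;> omega
    | eq => simp only [Expr.eval, BinOp.eval]; split_ifs <;> omega

theorem Bounded.setVar {B : ℕ} {s : Store} (hs : Bounded B s) (x : ℕ) {k : ℕ} (hk : k ≤ B) :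
    Bounded B (s.setVar x k) := by
  refine ⟨fun y => ?_, hs.arr⟩
  by_cases h : y = x
  · simp [Store.setVar, h, hk]
  · simpa [Store.setVar, Function.update_of_ne h] using hs.var y

theorem Bounded.setArr {B : ℕ} {s : Store} (hs : Bounded B s) (a i : ℕ) {k : ℕ} (hk : k ≤ B) :
    Bounded B (s.setArr a i k) := by
  refine ⟨hs.var, fun b j => ?_⟩
  by_cases h : b = a
  · by_cases h' : j = i
    · simp [Store.setArr, h, h', hk]
    · simpa [Store.setArr, h, Function.update_of_ne h'] using hs.arr a j
  · simpa [Store.setArr, Function.update_of_ne h] using hs.arr b j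

/-- Total correctness with a time bound, for bounds `2 ≤ B` and programs whose expressions satisfy
`Expr.ok`: started with `s`, the program halts within time `T` with a
memory that satisfies `Q`; it keeps all numbers in the memory below `B`, and what it computes on the
way below `B ^ 30`. -/
def Run (B : ℕ) (p : Prog) (s : Store) (T : ℕ) (Q : Store → Prop) : Prop :=
  2 ≤ B → p.ok = true → Bounded B s →
    ∃ (t : ℕ) (s' : Store), Exec (B ^ 30) p s t s' ∧ t ≤ T ∧ Bounded B s' ∧ Frame p s s' ∧ Q s'

theorem Run.mono {B : ℕ} {p : Prog} {s : Store} {T T' : ℕ} {Q Q' : Store → Prop}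
    (h : Run B p s T Q) (hT : T ≤ T')
    (hQ : ∀ s', Bounded B s' → Frame p s s' → Q s' → Q' s') : Run B p s T' Q' := by
  intro hB hok hs
  obtain ⟨t, s', he, ht, hb, hf, hq⟩ := h hB hok hs
  exact ⟨t, s', he, ht.trans hT, hb, hf, hQ s' hb hf hq⟩

theorem Run.seq {B : ℕ} {p q : Prog} {s : Store} {T₁ T₂ : ℕ} {R Q : Store → Prop}
    (hp : Run B p s T₁ R)
    (hq : ∀ s', Bounded B s' → Frame p s s' → R s' → Run B q s' T₂ Q) :
    Run B (.seq p q) s (T₁ + T₂) Q := by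
  intro hB hok hs
  simp only [Prog.ok, Bool.and_eq_true] at hok
  obtain ⟨t, s', he, ht, hb, hf, hr⟩ := hp hB hok.1 hs
  obtain ⟨t', s'', he', ht', hb', hf', hq'⟩ := hq s' hb hf hr hB hok.2 hb
  have hex := Exec.seq p q s s' s'' t t' he he'
  exact ⟨_, s'', hex, add_le_add ht ht', hb', hex.frame, hq'⟩

theorem Run.ite {B : ℕ} {e : Expr} {p q : Prog} {s : Store} {T : ℕ} {Q : Store → Prop}
    (hp : e.eval s ≠ 0 → Run B p s T Q) (hq : e.eval s = 0 → Run B q s T Q) :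
    Run B (.ite e p q) s (e.cost + 1 + T) Q := by
  intro hB hok hs
  simp only [Prog.ok, Bool.and_eq_true] at hok
  have hfit := Expr.fits_of_ok hB hs hok.1.1
  by_cases h : e.eval s = 0
  · obtain ⟨t, s', he, ht, hb, hf, hq'⟩ := hq h hB hok.2 hs
    have hex := Exec.ite_false e p q s s' t hfit h he
    exact ⟨_, s', hex, by omega, hb, hex.frame, hq'⟩
  · obtain ⟨t, s', he, ht, hb, hf, hq'⟩ := hp h hB hok.1.2 hs
    have hex := Exec.ite_true e p q s s' t hfit h he
    exact ⟨_, s', hex, by omega, hb, hex.frame, hq'⟩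

/-- The rule for while-loops. The potential `Φ` pays for the time and ensures termination. -/
theorem Run.loop {B : ℕ} {e : Expr} {p : Prog} (Inv : Store → Prop) (Φ : Store → ℕ)
    {Q : Store → Prop} {s : Store} (h0 : Inv s)
    (hbody : ∀ s', Bounded B s' → Frame p s s' → Inv s' → e.eval s' ≠ 0 →
      ∃ T, Run B p s' T fun s'' => Inv s'' ∧ Φ s'' + T + (e.cost + 1) ≤ Φ s')
    (hexit : ∀ s', Bounded B s' → Frame p s s' → Inv s' → e.eval s' = 0 → Q s') :
    Run B (.loop e p) s (Φ s + (e.cost + 1)) Q := by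
  suffices H : ∀ k s', Φ s' ≤ k → Frame p s s' → Inv s' →
      Run B (.loop e p) s' (Φ s' + (e.cost + 1)) Q
    from H (Φ s) s le_rfl (Frame.refl _ _) h0
  intro k
  induction k with
  | zero =>
    intro s' hk hfs hinv hB hok hs
    simp only [Prog.ok, Bool.and_eq_true] at hok
    have hfit := Expr.fits_of_ok hB hs hok.1
    by_cases h : e.eval s' = 0
    · have hex := Exec.loop_false (W := B ^ 30) e p s' hfit h
      exact ⟨_, s', hex, by omega, hs, hex.frame, hexit s' hs hfs hinv h⟩
    · obtain ⟨T, hT⟩ := hbody s' hs hfs hinv h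
      obtain ⟨t, s'', he, ht, hb, hf, hi, hφ⟩ := hT hB hok.2 hs
      omega
  | succ k ih =>
    intro s' hk hfs hinv hB hok hs
    have hok' := hok
    simp only [Prog.ok, Bool.and_eq_true] at hok
    have hfit := Expr.fits_of_ok hB hs hok.1
    by_cases h : e.eval s' = 0
    · have hex := Exec.loop_false (W := B ^ 30) e p s' hfit h
      exact ⟨_, s', hex, by omega, hs, hex.frame, hexit s' hs hfs hinv h⟩
    · obtain ⟨T, hT⟩ := hbody s' hs hfs hinv h
      obtain ⟨t, s'', he, ht, hb, hf, hi, hφ⟩ := hT hB hok.2 hs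
      obtain ⟨t', s3, he', ht', hb', hf', hq⟩ := ih s'' (by omega) (hfs.trans hf) hi hB hok' hb
      have hex := Exec.loop_true e p s' s'' s3 t t' hfit h he he'
      exact ⟨_, s3, hex, by omega, hb', hex.frame, hq⟩

/-! ### Loop-free programs -/

/-- An upper bound for the running time of a program without loops (and the junk value `0` for a
loop). -/
def Prog.cost : Prog → ℕ
  | .skip => 1
  | .assign _ e => e.cost + 1
  | .write _ i e => i.cost + e.cost + 1
  | .seq p q => p.cost + q.cost
  | .ite e p q => e.cost + 1 + (p.cost + q.cost)
  | .loop _ _ => 0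

/-- The weakest precondition of a program without loops. -/
def Prog.wp (B : ℕ) : Prog → (Store → Prop) → Store → Prop
  | .skip, Q, s => Q s
  | .assign x e, Q, s => e.Small B s ∧ Q (s.setVar x (e.eval s))
  | .write a i e, Q, s => e.Small B s ∧ Q (s.setArr a (i.eval s) (e.eval s))
  | .seq p q, Q, s => p.wp B (q.wp B Q) s
  | .ite e p q, Q, s => (e.eval s ≠ 0 → p.wp B Q s) ∧ (e.eval s = 0 → q.wp B Q s)
  | .loop _ _, _, _ => False

theorem Run.of_wp {B : ℕ} {p : Prog} : ∀ {Q : Store → Prop} {s : Store}, p.wp B Q s →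
    Run B p s p.cost Q := by
  induction p with
  | skip =>
    intro Q s h hB hok hs
    exact ⟨1, s, .skip s, le_rfl, hs, Frame.refl _ _, h⟩
  | assign x e =>
    intro Q s h hB hok hs
    have hok' : e.ok = true := hok
    have hfit := Expr.fits_of_ok hB hs hok'
    simp only [Expr.ok, Bool.and_eq_true] at hok'
    have hex := Exec.assign x e s hfit
    exact ⟨_, _, hex, le_rfl, hs.setVar x (h.1.eval_le hB hs hok'.1), hex.frame, h.2⟩
  | write a i e =>
    intro Q s h hB hok hs
    simp only [Prog.ok, Bool.and_eq_true] at hok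
    have hok' := hok.2
    simp only [Expr.ok, Bool.and_eq_true] at hok'
    have hex := Exec.write a i e s (Expr.fits_of_ok hB hs hok.1) (Expr.fits_of_ok hB hs hok.2)
    exact ⟨_, _, hex, le_rfl, hs.setArr a _ (h.1.eval_le hB hs hok'.1), hex.frame, h.2⟩
  | seq p q ihp ihq =>
    intro Q s h
    exact Run.seq (ihp h) fun s' _ _ hs' => ihq hs'
  | ite e p q ihp ihq =>
    intro Q s h
    exact Run.ite (fun he => (ihp (h.1 he)).mono (by omega) fun _ _ _ h => h)
      fun he => (ihq (h.2 he)).mono (by omega) fun _ _ _ h => h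
  | loop e p => intro Q s h; exact h.elim

theorem Run.of_wp_le {B T : ℕ} {p : Prog} {Q : Store → Prop} {s : Store} (h : p.wp B Q s)
    (hT : p.cost ≤ T) : Run B p s T Q :=
  (Run.of_wp h).mono hT fun _ _ _ h => h

@[simp] theorem Store.var_setVar (s : Store) (x k y : ℕ) :
    (s.setVar x k).var y = if y = x then k else s.var y := by
  simp [Store.setVar, Function.update_apply]

@[simp] theorem Store.arr_setVar (s : Store) (x k : ℕ) : (s.setVar x k).arr = s.arr := rfl

@[simp] theorem Store.var_setArr (s : Store) (a i k : ℕ) : (s.setArr a i k).var = s.var := rfl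

@[simp] theorem Store.arr_setArr (s : Store) (a i k b : ℕ) :
    (s.setArr a i k).arr b = if b = a then Function.update (s.arr a) i k else s.arr b := by
  by_cases h : b = a
  · subst h; simp [Store.setArr]
  · simp [Store.setArr, h]

theorem BinOp.eval_eq_ne_zero {a b : ℕ} : BinOp.eq.eval a b ≠ 0 ↔ a = b := by
  simp [BinOp.eval]

theorem BinOp.eval_lt_ne_zero {a b : ℕ} : BinOp.lt.eval a b ≠ 0 ↔ a < b := by
  simp [BinOp.eval]

theorem BinOp.eval_mul_ne_zero {a b : ℕ} : BinOp.mul.eval a b ≠ 0 ↔ a ≠ 0 ∧ b ≠ 0 := by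
  simp [BinOp.eval]

theorem BinOp.eval_add_ne_zero {a b : ℕ} : BinOp.add.eval a b ≠ 0 ↔ a ≠ 0 ∨ b ≠ 0 := by
  simp only [BinOp.eval]; omega

/-! ### Counting loops -/

/-- `for x = 0, …, n - 1 do p`, where `n` is the value of variable `2`, which holds the number of
vertices in all programs below. -/
def forLoop (x : ℕ) (p : Prog) : Prog :=
  .seq (.assign x (.const 0))
    (.loop (.op .lt (.var x) (.var 2)) (.seq p (.assign x (.op .add (.var x) (.const 1)))))

/-- The rule for counting loops. The invariant `Inv k` holds before the round with `x = k`; since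
the loop sets `x` to `k + 1` after the body, it is required of the memory with this new value. -/
theorem Run.forLoop {B n x : ℕ} {p : Prog} {s : Store} (Inv : ℕ → Store → Prop) {T : ℕ}
    {Q : Store → Prop} (hn : s.var 2 = n) (hx : p.setsVar x = false) (hx2 : x ≠ 2)
    (h2 : p.setsVar 2 = false) (h0 : Inv 0 (s.setVar x 0))
    (hbody : ∀ k s', k < n → Bounded B s' → Frame (WordRAM.forLoop x p) s s' → s'.var x = k →
      Inv k s' → Run B p s' T fun s'' => Inv (k + 1) (s''.setVar x (k + 1)))
    (hexit : ∀ s', Bounded B s' → Frame (WordRAM.forLoop x p) s s' → Inv n s' → Q s') :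
    Run B (WordRAM.forLoop x p) s (n * (T + 8) + 6) Q := by
  intro hB hok hs
  have hnB : n ≤ B := hn ▸ hs.var 2
  have hfr : ∀ s', Frame (.seq p (.assign x (.op .add (.var x) (.const 1)))) (s.setVar x 0) s' →
      Frame (WordRAM.forLoop x p) s s' := by
    intro s' hf
    refine ⟨fun y hy => ?_, fun a ha => ?_⟩
    · have hy' : y ≠ x := by
        rintro rfl; simp [WordRAM.forLoop, Prog.setsVar] at hy
      simp only [WordRAM.forLoop, Prog.setsVar, Bool.or_eq_false_iff] at hy
      rw [hf.var y (by simpa only [Prog.setsVar, Bool.or_eq_false_iff] using hy.2)]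
      simp [Store.setVar, Function.update_of_ne hy']
    · rw [hf.arr a (by simpa [WordRAM.forLoop, Prog.setsArr] using ha)]
      rfl
  refine Run.mono (T := 2 + (n * (T + 8) + 4)) (Q := Q) ?_ (by omega) (fun _ _ _ h => h) hB hok hs
  refine Run.seq (R := fun s' => s' = s.setVar x 0) ?_ ?_
  · exact Run.of_wp ⟨trivial, rfl⟩
  rintro s0 hb0 hf0 rfl
  have hmain := Run.loop (B := B) (e := .op .lt (.var x) (.var 2))
    (p := .seq p (.assign x (.op .add (.var x) (.const 1)))) (s := s.setVar x 0) (Q := Q)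
    (fun s' => Inv (s'.var x) s' ∧ s'.var x ≤ n) (fun s' => (n - s'.var x) * (T + 8))
    ⟨by simpa [Store.setVar] using h0, by simp [Store.setVar]⟩ ?_ ?_
  · refine hmain.mono ?_ fun _ _ _ h => h
    simp [Store.setVar, Expr.cost]
  · rintro s' hb hf ⟨hi, hle⟩ he
    have hfor := hfr s' hf
    have hs2 : s'.var 2 = n := by
      rw [hfor.var 2 (by simp [WordRAM.forLoop, Prog.setsVar, hx2, h2]), hn]
    have hlt : s'.var x < n := by
      by_contra hc
      exact he (by simp [Expr.eval, BinOp.eval, hs2, hc])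
    refine ⟨T + 4, ?_⟩
    refine Run.seq (hbody (s'.var x) s' hlt hb hfor rfl hi) (fun s'' hb'' hf'' hi'' => ?_)
    have hxx : s''.var x = s'.var x := hf''.var x hx
    refine Run.of_wp ⟨?_, ?_⟩
    · simp only [Expr.Small, Expr.eval]; omega
    · simp only [Expr.eval, BinOp.eval, hxx, Expr.cost]
      refine ⟨⟨by simpa [Store.setVar] using hi'', by simp [Store.setVar]; omega⟩, ?_⟩
      have h1 : n - s'.var x = (n - (s'.var x + 1)) + 1 := by omega
      simp only [Store.setVar, Function.update_self]
      rw [h1, Nat.add_one_mul]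
      have h2 : n - (s'.var x + 1) + 1 - 1 = n - (s'.var x + 1) := by omega
      omega
  · rintro s' hb hf ⟨hi, hle⟩ he
    have hfor := hfr s' hf
    have hs2 : s'.var 2 = n := by
      rw [hfor.var 2 (by simp [WordRAM.forLoop, Prog.setsVar, hx2, h2]), hn]
    have hge : s'.var x = n := by
      by_contra hc
      have : s'.var x < n := by omega
      simp [Expr.eval, BinOp.eval, hs2, this] at he
    exact hexit s' hb hfor (hge ▸ hi)

end WordRAM

/-! ### Flows with potentials -/

namespace TokenFlow

/-- The potential `π` changes by at most one along edges, and `g` sends flow only along edges on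
which `π` drops by one. -/
structure IsTight (n : ℕ) (A : ℕ → ℕ → Prop) (π : ℕ → ℕ) (g : ℕ → ℕ → ℕ) : Prop where
  lip : ∀ u < n, ∀ v < n, A u v → π u ≤ π v + 1
  slack : ∀ u < n, ∀ v < n, 0 < g u v → A u v ∧ π u = π v + 1

/-- The flow `g` carries the supply `X` to the demand `Y`, up to the supply `src` that is still to
be sent and the demand `dem` that is still to be satisfied. -/
def IsConserving (n : ℕ) (X Y : ℕ → ℕ) (g : ℕ → ℕ → ℕ) (src dem : ℕ → ℕ) : Prop :=
  ∀ v < n, X v + ∑ u ∈ Finset.range n, g u v + dem v = Y v + ∑ w ∈ Finset.range n, g v w + src v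

theorem sum_range_eq_succ {n j : ℕ} (hj : j < n) {f f' : ℕ → ℕ}
    (h : ∀ i < n, f' i = f i + if i = j then 1 else 0) :
    ∑ i ∈ Finset.range n, f' i = ∑ i ∈ Finset.range n, f i + 1 := by
  rw [Finset.sum_congr rfl fun i hi => h i (Finset.mem_range.mp hi), Finset.sum_add_distrib]
  simp [hj]

/-- `g'` arises from `g` by an additional unit of flow from `u` to `v`. -/
def IsPush (n u v : ℕ) (g g' : ℕ → ℕ → ℕ) : Prop :=
  ∀ a < n, ∀ b < n, g' a b = g a b + if a = u ∧ b = v then 1 else 0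

section Push

variable {n u v : ℕ} {g g' : ℕ → ℕ → ℕ}

theorem IsPush.inflow (h : IsPush n u v g g') (hu : u < n) {x : ℕ} (hx : x < n) :
    ∑ a ∈ Finset.range n, g' a x = ∑ a ∈ Finset.range n, g a x + if x = v then 1 else 0 := by
  by_cases hxv : x = v
  · rw [if_pos hxv]
    exact sum_range_eq_succ hu fun a ha => by rw [h a ha x hx]; simp [hxv]
  · rw [if_neg hxv]
    exact Finset.sum_congr rfl fun a ha => by
      rw [h a (Finset.mem_range.mp ha) x hx]; simp [hxv]

theorem IsPush.outflow (h : IsPush n u v g g') (hv : v < n) {x : ℕ} (hx : x < n) :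
    ∑ b ∈ Finset.range n, g' x b = ∑ b ∈ Finset.range n, g x b + if x = u then 1 else 0 := by
  by_cases hxu : x = u
  · rw [if_pos hxu]
    exact sum_range_eq_succ hv fun b hb => by rw [h x hx b hb]; simp [hxu]
  · rw [if_neg hxu]
    exact Finset.sum_congr rfl fun b hb => by
      rw [h x hx b (Finset.mem_range.mp hb)]; simp [hxu]

variable {X Y src dem : ℕ → ℕ}

/-- A unit that is missing at `v` is fetched from `u`. -/
theorem IsConserving.push (hu : u < n) (hv : v < n)
    (hc : IsConserving n X Y g src fun x => dem x + if x = v then 1 else 0)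
    (h : IsPush n u v g g') :
    IsConserving n X Y g' src fun x => dem x + if x = u then 1 else 0 := by
  intro x hx
  have := hc x hx
  simp only [h.inflow hu hx, h.outflow hv hx]
  simp only at this
  omega

/-- A unit that is missing at `v` is fetched from `u` by cancelling flow from `v` to `u`. -/
theorem IsConserving.cancel (hu : u < n) (hv : v < n)
    (hc : IsConserving n X Y g src fun x => dem x + if x = v then 1 else 0)
    (h : IsPush n v u g' g) :
    IsConserving n X Y g' src fun x => dem x + if x = u then 1 else 0 := by
  intro x hx
  have := hc x hx
  simp only [h.inflow hv hx, h.outflow hu hx] at this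
  simp only
  omega

end Push

section Flow

variable {n : ℕ} {A : ℕ → ℕ → Prop} {X Y π src dem : ℕ → ℕ} {g : ℕ → ℕ → ℕ} {K : ℕ}

/-- The arcs of the residual network with reduced cost zero. -/
def Admissible (A : ℕ → ℕ → Prop) (π : ℕ → ℕ) (g : ℕ → ℕ → ℕ) (u v : ℕ) : Prop :=
  A u v ∧ (π u = π v + 1 ∨ 0 < g v u)

/-- The invariant of the primal-dual method: all vertices with remaining supply have the maximal
potential `K`, and all vertices with remaining demand have potential `0`. -/
structure IsPartialFlow (n : ℕ) (A : ℕ → ℕ → Prop) (X Y : ℕ → ℕ) (π : ℕ → ℕ) (g : ℕ → ℕ → ℕ)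
    (src dem : ℕ → ℕ) (K : ℕ) : Prop where
  tight : IsTight n A π g
  cons : IsConserving n X Y g src dem
  le : ∀ v < n, π v ≤ K
  of_src : ∀ v < n, 0 < src v → π v = K
  of_dem : ∀ v < n, 0 < dem v → π v = 0
  src_le : ∀ v < n, src v ≤ 1
  dem_le : ∀ v < n, dem v ≤ 1

/-- If no admissible arc leaves a set `R` which contains all remaining supply and no remaining
demand, then the potential of `R` can be raised. -/
theorem IsPartialFlow.raise (hf : IsPartialFlow n A X Y π g src dem K)
    (hA : ∀ u < n, ∀ v < n, A u v → A v u) (R : ℕ → Prop)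
    (hsrc : ∀ v < n, 0 < src v → R v) (hdem : ∀ v < n, 0 < dem v → ¬ R v)
    (hR : ∀ u < n, ∀ v < n, R u → ¬ R v → ¬ Admissible A π g u v) {π' : ℕ → ℕ}
    (h1 : ∀ v < n, R v → π' v = π v + 1) (h0 : ∀ v < n, ¬ R v → π' v = π v) :
    IsPartialFlow n A X Y π' g src dem (K + 1) where
  tight := by
    refine ⟨fun u hu v hv h => ?_, fun u hu v hv h => ?_⟩
    · have hl := hf.tight.lip u hu v hv h
      by_cases hRu : R u
      · rw [h1 u hu hRu]
        by_cases hRv : R v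
        · rw [h1 v hv hRv]; omega
        · rw [h0 v hv hRv]
          have : π u ≠ π v + 1 := fun he => hR u hu v hv hRu hRv ⟨h, Or.inl he⟩
          omega
      · rw [h0 u hu hRu]
        by_cases hRv : R v
        · rw [h1 v hv hRv]; omega
        · rw [h0 v hv hRv]; omega
    · obtain ⟨ha, he⟩ := hf.tight.slack u hu v hv h
      refine ⟨ha, ?_⟩
      by_cases hRu : R u
      · by_cases hRv : R v
        · rw [h1 u hu hRu, h1 v hv hRv]; omega
        · exact absurd ⟨ha, Or.inl he⟩ (hR u hu v hv hRu hRv)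
      · by_cases hRv : R v
        · exact absurd ⟨hA u hu v hv ha, Or.inr h⟩ (hR v hv u hu hRv hRu)
        · rw [h0 u hu hRu, h0 v hv hRv]; omega
  cons := hf.cons
  le := fun v hv => by
    have := hf.le v hv
    by_cases h : R v
    · rw [h1 v hv h]; omega
    · rw [h0 v hv h]; omega
  of_src := fun v hv h => by rw [h1 v hv (hsrc v hv h), hf.of_src v hv h]
  of_dem := fun v hv h => by rw [h0 v hv (hdem v hv h), hf.of_dem v hv h]
  src_le := hf.src_le
  dem_le := hf.dem_le

theorem IsTight.push {u v : ℕ} {g' : ℕ → ℕ → ℕ} (ht : IsTight n A π g) (h : IsPush n u v g g')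
    (ha : A u v) (he : π u = π v + 1) : IsTight n A π g' := by
  refine ⟨ht.lip, fun a hna b hnb hpos => ?_⟩
  by_cases hab : a = u ∧ b = v
  · obtain ⟨rfl, rfl⟩ := hab; exact ⟨ha, he⟩
  · rw [h a hna b hnb, if_neg hab] at hpos
    exact ht.slack a hna b hnb hpos

theorem IsTight.cancel {u v : ℕ} {g' : ℕ → ℕ → ℕ} (ht : IsTight n A π g)
    (h : IsPush n u v g' g) : IsTight n A π g' :=
  ⟨ht.lip, fun a hna b hnb hpos => ht.slack a hna b hnb (by rw [h a hna b hnb]; omega)⟩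

theorem sum_inflow_eq_sum_outflow (n : ℕ) (g : ℕ → ℕ → ℕ) :
    ∑ v ∈ Finset.range n, ∑ u ∈ Finset.range n, g u v =
      ∑ v ∈ Finset.range n, ∑ w ∈ Finset.range n, g v w := Finset.sum_comm

theorem IsConserving.sum_eq (h : IsConserving n X Y g src dem) :
    ∑ v ∈ Finset.range n, X v + ∑ v ∈ Finset.range n, dem v =
      ∑ v ∈ Finset.range n, Y v + ∑ v ∈ Finset.range n, src v := by
  have := Finset.sum_congr (rfl : Finset.range n = Finset.range n)
    fun v hv => h v (Finset.mem_range.mp hv)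
  simp only [Finset.sum_add_distrib] at this
  rw [sum_inflow_eq_sum_outflow] at this
  omega

/-- If the potential of a vertex with remaining supply has reached the number of vertices, then some
level below it is empty, and the levels above that one form a set that is closed under adjacency
and has more supply than demand. -/
theorem IsPartialFlow.exists_closed (hf : IsPartialFlow n A X Y π g src dem K) (hK : n ≤ K)
    {x : ℕ} (hx : x < n) (hsx : 0 < src x) :
    ∃ S ⊆ Finset.range n, (∀ u ∈ S, ∀ v < n, (A u v → v ∈ S)) ∧
      ∑ v ∈ S, Y v < ∑ v ∈ S, X v := by
  obtain ⟨j, hj, hjn⟩ : ∃ j ∈ Finset.range n, j ∉ ((Finset.range n).erase x).image π := by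
    by_contra hcon
    push Not at hcon
    have h1 := Finset.card_le_card (show Finset.range n ⊆ _ from hcon)
    have h2 := Finset.card_image_le (f := π) (s := (Finset.range n).erase x)
    rw [Finset.card_erase_of_mem (Finset.mem_range.mpr hx)] at h2
    rw [Finset.card_range] at h1 h2
    omega
  have hj' := Finset.mem_range.mp hj
  have hπx := hf.of_src x hx hsx
  have hempty : ∀ v < n, π v ≠ j := by
    intro v hv he
    by_cases hvx : v = x
    · subst hvx; omega
    · exact hjn (Finset.mem_image.mpr ⟨v, Finset.mem_erase.mpr ⟨hvx, Finset.mem_range.mpr hv⟩, he⟩)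
  set S := (Finset.range n).filter fun v => j < π v with hS
  have hmem : ∀ v, v ∈ S ↔ v < n ∧ j < π v := fun v => by simp [hS]
  have hcl : ∀ u ∈ S, ∀ v < n, (A u v → v ∈ S) := by
    intro u hu v hv ha
    rw [hmem] at hu ⊢
    have := hf.tight.lip u hu.1 v hv ha
    have := hempty v hv
    exact ⟨hv, by omega⟩
  refine ⟨S, Finset.filter_subset _ _, hcl, ?_⟩
  have hsum : ∑ v ∈ S, (X v + ∑ u ∈ Finset.range n, g u v + dem v) =
      ∑ v ∈ S, (Y v + ∑ w ∈ Finset.range n, g v w + src v) :=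
    Finset.sum_congr rfl fun v hv => hf.cons v ((hmem v).mp hv).1
  simp only [Finset.sum_add_distrib] at hsum
  have hin : ∑ v ∈ S, ∑ u ∈ S, g u v ≤ ∑ v ∈ S, ∑ u ∈ Finset.range n, g u v :=
    Finset.sum_le_sum fun v _ => Finset.sum_le_sum_of_subset (Finset.filter_subset _ _)
  have hout : ∑ v ∈ S, ∑ w ∈ Finset.range n, g v w = ∑ v ∈ S, ∑ w ∈ S, g v w := by
    refine Finset.sum_congr rfl fun v hv => (Finset.sum_subset (Finset.filter_subset _ _) ?_).symm
    intro w hw hwS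
    by_contra hne
    have hv' := (hmem v).mp hv
    have hw' := Finset.mem_range.mp hw
    exact hwS (hcl v hv w hw' (hf.tight.slack v hv'.1 w hw' (Nat.pos_of_ne_zero hne)).1)
  have hin' : ∑ v ∈ S, ∑ u ∈ Finset.range n, g u v = ∑ v ∈ S, ∑ u ∈ S, g u v := by
    refine Finset.sum_congr rfl fun v hv => (Finset.sum_subset (Finset.filter_subset _ _) ?_).symm
    intro u hu huS
    by_contra hne
    have hv' := (hmem v).mp hv
    have hu' := Finset.mem_range.mp hu
    have hs := (hf.tight.slack u hu' v hv'.1 (Nat.pos_of_ne_zero hne)).2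
    exact huS ((hmem u).mpr ⟨hu', by omega⟩)
  have hcomm : ∑ v ∈ S, ∑ u ∈ S, g u v = ∑ v ∈ S, ∑ w ∈ S, g v w := Finset.sum_comm
  have hdem : ∑ v ∈ S, dem v = 0 := by
    refine Finset.sum_eq_zero fun v hv => ?_
    by_contra hne
    have hv' := (hmem v).mp hv
    have := hf.of_dem v hv'.1 (Nat.pos_of_ne_zero hne)
    omega
  have hsrc : 0 < ∑ v ∈ S, src v :=
    Finset.sum_pos' (fun _ _ => Nat.zero_le _) ⟨x, (hmem x).mpr ⟨hx, by omega⟩, hsx⟩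
  omega

/-! ### Realizing a flow by swaps -/

/-- A vertex of maximal potential among the unoccupied vertices with inflow gets its inflow from
occupied vertices only. -/
theorem occupied_of_flow {occ : ℕ → ℕ} (ht : IsTight n A π g)
    (hc : IsConserving n occ Y g (fun _ => 0) fun _ => 0) {b u : ℕ} (hb : b < n) (hu : u < n)
    (hmax : ∀ v < n, occ v = 0 → 0 < ∑ a ∈ Finset.range n, g a v → π v ≤ π b) (hg : 0 < g u b) :
    occ u ≠ 0 := by
  intro h0
  have hout : g u b ≤ ∑ w ∈ Finset.range n, g u w :=
    Finset.single_le_sum (f := fun w => g u w) (fun _ _ => Nat.zero_le _) (Finset.mem_range.mpr hb)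
  have h1 := hc u hu
  have h2 := hmax u hu h0 (by simp only [h0] at h1; omega)
  have h3 := (ht.slack u hu b hb hg).2
  omega

/-- When no unoccupied vertex has inflow, the demand is satisfied. -/
theorem eq_of_no_inflow {occ : ℕ → ℕ} (hc : IsConserving n occ Y g (fun _ => 0) fun _ => 0)
    (hY : ∀ v < n, Y v ≤ 1)
    (h : ∀ v < n, occ v = 0 → ∑ a ∈ Finset.range n, g a v = 0) : ∀ v < n, occ v = Y v := by
  have hle : ∀ v ∈ Finset.range n, Y v ≤ occ v := by
    intro v hv
    have hv' := Finset.mem_range.mp hv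
    have h1 := hc v hv'
    have h2 := hY v hv'
    by_cases h0 : occ v = 0
    · have h3 := h v hv' h0
      simp only at h1; omega
    · omega
  have hs := hc.sum_eq
  simp only [Finset.sum_const_zero, add_zero] at hs
  intro v hv
  exact ((Finset.sum_eq_sum_iff_of_le hle).mp hs.symm v (Finset.mem_range.mpr hv)).symm

/-- Moving a token from `u` to `b` along flow. -/
theorem IsConserving.move {occ occ' : ℕ → ℕ} {g' : ℕ → ℕ → ℕ}
    (hc : IsConserving n occ Y g (fun _ => 0) fun _ => 0) {b u : ℕ} (hb : b < n) (hu : u < n)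
    (hub : u ≠ b) (h : IsPush n u b g' g) (hou : occ u = 1) (hob : occ b = 0)
    (hou' : occ' u = 0) (hob' : occ' b = 1) (ho : ∀ v < n, v ≠ u → v ≠ b → occ' v = occ v) :
    IsConserving n occ' Y g' (fun _ => 0) fun _ => 0 := by
  intro x hx
  have := hc x hx
  simp only [h.inflow hu hx, h.outflow hb hx] at this
  simp only
  by_cases h1 : x = u
  · subst h1
    rw [if_neg hub, if_pos rfl] at this
    omega
  by_cases h2 : x = b
  · subst h2
    rw [if_pos rfl, if_neg h1] at this
    omega
  rw [if_neg h1, if_neg h2] at this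
  rw [ho x hx h1 h2]; omega

end Flow

end TokenFlow

namespace TokenPlacement

/-! ### Potentials and swapping sequences -/

section Potential

variable {V : Type*} {G : SimpleGraph V}

/-- The total potential of the tokens of color 2. -/
def potential [Fintype V] (π : V → ℕ) (f : TokenPlacement V 2) : ℕ :=
  ∑ v, (f.color v : ℕ) * π v

theorem Adjacent.potential_le [Fintype V] {f f' : TokenPlacement V 2} {π : V → ℕ}
    (hπ : ∀ u v, G.Adj u v → π u ≤ π v + 1) (h : Adjacent G f f') :
    potential π f ≤ potential π f' + 1 := by
  classical
  obtain ⟨hne, u, v, huv, hu, hv, hw⟩ := h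
  have hc := Adjacent.color_ne hne hu hv hw
  have hcol := Adjacent.color_eq_swap hu hv hw
  obtain ⟨z, hz⟩ : ∃ z : V, ∀ x, x ≠ z → f.color x ≠ 0 → Equiv.swap u v x = x := by
    by_cases h0 : f.color u = 0
    · refine ⟨v, fun x hx hx0 => Equiv.swap_apply_of_ne_of_ne ?_ hx⟩
      rintro rfl
      exact hx0 h0
    · refine ⟨u, fun x hx hx0 => Equiv.swap_apply_of_ne_of_ne hx ?_⟩
      rintro rfl
      exact hc ((color_eq_one_of_ne_zero h0).trans (color_eq_one_of_ne_zero hx0).symm)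
  have hsw : ∀ x, π x ≤ π (Equiv.swap u v x) + 1 := by
    intro x
    by_cases h1 : x = u
    · rw [h1, Equiv.swap_apply_left]; exact hπ u v huv
    by_cases h2 : x = v
    · rw [h2, Equiv.swap_apply_right]; exact hπ v u huv.symm
    rw [Equiv.swap_apply_of_ne_of_ne h1 h2]; omega
  have h1 : potential π f' = ∑ x, (f.color x : ℕ) * π (Equiv.swap u v x) := by
    rw [potential, ← Equiv.sum_comp (Equiv.swap u v)]
    exact Finset.sum_congr rfl fun x _ => by rw [hcol]
  have h2 : (1 : ℕ) = ∑ x, if x = z then 1 else 0 := by simp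
  rw [h1, h2, ← Finset.sum_add_distrib]
  refine Finset.sum_le_sum fun x _ => ?_
  by_cases hx0 : f.color x = 0
  · simp [hx0]
  · have hx1 : (f.color x : ℕ) = 1 := by rw [color_eq_one_of_ne_zero hx0]; rfl
    rw [hx1, one_mul, one_mul]
    by_cases hxz : x = z
    · rw [if_pos hxz]; exact hsw x
    · rw [hz x hxz hx0]; omega

theorem IsSwappingSeq.potential_le [Fintype V] {π : V → ℕ}
    (hπ : ∀ u v, G.Adj u v → π u ≤ π v + 1) {S : List (TokenPlacement V 2)} :
    ∀ {f f' : TokenPlacement V 2}, IsSwappingSeq G f f' S →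
      potential π f ≤ potential π f' + seqLen S := by
  induction S with
  | nil => intro f f' h; simp [IsSwappingSeq] at h
  | cons a T ih =>
    rintro f f' ⟨h1, h2, h3⟩
    obtain rfl : a = f := by simpa using h1
    cases T with
    | nil =>
      obtain rfl : a = f' := by simpa using h2
      omega
    | cons b R =>
      rw [List.isChain_cons_cons] at h3
      have hr := ih (f := b) (f' := f')
        ⟨by simp, by simpa [List.getLast?_cons_cons] using h2, h3.2⟩
      have hl := h3.1.potential_le hπ
      simp only [seqLen, List.length_cons] at hr ⊢
      omega

/-- A swapping sequence that lowers the potential in each step has minimum length. -/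
theorem IsSwappingSeq.seqLen_eq_opt [Fintype V] {π : V → ℕ}
    (hπ : ∀ u v, G.Adj u v → π u ≤ π v + 1) {S : List (TokenPlacement V 2)}
    {f f' : TokenPlacement V 2} (hS : IsSwappingSeq G f f' S)
    (h : potential π f' + seqLen S ≤ potential π f) : (seqLen S : ℕ∞) = opt G f f' := by
  refine le_antisymm (le_iInf₂ fun S' hS' => ?_) (iInf₂_le S hS)
  have := hS'.potential_le hπ
  exact_mod_cast (by omega : seqLen S ≤ seqLen S')

/-- Swaps do not change the number of tokens of color 2 on a set that is closed under adjacency. -/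
theorem IsSwappingSeq.sum_eq_of_closed [DecidableEq V] {D : Finset V}
    (hD : ∀ u ∈ D, ∀ v, G.Adj u v → v ∈ D) {S : List (TokenPlacement V 2)} :
    ∀ {f f' : TokenPlacement V 2}, IsSwappingSeq G f f' S →
      ∑ v ∈ D, (f.color v : ℕ) = ∑ v ∈ D, (f'.color v : ℕ) := by
  induction S with
  | nil => intro f f' h; simp [IsSwappingSeq] at h
  | cons a T ih =>
    rintro f f' ⟨h1, h2, h3⟩
    obtain rfl : a = f := by simpa using h1
    cases T with
    | nil =>
      obtain rfl : a = f' := by simpa using h2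
      rfl
    | cons b R =>
      rw [List.isChain_cons_cons] at h3
      rw [← ih (f := b) (f' := f')
        ⟨by simp, by simpa [List.getLast?_cons_cons] using h2, h3.2⟩]
      obtain ⟨-, u, v, huv, hu, hv, hw⟩ := h3.1
      have hcol := Adjacent.color_eq_swap hu hv hw
      have hmaps : ∀ x ∈ D, Equiv.swap u v x ∈ D := by
        intro x hx
        by_cases h1 : x = u
        · rw [h1, Equiv.swap_apply_left]; exact hD u (h1 ▸ hx) v huv
        by_cases h2 : x = v
        · rw [h2, Equiv.swap_apply_right]; exact hD v (h2 ▸ hx) u huv.symm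
        rwa [Equiv.swap_apply_of_ne_of_ne h1 h2]
      refine Finset.sum_nbij' (Equiv.swap u v) (Equiv.swap u v) hmaps hmaps
        (fun x _ => by simp) (fun x _ => by simp) fun x _ => by rw [hcol]

end Potential

end TokenPlacement

/-! ### Breadth-first search with a queue -/

namespace TokenFlow

/-- The state of a breadth-first search: the vertices found so far are `Q 0, …, Q (tail - 1)`, the
vertex `Q i` has rank `i + 1`, the other vertices have rank `0`, and each vertex found is a root or
was found over an arc from a parent of smaller rank. -/
structure IsQueue (n : ℕ) (root : ℕ → Prop) (arc : ℕ → ℕ → Prop) (Q rk par : ℕ → ℕ) (tail : ℕ) :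
    Prop where
  mem : ∀ i < tail, Q i < n ∧ rk (Q i) = i + 1
  rank : ∀ v < n, 0 < rk v → rk v ≤ tail ∧ Q (rk v - 1) = v
  parent : ∀ v < n, 0 < rk v →
    root v ∨ (par v < n ∧ 0 < rk (par v) ∧ rk (par v) < rk v ∧ arc (par v) v)

variable {n : ℕ} {root : ℕ → Prop} {arc : ℕ → ℕ → Prop} {Q rk par : ℕ → ℕ} {tail : ℕ}

theorem IsQueue.tail_le (h : IsQueue n root arc Q rk par tail) : tail ≤ n := by
  have := Finset.card_le_card_of_injOn (s := Finset.range tail) (t := Finset.range n) Q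
    (fun i hi => by
      have := (h.mem i (by simpa using hi)).1
      simpa using this)
    (fun i hi j hj hij => by
      have h1 := (h.mem i (by simpa using hi)).2
      have h2 := (h.mem j (by simpa using hj)).2
      rw [hij] at h1
      omega)
  simpa using this

theorem IsQueue.enqueue (h : IsQueue n root arc Q rk par tail) {v : ℕ} (hv : v < n)
    (h0 : rk v = 0) {par' : ℕ → ℕ} (hpar : ∀ x, x ≠ v → par' x = par x)
    (hnew : root v ∨ (par' v < n ∧ 0 < rk (par' v) ∧ arc (par' v) v)) :
    IsQueue n root arc (Function.update Q tail v) (Function.update rk v (tail + 1)) par'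
      (tail + 1) := by
  refine ⟨fun i hi => ?_, fun x hx hpos => ?_, fun x hx hpos => ?_⟩
  · by_cases hit : i = tail
    · subst hit; simp [hv]
    · have hm := h.mem i (by omega)
      have hne : Q i ≠ v := by
        intro he; rw [he] at hm; omega
      rw [Function.update_of_ne hit, Function.update_of_ne hne]
      exact hm
  · by_cases hxv : x = v
    · subst hxv; simp
    · rw [Function.update_of_ne hxv] at hpos ⊢
      obtain ⟨h1, h2⟩ := h.rank x hx hpos
      rw [Function.update_of_ne (by omega)]
      exact ⟨by omega, h2⟩
  · by_cases hxv : x = v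
    · subst hxv
      refine hnew.imp id fun ⟨h1, h2, h3⟩ => ?_
      have hne : par' x ≠ x := by
        intro he; rw [he, h0] at h2; omega
      have := (h.rank _ h1 h2).1
      rw [Function.update_of_ne hne, Function.update_self]
      exact ⟨h1, h2, by omega, h3⟩
    · rw [Function.update_of_ne hxv] at hpos
      refine (h.parent x hx hpos).imp id fun ⟨h1, h2, h3, h4⟩ => ?_
      have hne : par x ≠ v := by
        intro he; rw [he, h0] at h2; omega
      rw [hpar x hxv, Function.update_of_ne hne, Function.update_of_ne hxv]
      exact ⟨h1, h2, h3, h4⟩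

end TokenFlow

namespace WordRAM

open TokenFlow

/-! ### The search on the word RAM

The programs use the memory as follows. Variables: `0` input and final answer, `1` number of the
placements written down, `2` number of vertices, `3` remaining supply, `4` maximal potential, `5`,
`6` and `9` loop counters (`9` also walks along the search path), `7` length of the queue, `8`
origin of an arc, `10` target vertex, `11` total initial deficit, `12` flag of the last loop.
Arrays: `0` adjacency matrix, `1` initial and `2` target placement, `3` output, `4` remaining
supply, `5` remaining demand, `6` flow matrix, `7` potential, `8` rank in the queue, `9` queue,
`10` parent in the search, `11` current placement, `12` inflow.
-/

/-- The matrix with `n` columns that the array `a` holds row by row. -/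
def Store.mat (s : Store) (n a : ℕ) (u v : ℕ) : ℕ := s.arr a (u * n + v)

/-- Adjacency, as it is stored in array `0`. -/
def Store.adj (s : Store) (n : ℕ) (u v : ℕ) : Prop := s.mat n 0 u v ≠ 0

/-- Append the vertex in variable `v` to the queue. -/
def enqueue (v : ℕ) : Prog :=
  .seq (.write 9 (.var 7) (.var v))
    (.seq (.assign 7 (.op .add (.var 7) (.const 1))) (.write 8 (.var v) (.var 7)))

/-- Start the search with the vertices that have remaining supply. -/
def seedQueue : Prog :=
  .seq (forLoop 5 (.write 8 (.var 5) (.const 0)))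
    (.seq (.assign 7 (.const 0)) (forLoop 5 (.ite (.read 4 (.var 5)) (enqueue 5) .skip)))

/-- The address of the entry of a matrix in the row and the column given by two variables. -/
def entry (u v : ℕ) : Expr := .op .add (.op .mul (.var u) (.var 2)) (.var v)

/-- The test whether the vertex in variable `9` is new and whether the arc to it from the vertex in
variable `8` is admissible. -/
def arcTest : Expr :=
  .op .mul (.op .eq (.read 8 (.var 9)) (.const 0))
    (.op .mul (.read 0 (entry 8 9))
      (.op .add (.op .eq (.read 7 (.var 8)) (.op .add (.read 7 (.var 9)) (.const 1)))
        (.read 6 (entry 9 8))))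

/-- Append to the queue all new vertices that admissible arcs reach from the one in variable `8`. -/
def scanArcs : Prog :=
  forLoop 9 (.ite arcTest (.seq (.write 10 (.var 9) (.var 8)) (enqueue 9)) .skip)

/-- Search along admissible arcs from the vertices with remaining supply. -/
def search : Prog :=
  .seq seedQueue
    (forLoop 6 (.ite (.op .lt (.var 6) (.var 7))
      (.seq (.assign 8 (.read 9 (.var 6))) scanArcs) .skip))

/-- The vertices from which the search starts. -/
def Store.IsSource (s : Store) (v : ℕ) : Prop := 0 < s.arr 4 v

/-- The arcs along which the search proceeds. -/
def Store.IsArc (s : Store) (n : ℕ) (u v : ℕ) : Prop :=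
  Admissible (s.adj n) (s.arr 7) (s.mat n 6) u v

/-- The memory holds the state of a search of the instance in `s₀`. -/
def Searching (n : ℕ) (s₀ s : Store) : Prop :=
  IsQueue n s₀.IsSource (s₀.IsArc n) (s.arr 9) (s.arr 8) (s.arr 10) (s.var 7)

theorem run_seedQueue {B n : ℕ} (hB : n * n + n + 2 ≤ B) {s : Store} (hn : s.var 2 = n) :
    Run B seedQueue s (60 * n + 20) fun s' =>
      Searching n s s' ∧ ∀ v < n, s.IsSource v → 0 < s'.arr 8 v := by
  refine Run.mono (T := (n * (3 + 8) + 6) + (2 + (n * (20 + 8) + 6))) (Run.seq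
    (Run.forLoop (fun k s' => ∀ v < k, s'.arr 8 v = 0) hn rfl (by decide) rfl
      (by simp) ?_ (fun s' _ _ h => h)) ?_) (by omega) (fun _ _ _ h => h)
  · intro k s' hk hb hf hi hinv
    refine Run.of_wp_le ?_ (by decide)
    simp only [Prog.wp, Expr.Small, Expr.eval, true_and, Store.arr_setVar, Store.arr_setArr, hi,
      if_true]
    intro v hv
    by_cases hvk : v = k
    · simp [hvk]
    · rw [Function.update_of_ne hvk]; exact hinv v (by omega)
  intro s1 hb1 hf1 hz
  have hn1 : s1.var 2 = n := (hf1.var 2 rfl).trans hn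
  refine Run.seq (R := fun s2 => s2 = s1.setVar 7 0) (Run.of_wp_le ⟨trivial, rfl⟩ (by decide)) ?_
  rintro s2 hb2 hf2 rfl
  refine Run.forLoop (fun k s' => Searching n s s' ∧ (∀ v < k, s.IsSource v → 0 < s'.arr 8 v) ∧
      ∀ v < n, k ≤ v → s'.arr 8 v = 0) (by simpa using hn1) rfl (by decide) rfl ?_ ?_
    (fun s' _ _ h => ⟨h.1, h.2.1⟩)
  · refine ⟨⟨?_, ?_, ?_⟩, by simp, fun v hv _ => by simpa using hz v hv⟩
    · simp
    · intro v hv hpos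
      simp [hz v hv] at hpos
    · intro v hv hpos
      simp [hz v hv] at hpos
  · rintro k s' hk hb hf hi ⟨hq, hsrc, hzero⟩
    have h4 : s'.arr 4 = s.arr 4 := (hf.arr 4 rfl).trans (hf1.arr 4 rfl)
    have htail := hq.tail_le
    refine Run.of_wp_le ?_ (by decide)
    simp only [Prog.wp, enqueue, Expr.Small, Expr.eval, BinOp.eval, true_and, Store.arr_setVar,
      Store.arr_setArr, Store.var_setVar, Store.var_setArr, hi, h4]
    refine ⟨fun hs => ⟨by simp; omega, ?_⟩, fun hs => ?_⟩
    · have hk0 : s'.arr 8 k = 0 := hzero k hk le_rfl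
      have hq' := IsQueue.enqueue hq hk hk0 (par' := s'.arr 10) (fun _ _ => rfl)
        (Or.inl (Nat.pos_of_ne_zero hs))
      refine ⟨by simpa [Searching, hi] using hq', ?_, ?_⟩
      · intro v hv hvs
        by_cases hvk : v = k
        · simp [hvk]
        · simpa [hvk, hi] using hsrc v (by omega) hvs
      · intro v hv hkv
        have hvk : v ≠ k := by omega
        simpa [hvk, hi] using hzero v hv (by omega)
    · refine ⟨by simpa [Searching] using hq, ?_, fun v hv hkv => hzero v hv (by omega)⟩
      intro v hv hvs
      by_cases hvk : v = k
      · subst hvk; exact absurd hs hvs.ne'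
      · exact hsrc v (by omega) hvs

theorem eval_arcTest_ne_zero {n : ℕ} {s : Store} (hn : s.var 2 = n) :
    arcTest.eval s ≠ 0 ↔
      s.arr 8 (s.var 9) = 0 ∧ s.IsArc n (s.var 8) (s.var 9) := by
  simp only [arcTest, entry, Expr.eval, BinOp.eval_mul_ne_zero, BinOp.eval_add_ne_zero,
    BinOp.eval_eq_ne_zero]
  simp only [BinOp.eval, hn, Store.IsArc, Admissible, Store.adj, Store.mat, Nat.pos_iff_ne_zero]

theorem Store.isArc_congr {n : ℕ} {s s' : Store} (h0 : s'.arr 0 = s.arr 0)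
    (h6 : s'.arr 6 = s.arr 6) (h7 : s'.arr 7 = s.arr 7) : s'.IsArc n = s.IsArc n := by
  funext u v
  simp only [Store.IsArc, Store.adj, Store.mat, Admissible, h0, h6, h7]

/-- All vertices that are reached from one of the first `k` vertices in the queue are found. -/
def Scanned (n : ℕ) (s₀ s : Store) (k : ℕ) : Prop :=
  ∀ w < n, 0 < s.arr 8 w → s.arr 8 w ≤ k → ∀ v < n, s₀.IsArc n w v → 0 < s.arr 8 v

/-- The vertex in variable `8` is the one at position `k` of the queue. -/
theorem run_scanArcs {B n k : ℕ} (hB : n * n + n + 2 ≤ B) {s₀ s : Store} (hn : s.var 2 = n)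
    (h0 : s.arr 0 = s₀.arr 0) (h6 : s.arr 6 = s₀.arr 6) (h7 : s.arr 7 = s₀.arr 7)
    (hq : Searching n s₀ s) (hk : k < s.var 7) (h8 : s.var 8 = s.arr 9 k) (hsc : Scanned n s₀ s k)
    (hsrc : ∀ v < n, s₀.IsSource v → 0 < s.arr 8 v) :
    Run B scanArcs s (80 * n + 10) fun s' =>
      Searching n s₀ s' ∧ Scanned n s₀ s' (k + 1) ∧ ∀ v < n, s₀.IsSource v → 0 < s'.arr 8 v := by
  obtain ⟨hun, hur⟩ := hq.mem k hk
  refine Run.mono (T := n * (70 + 8) + 6) (Run.forLoop (fun j s' =>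
    Searching n s₀ s' ∧ Scanned n s₀ s' k ∧ (∀ v < n, s₀.IsSource v → 0 < s'.arr 8 v) ∧
    k < s'.var 7 ∧ s'.arr 9 k = s.arr 9 k ∧ ∀ v < j, s₀.IsArc n (s.arr 9 k) v → 0 < s'.arr 8 v)
    hn rfl (by decide) rfl ⟨hq, hsc, hsrc, hk, rfl, by simp⟩ ?_ ?_) (by omega) (fun _ _ _ h => h)
  · rintro j s' hj hb hf hi ⟨hq', hsc', hsrc', hk', h9, hin⟩
    have hn' : s'.var 2 = n := (hf.var 2 rfl).trans hn
    have hu : s'.var 8 = s.arr 9 k := (hf.var 8 rfl).trans h8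
    have harc : s'.IsArc n = s₀.IsArc n := Store.isArc_congr ((hf.arr 0 rfl).trans h0)
      ((hf.arr 6 rfl).trans h6) ((hf.arr 7 rfl).trans h7)
    have htest := eval_arcTest_ne_zero hn'
    rw [hi, hu, harc] at htest
    have htail := hq'.tail_le
    refine Run.of_wp_le ⟨fun he => ?_, fun he => ?_⟩ (by decide)
    · obtain ⟨hj0, ha⟩ := htest.mp he
      have hur' := (hq'.mem k hk').2
      rw [h9] at hur'
      have hq'' := IsQueue.enqueue hq' hj hj0 (par' := Function.update (s'.arr 10) j (s.arr 9 k))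
        (fun x hx => Function.update_of_ne hx _ _) (Or.inr (by
          rw [Function.update_self]
          exact ⟨hun, by omega, ha⟩))
      simp only [Prog.wp, enqueue, Expr.Small, Expr.eval, BinOp.eval, true_and, Store.arr_setVar,
        Store.arr_setArr, Store.var_setVar, Store.var_setArr, hi, hu]
      refine ⟨by omega, by simpa [Searching] using hq'', ?_, ?_, ?_, ?_, ?_⟩
      · intro w hw hpos hle v hv ha'
        have hwj : w ≠ j := by
          rintro rfl
          simp at hle; omega
        simp only [Store.arr_setVar, Store.arr_setArr, Nat.reduceEqDiff, reduceIte] at hpos hle ⊢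
        rw [Function.update_of_ne hwj] at hpos hle
        by_cases hvj : v = j
        · simp [hvj]
        · rw [Function.update_of_ne hvj]; exact hsc' w hw hpos hle v hv ha'
      · intro v hv hvs
        by_cases hvj : v = j
        · simp [hvj]
        · simpa [hvj] using hsrc' v hv hvs
      · simp; omega
      · have : k ≠ s'.var 7 := by omega
        simpa [this] using h9
      · intro v hv hvs
        by_cases hvj : v = j
        · simp [hvj]
        · simpa [hvj] using hin v (by omega) hvs
    · refine ⟨by simpa [Searching] using hq', hsc', hsrc', by simpa using hk', h9, ?_⟩
      intro v hv ha
      by_cases hvj : v = j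
      · subst hvj
        by_contra hc
        exact htest.mpr ⟨by simpa using hc, ha⟩ he
      · exact hin v (by omega) ha
  · rintro s' hb hf ⟨hq', hsc', hsrc', hk', h9, hin⟩
    refine ⟨hq', ?_, hsrc'⟩
    intro w hw hpos hle v hv ha
    by_cases hwk : s'.arr 8 w ≤ k
    · exact hsc' w hw hpos hwk v hv ha
    · have hw1 : s'.arr 8 w = k + 1 := by omega
      have := (hq'.rank w hw hpos).2
      rw [hw1, Nat.add_sub_cancel, h9] at this
      rw [this] at hin
      exact hin v hv ha

theorem run_search {B n : ℕ} (hB : n * n + n + 2 ≤ B) {s : Store} (hn : s.var 2 = n) :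
    Run B search s (80 * n * n + 110 * n + 30) fun s' =>
      Searching n s s' ∧ (∀ v < n, s.IsSource v → 0 < s'.arr 8 v) ∧
      ∀ u < n, 0 < s'.arr 8 u → ∀ v < n, s.IsArc n u v → 0 < s'.arr 8 v := by
  refine Run.mono (T := (60 * n + 20) + (n * ((80 * n + 24) + 8) + 6))
    (Run.seq (run_seedQueue hB hn) ?_) (by ring_nf; omega) (fun _ _ _ h => h)
  rintro s1 hb1 hf1 ⟨hq1, hsrc1⟩
  have hn1 : s1.var 2 = n := (hf1.var 2 rfl).trans hn
  refine Run.forLoop (fun k s' => Searching n s s' ∧ Scanned n s s' k ∧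
    ∀ v < n, s.IsSource v → 0 < s'.arr 8 v) hn1 rfl (by decide) rfl
    ⟨hq1, fun w _ hpos hle => absurd hpos (by simp at hle; simp [hle]), hsrc1⟩ ?_ ?_
  · rintro k s' hk hb hf hi ⟨hq, hsc, hsrc⟩
    have hn' : s'.var 2 = n := (hf.var 2 rfl).trans hn1
    refine Run.mono (T := 4 + (3 + (80 * n + 10))) (Run.ite (fun he => ?_) fun he => ?_)
      (by omega) (fun _ _ _ h => h)
    · have hlt : k < s'.var 7 := by
        by_contra hc
        simp [Expr.eval, BinOp.eval, hi, hc] at he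
      refine Run.seq (R := fun s2 => s2 = s'.setVar 8 (s'.arr 9 k)) (Run.of_wp_le ?_ (by decide)) ?_
      · simp [Prog.wp, Expr.Small, Expr.eval, hi]
      rintro s2 _ _ rfl
      exact run_scanArcs (s₀ := s) hB (by simpa using hn') ((hf.arr 0 rfl).trans (hf1.arr 0 rfl))
        ((hf.arr 6 rfl).trans (hf1.arr 6 rfl)) ((hf.arr 7 rfl).trans (hf1.arr 7 rfl)) hq hlt
        (by simp) hsc hsrc
    · refine Run.of_wp_le ?_ (by simp only [Prog.cost]; omega)
      have hge : s'.var 7 ≤ k := by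
        by_contra hc
        simp [Expr.eval, BinOp.eval, hi, not_le.mp hc] at he
      refine ⟨hq, fun w hw hpos hle => hsc w hw hpos ?_, hsrc⟩
      exact (hq.rank w hw hpos).1.trans hge
  · rintro s' hb hf ⟨hq, hsc, hsrc⟩
    exact ⟨hq, hsrc, fun w hw hpos => hsc w hw hpos ((hq.rank w hw hpos).1.trans hq.tail_le)⟩

end WordRAM

namespace WordRAM

open TokenFlow

/-! ### The primal-dual method -/

/-- Writing to an array changes one entry of the matrix that it holds. -/
theorem update_entry {n u v a b k : ℕ} (f : ℕ → ℕ) (hv : v < n) (hb : b < n) :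
    Function.update f (u * n + v) k (a * n + b) =
      if a = u ∧ b = v then k else f (a * n + b) := by
  by_cases h : a = u ∧ b = v
  · rw [if_pos h, h.1, h.2, Function.update_self]
  · rw [if_neg h, Function.update_of_ne]
    intro he
    apply h
    have h1 : (a * n + b) / n = (u * n + v) / n := by rw [he]
    rw [mul_comm, Nat.mul_add_div (by omega), Nat.div_eq_of_lt hb, mul_comm u,
      Nat.mul_add_div (by omega), Nat.div_eq_of_lt hv] at h1
    have h2 : a = u := by omega
    subst h2
    exact ⟨rfl, by omega⟩

/-- Find a vertex with remaining demand that the search has found. -/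
def findTarget : Prog :=
  .seq (.assign 10 (.var 2))
    (forLoop 5 (.ite (.op .mul (.read 8 (.var 5)) (.read 5 (.var 5))) (.assign 10 (.var 5)) .skip))

/-- Change the flow on the arc to the vertex in variable `9` from its parent. -/
def augmentArc : Prog :=
  .seq (.assign 8 (.read 10 (.var 9)))
    (.seq (.ite (.read 6 (entry 9 8))
        (.write 6 (entry 9 8) (.op .sub (.read 6 (entry 9 8)) (.const 1)))
        (.write 6 (entry 8 9) (.op .add (.read 6 (entry 8 9)) (.const 1))))
      (.assign 9 (.var 8)))

/-- Send one unit of flow to the vertex in variable `10`, along the path that the search found. -/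
def augment : Prog :=
  .seq (.seq (.assign 9 (.var 10)) (.write 5 (.var 9) (.const 0)))
    (.seq (.loop (.op .eq (.read 4 (.var 9)) (.const 0)) augmentArc)
      (.seq (.write 4 (.var 9) (.const 0)) (.assign 3 (.op .sub (.var 3) (.const 1)))))

/-- Raise the potential of all vertices that the search found. -/
def raisePotential : Prog :=
  .seq (forLoop 5 (.ite (.read 8 (.var 5))
      (.write 7 (.var 5) (.op .add (.read 7 (.var 5)) (.const 1))) .skip))
    (.assign 4 (.op .add (.var 4) (.const 1)))

/-- Search, then augment the flow or raise the potential. -/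
def primalDualRound : Prog :=
  .seq search (.seq findTarget (.ite (.op .lt (.var 10) (.var 2)) augment raisePotential))

/-- The primal-dual method. -/
def primalDual : Prog :=
  .loop (.op .mul (.var 3) (.op .lt (.var 4) (.var 2))) primalDualRound

/-- The memory holds a flow for a part of the supply. -/
structure HoldsFlow (n : ℕ) (s : Store) : Prop where
  flow : IsPartialFlow n (s.adj n) (s.arr 1) (s.arr 2) (s.arr 7) (s.mat n 6) (s.arr 4) (s.arr 5)
    (s.var 4)
  symm : ∀ u < n, ∀ v < n, s.adj n u v → s.adj n v u
  count : s.var 3 = ∑ v ∈ Finset.range n, s.arr 4 v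
  bound : ∀ u < n, ∀ v < n, s.mat n 6 u v + s.var 3 ≤ n
  le : s.var 4 ≤ n

theorem run_findTarget {B n : ℕ} {s : Store} (hn : s.var 2 = n) :
    Run B findTarget s (20 * n + 10) fun s' =>
      (s'.var 10 < n ∧ 0 < s.arr 8 (s'.var 10) ∧ 0 < s.arr 5 (s'.var 10)) ∨
        (s'.var 10 = n ∧ ∀ v < n, 0 < s.arr 5 v → s.arr 8 v = 0) := by
  refine Run.mono (T := 2 + (n * (12 + 8) + 6)) (Run.seq (R := fun s1 => s1 = s.setVar 10 n)
    (Run.of_wp_le ⟨trivial, by rw [← hn]; rfl⟩ (by decide)) ?_) (by omega) (fun _ _ _ h => h)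
  rintro s1 _ _ rfl
  refine Run.forLoop (fun k s' =>
      (s'.var 10 < n ∧ 0 < s.arr 8 (s'.var 10) ∧ 0 < s.arr 5 (s'.var 10)) ∨
        (s'.var 10 = n ∧ ∀ v < k, 0 < s.arr 5 v → s.arr 8 v = 0)) (by simpa using hn) rfl
    (by decide) rfl (by simp) ?_ (fun s' _ _ h => h)
  intro k s' hk hb hf hi hinv
  have h8 : s'.arr 8 = s.arr 8 := hf.arr 8 rfl
  have h5 : s'.arr 5 = s.arr 5 := hf.arr 5 rfl
  refine Run.of_wp_le ⟨fun he => ?_, fun he => ?_⟩ (by decide)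
  · simp only [Expr.eval, BinOp.eval_mul_ne_zero, hi, h8, h5] at he
    refine ⟨trivial, Or.inl ?_⟩
    simp only [Expr.eval, hi, Store.var_setVar, Nat.reduceEqDiff, reduceIte]
    exact ⟨hk, Nat.pos_of_ne_zero he.1, Nat.pos_of_ne_zero he.2⟩
  · rw [← not_not (a := _ = 0), ← ne_eq] at he
    simp only [Expr.eval, BinOp.eval_mul_ne_zero, hi, h8, h5] at he
    simp only [Prog.wp, Store.var_setVar, Nat.reduceEqDiff, reduceIte]
    refine hinv.imp id fun ⟨h1, h2⟩ => ⟨h1, fun v hv hpos => ?_⟩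
    by_cases hvk : v = k
    · subst hvk
      by_contra hne
      exact he ⟨hne, by omega⟩
    · exact h2 v (by omega) hpos

theorem run_raisePotential {B n : ℕ} (hB : n * n + n + 2 ≤ B) {s₀ s : Store} (hn : s.var 2 = n)
    (hfl : HoldsFlow n s) (hK : s.var 4 < n) (h4 : s.arr 4 = s₀.arr 4)
    (harc : s.IsArc n = s₀.IsArc n)
    (hsrc : ∀ v < n, s₀.IsSource v → 0 < s.arr 8 v)
    (hcl : ∀ u < n, 0 < s.arr 8 u → ∀ v < n, s₀.IsArc n u v → 0 < s.arr 8 v)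
    (hdem : ∀ v < n, 0 < s.arr 5 v → s.arr 8 v = 0) :
    Run B raisePotential s (30 * n + 20) fun s' =>
      HoldsFlow n s' ∧ s'.var 3 = s.var 3 ∧ s'.var 4 = s.var 4 + 1 := by
  refine Run.mono (T := (n * (15 + 8) + 6) + 4) (Run.seq
    (Run.forLoop (fun k s' => ∀ v < n,
        s'.arr 7 v = s.arr 7 v + if v < k ∧ 0 < s.arr 8 v then 1 else 0)
      hn rfl (by decide) rfl (by simp) ?_ (fun s' _ _ h => h)) ?_) (by omega) (fun _ _ _ h => h)
  · intro k s' hk hb hf hi hinv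
    have h8 : s'.arr 8 = s.arr 8 := hf.arr 8 rfl
    have hπ := hfl.flow.le k hk
    refine Run.of_wp_le ⟨fun he => ?_, fun he => ?_⟩ (by decide)
    · simp only [Expr.eval, hi, h8] at he
      have hk7 := hinv k hk
      simp only [lt_irrefl, false_and, if_false, add_zero] at hk7
      simp only [Prog.wp, Expr.Small, Expr.eval, BinOp.eval, hi]
      refine ⟨by omega, fun v hv => ?_⟩
      simp only [Store.arr_setVar, Store.arr_setArr, reduceIte]
      by_cases hvk : v = k
      · subst hvk
        rw [Function.update_self, hk7, if_pos ⟨by omega, by omega⟩]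
      · rw [Function.update_of_ne hvk, hinv v hv]
        have : v < k + 1 ↔ v < k := by omega
        simp only [this]
    · simp only [Expr.eval, hi, h8] at he
      intro v hv
      rw [Store.arr_setVar, hinv v hv]
      by_cases hvk : v = k
      · subst hvk; simp [he]
      · have : v < k + 1 ↔ v < k := by omega
        simp only [this]
  intro s1 hb1 hf1 h7
  have h41 : s1.var 4 = s.var 4 := hf1.var 4 rfl
  refine Run.of_wp_le ⟨?_, ?_⟩ (by decide)
  · simp only [Expr.Small, Expr.eval]; omega
  simp only [Expr.eval, BinOp.eval, h41]
  have h7' : ∀ v < n, s1.arr 7 v = s.arr 7 v + if 0 < s.arr 8 v then 1 else 0 := by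
    intro v hv; simp [h7 v hv, hv]
  have hadj : (s1.setVar 4 (s.var 4 + 1)).adj n = s.adj n := by
    funext u v; simp only [Store.adj, Store.mat, Store.arr_setVar, hf1.arr 0 rfl]
  have hg : (s1.setVar 4 (s.var 4 + 1)).mat n 6 = s.mat n 6 := by
    funext u v; simp only [Store.mat, Store.arr_setVar, hf1.arr 6 rfl]
  refine ⟨⟨?_, ?_, ?_, ?_, ?_⟩, ?_, ?_⟩
  · rw [hadj, hg]
    simp only [Store.arr_setVar, Store.var_setVar, reduceIte, hf1.arr 1 rfl, hf1.arr 2 rfl,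
      hf1.arr 4 rfl, hf1.arr 5 rfl]
    refine hfl.flow.raise hfl.symm (fun v => 0 < s.arr 8 v) ?_ ?_ ?_ ?_ ?_
    · intro v hv hpos
      exact hsrc v hv (by rw [Store.IsSource, ← h4]; exact hpos)
    · intro v hv hpos
      simp [hdem v hv hpos]
    · intro u hu v hv hRu hRv ha
      refine hRv (hcl u hu hRu v hv ?_)
      rw [← harc]; exact ha
    · intro v hv hR; rw [h7' v hv, if_pos hR]
    · intro v hv hR; rw [h7' v hv, if_neg hR, add_zero]
  · rw [hadj]; exact hfl.symm
  · simp only [Store.arr_setVar, Store.var_setVar, Nat.reduceEqDiff, reduceIte, hf1.arr 4 rfl,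
      hf1.var 3 rfl]
    exact hfl.count
  · rw [hg]
    simp only [Store.var_setVar, Nat.reduceEqDiff, reduceIte, hf1.var 3 rfl]
    exact hfl.bound
  · simp; omega
  · simp [hf1.var 3 rfl]
  · simp

/-- The invariant of the augmentation: the unit of demand at the target has been moved to the
vertex `v` on the search path, and the flow between the vertices up to `v` is still the old one. -/
structure IsAugmenting (n : ℕ) (s s' : Store) : Prop where
  tight : IsTight n (s.adj n) (s.arr 7) (s'.mat n 6)
  cons : IsConserving n (s.arr 1) (s.arr 2) (s'.mat n 6) (s.arr 4)
    fun x => s.arr 5 x + if x = s'.var 9 then 1 else 0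
  lt : s'.var 9 < n
  found : 0 < s.arr 8 (s'.var 9)
  old : ∀ a < n, ∀ b < n, s.arr 8 a ≤ s.arr 8 (s'.var 9) → s.arr 8 b ≤ s.arr 8 (s'.var 9) →
    s'.mat n 6 a b = s.mat n 6 a b
  le : ∀ a < n, ∀ b < n, s'.mat n 6 a b ≤ s.mat n 6 a b + 1

theorem run_augmentArc {B n : ℕ} (hB : n * n + n + 2 ≤ B) {s s' : Store} (hn : s'.var 2 = n)
    (hg : ∀ u < n, ∀ v < n, s.mat n 6 u v ≤ n)
    (hpar : ∀ v < n, 0 < s.arr 8 v → 0 < s.arr 4 v ∨ (s.arr 10 v < n ∧ 0 < s.arr 8 (s.arr 10 v) ∧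
      s.arr 8 (s.arr 10 v) < s.arr 8 v ∧ s.IsArc n (s.arr 10 v) v))
    (h10 : s'.arr 10 = s.arr 10)
    (hinv : IsAugmenting n s s') (h0 : s.arr 4 (s'.var 9) = 0) :
    Run B augmentArc s' 40 fun s'' =>
      IsAugmenting n s s'' ∧ s.arr 8 (s''.var 9) < s.arr 8 (s'.var 9) := by
  obtain ⟨ht, hc, hv, hpos, hold, hle⟩ := hinv
  obtain ⟨hu, hupos, hrk, hadj, harc⟩ := (hpar _ hv hpos).resolve_left (by omega)
  generalize hvv : s'.var 9 = v at *
  generalize huu : s.arr 10 v = u at *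
  have hvu : s'.mat n 6 v u = s.mat n 6 v u := hold v hv u hu le_rfl hrk.le
  have huv : s'.mat n 6 u v = s.mat n 6 u v := hold u hu v hv hrk.le le_rfl
  refine Run.of_wp_le ?_ (by decide)
  have e1 : s'.arr 6 (v * n + u) = s'.mat n 6 v u := rfl
  have e2 : s'.arr 6 (u * n + v) = s'.mat n 6 u v := rfl
  simp only [augmentArc, Prog.wp, entry, Expr.Small, Expr.eval, BinOp.eval, true_and,
    Store.var_setVar, Store.arr_setVar, Store.var_setArr, Nat.reduceEqDiff, reduceIte, hvv, hn,
    h10, huu, e1, e2]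
  refine ⟨fun he => ⟨?_, hrk⟩, fun he => ⟨?_, ?_, hrk⟩⟩
  · -- cancel flow from `v` to `u`
    set s'' := ((s'.setVar 8 u).setArr 6 (v * n + u) (s'.mat n 6 v u - 1)).setVar 9 u with hs''
    have hmat : ∀ a < n, ∀ b < n, s''.mat n 6 a b =
        if a = v ∧ b = u then s'.mat n 6 v u - 1 else s'.mat n 6 a b := by
      intro a ha b hb
      simp only [hs'', Store.mat, Store.arr_setVar, Store.arr_setArr, reduceIte]
      exact update_entry _ hu hb
    have h9 : s''.var 9 = u := by simp [hs'']
    have hpush : IsPush n v u (s''.mat n 6) (s'.mat n 6) := by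
      intro a ha b hb
      rw [hmat a ha b hb]
      split_ifs with h
      · rw [h.1, h.2]; omega
      · omega
    refine ⟨ht.cancel hpush, ?_, ?_, ?_, ?_, ?_⟩
    · rw [h9]; exact hc.cancel hu hv hpush
    · rwa [h9]
    · rwa [h9]
    · intro a ha b hb hra hrb
      rw [h9] at hra hrb
      rw [hmat a ha b hb, if_neg (by rintro ⟨rfl, rfl⟩; omega)]
      exact hold a ha b hb (by omega) (by omega)
    · intro a ha b hb
      rw [hmat a ha b hb]
      split_ifs with h
      · rw [h.1, h.2, hvu]; omega
      · exact hle a ha b hb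
  · have := hg u hu v hv
    omega
  · -- push flow from `u` to `v`
    set s'' := ((s'.setVar 8 u).setArr 6 (u * n + v) (s'.mat n 6 u v + 1)).setVar 9 u with hs''
    have hmat : ∀ a < n, ∀ b < n, s''.mat n 6 a b =
        if a = u ∧ b = v then s'.mat n 6 u v + 1 else s'.mat n 6 a b := by
      intro a ha b hb
      simp only [hs'', Store.mat, Store.arr_setVar, Store.arr_setArr, reduceIte]
      exact update_entry _ hv hb
    have h9 : s''.var 9 = u := by simp [hs'']
    have hpush : IsPush n u v (s'.mat n 6) (s''.mat n 6) := by
      intro a ha b hb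
      rw [hmat a ha b hb]
      split_ifs with h
      · rw [h.1, h.2]
      · omega
    have hπ : s.arr 7 u = s.arr 7 v + 1 := harc.resolve_right (by omega)
    refine ⟨ht.push hpush hadj hπ, ?_, ?_, ?_, ?_, ?_⟩
    · rw [h9]; exact hc.push hu hv hpush
    · rwa [h9]
    · rwa [h9]
    · intro a ha b hb hra hrb
      rw [h9] at hra hrb
      rw [hmat a ha b hb, if_neg (by rintro ⟨rfl, rfl⟩; omega)]
      exact hold a ha b hb (by omega) (by omega)
    · intro a ha b hb
      rw [hmat a ha b hb]
      split_ifs with h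
      · rw [h.1, h.2, huv]
      · exact hle a ha b hb

/-- The parents have smaller ranks, so the walk back to a source takes at most `n` steps. -/
theorem run_augment {B n : ℕ} (hB : n * n + n + 2 ≤ B) {s : Store} (hn : s.var 2 = n)
    (hfl : HoldsFlow n s) (ht : s.var 10 < n) (hrt : 0 < s.arr 8 (s.var 10))
    (hrn : ∀ v < n, s.arr 8 v ≤ n) (hdt : 0 < s.arr 5 (s.var 10))
    (hpar : ∀ v < n, 0 < s.arr 8 v → 0 < s.arr 4 v ∨ (s.arr 10 v < n ∧ 0 < s.arr 8 (s.arr 10 v) ∧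
      s.arr 8 (s.arr 10 v) < s.arr 8 v ∧ s.IsArc n (s.arr 10 v) v)) :
    Run B augment s (50 * n + 30) fun s' =>
      HoldsFlow n s' ∧ s'.var 3 + 1 = s.var 3 ∧ s'.var 4 = s.var 4 := by
  obtain ⟨t, htt⟩ : ∃ t, s.var 10 = t := ⟨_, rfl⟩
  rw [htt] at ht hrt hdt
  have hdt1 : s.arr 5 t = 1 := by have := hfl.flow.dem_le t ht; omega
  refine Run.mono (T := 5 + ((45 * n + 5) + 8)) (Run.seq
    (R := fun s1 => s1 = (s.setVar 9 t).setArr 5 t 0) (Run.of_wp_le ?_ (by decide)) ?_)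
    (by omega) (fun _ _ _ h => h)
  · simp [Prog.wp, Expr.Small, Expr.eval, htt]
  rintro s1 _ _ hs1
  have hn1 : s1.var 2 = n := by simp [hs1, hn]
  have hadj1 : s1.adj n = s.adj n := by funext u v; simp [hs1, Store.adj, Store.mat]
  have hg1 : s1.mat n 6 = s.mat n 6 := by funext u v; simp [hs1, Store.mat]
  have harr : ∀ a, a ≠ 5 → s1.arr a = s.arr a := fun a ha => by simp [hs1, ha]
  have h51 : ∀ x, x ≠ t → s1.arr 5 x = s.arr 5 x := fun x hx => by simp [hs1, hx]
  have h5t : s1.arr 5 t = 0 := by simp [hs1]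
  have h91 : s1.var 9 = t := by simp [hs1]
  have harc1 : s1.IsArc n = s.IsArc n :=
    Store.isArc_congr (harr 0 (by decide)) (harr 6 (by decide)) (harr 7 (by decide))
  have hle1 : s.arr 8 t ≤ n := hrn t ht
  refine Run.seq (T₁ := 45 * n + 5) (T₂ := 8)
    (R := fun s2 => IsAugmenting n s1 s2 ∧ 0 < s.arr 4 (s2.var 9)) ?_ ?_
  · refine Run.mono (Run.loop (fun s2 => IsAugmenting n s1 s2) (fun s2 => s.arr 8 (s2.var 9) * 45)
      ?_ ?_ ?_) ?_ (fun _ _ _ h => h)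
    · refine ⟨?_, ?_, by rwa [h91], by rw [h91, harr 8 (by decide)]; exact hrt,
        fun _ _ _ _ _ _ => rfl, fun _ _ _ _ => Nat.le_succ _⟩
      · rw [hadj1, hg1, harr 7 (by decide)]; exact hfl.flow.tight
      · intro x hx
        have := hfl.flow.cons x hx
        rw [hg1, harr 1 (by decide), harr 2 (by decide), harr 4 (by decide), h91]
        simp only
        by_cases hxt : x = t
        · subst hxt; rw [if_pos rfl, h5t]; omega
        · rw [if_neg hxt, h51 x hxt]; omega
    · -- each step takes time `40`, and the test takes time `5`
      intro s2 hb2 hf2 hinv he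
      have h4 : s2.arr 4 = s.arr 4 := (hf2.arr 4 rfl).trans (harr 4 (by decide))
      simp only [Expr.eval, BinOp.eval_eq_ne_zero, h4] at he
      refine ⟨40, (run_augmentArc (s := s1) hB ((hf2.var 2 rfl).trans hn1) ?_ ?_ (hf2.arr 10 rfl)
        hinv ?_).mono le_rfl fun s3 _ _ h => ⟨h.1, ?_⟩⟩
      · intro u hu v hv; rw [hg1]; have := hfl.bound u hu v hv; omega
      · rw [harr 8 (by decide), harr 10 (by decide), harr 4 (by decide), harc1]; exact hpar
      · rw [harr 4 (by decide)]; exact he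
      · have hlt := h.2
        rw [harr 8 (by decide)] at hlt
        simp only [Expr.cost]
        omega
    · intro s2 hb2 hf2 hinv he
      have h4 : s2.arr 4 = s.arr 4 := (hf2.arr 4 rfl).trans (harr 4 (by decide))
      rw [← not_not (a := _ = 0), ← ne_eq] at he
      simp only [Expr.eval, BinOp.eval_eq_ne_zero, h4] at he
      exact ⟨hinv, Nat.pos_of_ne_zero he⟩
    · simp only [h91, Expr.cost]; omega
  rintro s2 hb2 hf2 ⟨⟨htight, hcons, hv, hvpos, hold, hgle⟩, hroot⟩
  obtain ⟨v, hvv⟩ : ∃ v, s2.var 9 = v := ⟨_, rfl⟩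
  rw [hvv] at hcons hv hroot
  have hfr : ∀ a, a ≠ 5 → a ≠ 6 → s2.arr a = s.arr a := fun a h5 h6 =>
    (hf2.arr a (by simp [augmentArc, Prog.setsArr, h6.symm])).trans (harr a h5)
  have hsv : s.arr 4 v = 1 := by have := hfl.flow.src_le v hv; omega
  have h32 : s2.var 3 = s.var 3 := (hf2.var 3 rfl).trans (by simp [hs1])
  have h42 : s2.var 4 = s.var 4 := (hf2.var 4 rfl).trans (by simp [hs1])
  have h52 : s2.arr 5 = s1.arr 5 := hf2.arr 5 rfl
  refine Run.of_wp_le ?_ (by decide)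
  simp only [Prog.wp, Expr.Small, Expr.eval, BinOp.eval, true_and, Store.var_setArr, hvv, h32]
  set s3 := (s2.setArr 4 v 0).setVar 3 (s.var 3 - 1) with hs3
  have hadj3 : s3.adj n = s.adj n := by
    funext a b; simp [hs3, Store.adj, Store.mat, hfr]
  have hg3 : s3.mat n 6 = s2.mat n 6 := by funext a b; simp [hs3, Store.mat]
  have h43 : ∀ x, x ≠ v → s3.arr 4 x = s.arr 4 x := fun x hx => by simp [hs3, hfr, hx]
  have h4v : s3.arr 4 v = 0 := by simp [hs3]
  have h53 : s3.arr 5 = s1.arr 5 := by simp [hs3, h52]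
  have h5le : ∀ x, s1.arr 5 x ≤ s.arr 5 x := by
    intro x
    by_cases hx : x = t
    · rw [hx, h5t]; omega
    · rw [h51 x hx]
  have h4le : ∀ x, s3.arr 4 x ≤ s.arr 4 x := by
    intro x
    by_cases hx : x = v
    · rw [hx, h4v]; omega
    · rw [h43 x hx]
  have harr3 : ∀ a, a ≠ 4 → a ≠ 5 → a ≠ 6 → s3.arr a = s.arr a := fun a h4 h5 h6 => by
    simp [hs3, h4, hfr a h5 h6]
  have hsum : ∑ x ∈ Finset.range n, s.arr 4 x = ∑ x ∈ Finset.range n, s3.arr 4 x + 1 := by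
    refine sum_range_eq_succ hv fun x hx => ?_
    by_cases hxv : x = v
    · rw [hxv, if_pos rfl, h4v, hsv]
    · rw [if_neg hxv, h43 x hxv, add_zero]
  have hcount := hfl.count
  have hvar3 : s3.var 3 = s.var 3 - 1 := by simp [hs3]
  have hvar4 : s3.var 4 = s.var 4 := by simp [hs3, h42]
  refine ⟨⟨⟨?_, ?_, ?_, ?_, ?_, ?_, ?_⟩, ?_, ?_, ?_, ?_⟩, ?_, hvar4⟩
  · rw [hadj3, hg3, harr3 7 (by decide) (by decide) (by decide)]
    rw [hadj1, harr 7 (by decide)] at htight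
    exact htight
  · intro x hx
    have := hcons x hx
    rw [hg3, harr3 1 (by decide) (by decide) (by decide),
      harr3 2 (by decide) (by decide) (by decide), h53]
    rw [harr 1 (by decide), harr 2 (by decide), harr 4 (by decide)] at this
    simp only at this
    by_cases hxv : x = v
    · subst hxv; rw [if_pos rfl, hsv] at this; rw [h4v]; omega
    · rw [if_neg hxv] at this; rw [h43 x hxv]; omega
  · rw [harr3 7 (by decide) (by decide) (by decide), hvar4]; exact hfl.flow.le
  · rw [harr3 7 (by decide) (by decide) (by decide), hvar4]
    exact fun x hx hpos => hfl.flow.of_src x hx (hpos.trans_le (h4le x))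
  · rw [harr3 7 (by decide) (by decide) (by decide), h53]
    exact fun x hx hpos => hfl.flow.of_dem x hx (hpos.trans_le (h5le x))
  · exact fun x hx => (h4le x).trans (hfl.flow.src_le x hx)
  · rw [h53]; exact fun x hx => (h5le x).trans (hfl.flow.dem_le x hx)
  · rw [hadj3]; exact hfl.symm
  · rw [hvar3]; omega
  · intro a ha b hb
    have h1 := hgle a ha b hb
    have h2 := hfl.bound a ha b hb
    rw [hg1] at h1
    rw [hg3, hvar3]; omega
  · rw [hvar4]; exact hfl.le
  · rw [hvar3]; omega

theorem HoldsFlow.congr {n : ℕ} {s s' : Store} (h : HoldsFlow n s)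
    (harr : ∀ a, a ≤ 7 → a ≠ 3 → s'.arr a = s.arr a) (h3 : s'.var 3 = s.var 3)
    (h4 : s'.var 4 = s.var 4) : HoldsFlow n s' := by
  have hadj : s'.adj n = s.adj n := by
    funext u v; simp only [Store.adj, Store.mat, harr 0 (by decide) (by decide)]
  have hg : s'.mat n 6 = s.mat n 6 := by
    funext u v; simp only [Store.mat, harr 6 (by decide) (by decide)]
  refine ⟨?_, ?_, ?_, ?_, ?_⟩
  · rw [hadj, hg, harr 1 (by decide) (by decide), harr 2 (by decide) (by decide),
      harr 7 (by decide) (by decide), harr 4 (by decide) (by decide),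
      harr 5 (by decide) (by decide), h4]
    exact h.flow
  · rw [hadj]; exact h.symm
  · rw [h3, harr 4 (by decide) (by decide)]; exact h.count
  · rw [hg, h3]; exact h.bound
  · rw [h4]; exact h.le

/-- A round of the primal-dual method takes quadratic time and makes progress. -/
theorem run_primalDualRound {B n : ℕ} (hB : n * n + n + 2 ≤ B) {s : Store} (hn : s.var 2 = n)
    (hfl : HoldsFlow n s) (hK : s.var 4 < n) :
    Run B primalDualRound s (80 * n * n + 200 * n + 100) fun s' =>
      HoldsFlow n s' ∧ s'.var 3 + (n - s'.var 4) + 1 ≤ s.var 3 + (n - s.var 4) := by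
  refine Run.mono (T := (80 * n * n + 110 * n + 30) + ((20 * n + 10) + (4 + (50 * n + 30))))
    (Run.seq (run_search hB hn) ?_) (by omega) (fun _ _ _ h => h)
  rintro s1 hb1 hf1 ⟨hq, hsrc, hcl⟩
  have hn1 : s1.var 2 = n := (hf1.var 2 rfl).trans hn
  refine Run.seq (run_findTarget hn1) ?_
  rintro s2 hb2 hf2 htgt
  have hn2 : s2.var 2 = n := (hf2.var 2 rfl).trans hn1
  have h3 : s2.var 3 = s.var 3 := (hf2.var 3 rfl).trans (hf1.var 3 rfl)
  have h4 : s2.var 4 = s.var 4 := (hf2.var 4 rfl).trans (hf1.var 4 rfl)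
  have h8 : s2.arr 8 = s1.arr 8 := hf2.arr 8 rfl
  have h10 : s2.arr 10 = s1.arr 10 := hf2.arr 10 rfl
  have harr : ∀ a, a ≤ 7 → a ≠ 3 → s2.arr a = s.arr a := by
    intro a ha _
    refine (hf2.arr a rfl).trans (hf1.arr a ?_)
    interval_cases a <;> rfl
  have hfl2 : HoldsFlow n s2 := hfl.congr harr h3 h4
  have harc : s2.IsArc n = s.IsArc n := Store.isArc_congr (harr 0 (by decide) (by decide))
    (harr 6 (by decide) (by decide)) (harr 7 (by decide) (by decide))
  have h5 : s2.arr 5 = s1.arr 5 := hf2.arr 5 rfl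
  refine Run.ite (fun he => ?_) fun he => ?_
  · simp only [Expr.eval, BinOp.eval_lt_ne_zero, hn2] at he
    obtain ⟨ht, hrt, hdt⟩ := htgt.resolve_right fun h => by omega
    refine (run_augment hB hn2 hfl2 ht (by rwa [h8]) ?_ (by rwa [h5]) ?_).mono (by omega)
      fun s3 _ _ h => ⟨h.1, by omega⟩
    · intro v hv
      rw [h8]
      by_cases hpos : 0 < s1.arr 8 v
      · exact (hq.rank v hv hpos).1.trans hq.tail_le
      · omega
    · rw [h8, h10, harc, harr 4 (by decide) (by decide)]
      exact hq.parent
  · rw [← not_not (a := _ = 0), ← ne_eq] at he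
    simp only [Expr.eval, BinOp.eval_lt_ne_zero, hn2] at he
    have hdem := (htgt.resolve_left fun h => he h.1).2
    refine (run_raisePotential hB (s₀ := s) hn2 hfl2 (by omega) (harr 4 (by decide) (by decide))
      harc (by rwa [h8]) (by rwa [h8]) (by rwa [h8, h5])).mono (by omega)
      fun s3 _ _ h => ⟨h.1, by omega⟩

/-- The primal-dual method takes cubic time, since each of its rounds removes a unit of supply or
raises the maximal potential, which stays at most `n`. -/
theorem run_primalDual {B n : ℕ} (hB : n * n + n + 2 ≤ B) {s : Store} (hn : s.var 2 = n)
    (hfl : HoldsFlow n s) (h3 : s.var 3 ≤ n) :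
    Run B primalDual s (2 * n * (80 * n * n + 200 * n + 110) + 10) fun s' =>
      HoldsFlow n s' ∧ (s'.var 3 = 0 ∨ s'.var 4 = n) := by
  refine Run.mono (Run.loop (fun s' => HoldsFlow n s')
    (fun s' => (s'.var 3 + (n - s'.var 4)) * (80 * n * n + 200 * n + 110)) hfl ?_ ?_) ?_
    (fun _ _ _ h => h)
  · intro s' hb hf hinv he
    have hn' : s'.var 2 = n := (hf.var 2 rfl).trans hn
    simp only [Expr.eval, BinOp.eval_mul_ne_zero, BinOp.eval_lt_ne_zero, hn'] at he
    refine ⟨_, (run_primalDualRound hB hn' hinv he.2).mono le_rfl fun s'' _ _ h => ⟨h.1, ?_⟩⟩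
    have := Nat.mul_le_mul_right (80 * n * n + 200 * n + 110) h.2
    rw [Nat.add_one_mul] at this
    simp only [Expr.cost]
    omega
  · intro s' hb hf hinv he
    have hn' : s'.var 2 = n := (hf.var 2 rfl).trans hn
    rw [← not_not (a := _ = 0), ← ne_eq] at he
    simp only [Expr.eval, BinOp.eval_mul_ne_zero, BinOp.eval_lt_ne_zero, hn'] at he
    have := hinv.le
    exact ⟨hinv, by omega⟩
  · have := Nat.mul_le_mul_right (80 * n * n + 200 * n + 110)
      (show s.var 3 + (n - s.var 4) ≤ 2 * n by omega)
    simp only [Expr.cost]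
    omega

end WordRAM

/-! ### Prolonging swapping sequences -/

namespace TokenPlacement

section

variable {V : Type*} {G : SimpleGraph V}

theorem IsSwappingSeq.concat {c : ℕ} {f f' f'' : TokenPlacement V c}
    {S : List (TokenPlacement V c)} (hS : IsSwappingSeq G f f' S) (h : Adjacent G f' f'') :
    IsSwappingSeq G f f'' (S ++ [f'']) := by
  obtain ⟨h1, h2, h3⟩ := hS
  refine ⟨?_, by simp, ?_⟩
  · rw [List.head?_append, h1]; rfl
  · refine List.isChain_append.mpr ⟨h3, by simp, fun x hx y hy => ?_⟩
    rw [h2] at hx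
    obtain rfl : f' = x := by simpa using hx
    obtain rfl : f'' = y := by simpa using hy
    exact h

theorem IsSwappingSeq.length_eq {c : ℕ} {f f' : TokenPlacement V c}
    {S : List (TokenPlacement V c)} (hS : IsSwappingSeq G f f' S) : S.length = seqLen S + 1 := by
  cases S with
  | nil => simp [IsSwappingSeq] at hS
  | cons a T => simp [seqLen]

theorem potential_swapTokens [Fintype V] [DecidableEq V] {π : V → ℕ} {f : TokenPlacement V 2}
    {u b : V} (hu : f.color u = 1) (hb : f.color b = 0) (hπ : π u = π b + 1) :
    potential π (swapTokens f (u, b)) + 1 = potential π f := by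
  have h1 : potential π (swapTokens f (u, b)) =
      ∑ x, (f.color x : ℕ) * π (Equiv.swap u b x) := by
    rw [potential, ← Equiv.sum_comp (Equiv.swap u b)]
    exact Finset.sum_congr rfl fun x _ => by simp [swapTokens]
  have h2 : (1 : ℕ) = ∑ x, if x = u then 1 else 0 := by simp
  rw [h1, h2, ← Finset.sum_add_distrib]
  refine Finset.sum_congr rfl fun x _ => ?_
  by_cases hxu : x = u
  · subst hxu; simp [hu, hπ]
  by_cases hxb : x = b
  · subst hxb; simp [hb, hxu]
  · simp [hxu, Equiv.swap_apply_of_ne_of_ne hxu hxb]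

end

end TokenPlacement

namespace WordRAM

open TokenFlow TokenPlacement

/-! ### Writing down a swapping sequence -/

/-- Compute the inflow of all vertices. -/
def sumInflow : Prog :=
  forLoop 6 (forLoop 5
    (.write 12 (.var 5) (.op .add (.read 12 (.var 5)) (.read 6 (entry 6 5)))))

/-- Choose an unoccupied vertex with inflow of maximal potential. -/
def chooseTarget : Prog :=
  .seq (.assign 10 (.var 2))
    (forLoop 5 (.ite (.op .mul (.op .eq (.read 11 (.var 5)) (.const 0)) (.read 12 (.var 5)))
      (.ite (.op .add (.op .eq (.var 10) (.var 2)) (.op .lt (.read 7 (.var 10)) (.read 7 (.var 5))))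
        (.assign 10 (.var 5)) .skip) .skip))

/-- Choose a vertex from which there is flow to the vertex in variable `10`. -/
def chooseOrigin : Prog :=
  forLoop 5 (.ite (.read 6 (entry 5 10)) (.assign 8 (.var 5)) .skip)

/-- Append the current placement to the output. -/
def emit : Prog :=
  .seq (forLoop 5 (.write 3 (entry 1 5) (.read 11 (.var 5))))
    (.assign 1 (.op .add (.var 1) (.const 1)))

/-- Update the memory for the move of a token from the vertex in variable `8` to the one in
variable `10`. -/
def moveToken : Prog :=
  .seq (.write 6 (entry 8 10) (.op .sub (.read 6 (entry 8 10)) (.const 1)))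
    (.seq (.write 12 (.var 10) (.op .sub (.read 12 (.var 10)) (.const 1)))
      (.seq (.write 11 (.var 8) (.const 0)) (.write 11 (.var 10) (.const 1))))

/-- Move tokens along flow and record the placements, until no flow is left to be realized. -/
def realize : Prog :=
  .seq sumInflow (.seq (.assign 12 (.const 1))
    (.loop (.var 12) (.seq chooseTarget (.ite (.op .lt (.var 10) (.var 2))
      (.seq chooseOrigin (.seq moveToken emit)) (.assign 12 (.const 0))))))

theorem run_sumInflow {B n : ℕ} (hB : n * n + n + 2 ≤ B) {s : Store} (hn : s.var 2 = n)
    (hg : ∀ u < n, ∀ v < n, s.mat n 6 u v ≤ n) (h0 : ∀ v < n, s.arr 12 v = 0) :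
    Run B sumInflow s (30 * n * n + 20 * n + 10) fun s' =>
      ∀ v < n, s'.arr 12 v = ∑ a ∈ Finset.range n, s.mat n 6 a v := by
  refine Run.mono (T := n * ((n * (20 + 8) + 6) + 8) + 6) (Run.forLoop
    (fun k s' => ∀ v < n, s'.arr 12 v = ∑ a ∈ Finset.range k, s.mat n 6 a v) hn rfl (by decide) rfl
    (by simpa using h0) ?_ (fun s' _ _ h => h)) (by ring_nf; omega) (fun _ _ _ h => h)
  intro k s1 hk hb1 hf1 hi1 hinv1
  have hn1 : s1.var 2 = n := (hf1.var 2 rfl).trans hn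
  refine Run.forLoop (fun j s' => ∀ v < n, s'.arr 12 v =
      ∑ a ∈ Finset.range k, s.mat n 6 a v + if v < j then s.mat n 6 k v else 0) hn1 rfl (by decide)
    rfl (by simpa using hinv1) ?_ ?_
  · intro j s2 hj hb2 hf2 hi2 hinv2
    have h6 : s2.arr 6 = s.arr 6 := (hf2.arr 6 rfl).trans (hf1.arr 6 rfl)
    have hk2 : s2.var 6 = k := (hf2.var 6 rfl).trans hi1
    have hn2 : s2.var 2 = n := (hf2.var 2 rfl).trans hn1
    have hj2 := hinv2 j hj
    simp only [lt_irrefl, if_false, add_zero] at hj2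
    have hle : ∑ a ∈ Finset.range k, s.mat n 6 a j ≤ k * n := by
      have := Finset.sum_le_card_nsmul (Finset.range k) (fun a => s.mat n 6 a j) n
        fun a ha => hg a ((Finset.mem_range.mp ha).trans hk) j hj
      simpa using this
    have hkn : k * n ≤ n * n := Nat.mul_le_mul_right _ hk.le
    have hgk := hg k hk j hj
    have e1 : s.arr 6 (k * n + j) = s.mat n 6 k j := rfl
    refine Run.of_wp_le ?_ (by decide)
    simp only [Prog.wp, entry, Expr.Small, Expr.eval, BinOp.eval, hi2, hk2, hn2, h6, hj2, e1]
    refine ⟨by omega, fun v hv => ?_⟩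
    simp only [Store.arr_setVar, Store.arr_setArr, reduceIte]
    by_cases hvj : v = j
    · subst hvj
      rw [Function.update_self, if_pos (by omega)]
    · rw [Function.update_of_ne hvj, hinv2 v hv]
      have : v < j + 1 ↔ v < j := by omega
      simp only [this]
  · intro s2 hb2 hf2 hinv2 v hv
    rw [Store.arr_setVar, hinv2 v hv, if_pos hv, Finset.sum_range_succ]

theorem run_chooseTarget {B n : ℕ} {s : Store} (hn : s.var 2 = n) :
    Run B chooseTarget s (40 * n + 10) fun s' =>
      (s'.var 10 = n ∧ ∀ v < n, s.arr 11 v = 0 → s.arr 12 v = 0) ∨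
        (s'.var 10 < n ∧ s.arr 11 (s'.var 10) = 0 ∧ 0 < s.arr 12 (s'.var 10) ∧
          ∀ v < n, s.arr 11 v = 0 → 0 < s.arr 12 v → s.arr 7 v ≤ s.arr 7 (s'.var 10)) := by
  refine Run.mono (T := 2 + (n * (32 + 8) + 6)) (Run.seq (R := fun s1 => s1 = s.setVar 10 n)
    (Run.of_wp_le ⟨trivial, by rw [← hn]; rfl⟩ (by decide)) ?_) (by omega) (fun _ _ _ h => h)
  rintro s1 _ _ rfl
  refine Run.forLoop (fun k s' =>
      (s'.var 10 = n ∧ ∀ v < k, s.arr 11 v = 0 → s.arr 12 v = 0) ∨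
        (s'.var 10 < n ∧ s.arr 11 (s'.var 10) = 0 ∧ 0 < s.arr 12 (s'.var 10) ∧
          ∀ v < k, s.arr 11 v = 0 → 0 < s.arr 12 v → s.arr 7 v ≤ s.arr 7 (s'.var 10)))
    (by simpa using hn) rfl (by decide) rfl (by simp) ?_ (fun s' _ _ h => h)
  intro k s' hk hb hf hi hinv
  have h11 : s'.arr 11 = s.arr 11 := hf.arr 11 rfl
  have h12 : s'.arr 12 = s.arr 12 := hf.arr 12 rfl
  have h7 : s'.arr 7 = s.arr 7 := hf.arr 7 rfl
  have hn' : s'.var 2 = n := (hf.var 2 rfl).trans (by simpa using hn)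
  refine Run.of_wp_le ⟨fun he => ⟨fun he' => ?_, fun he' => ?_⟩, fun he => ?_⟩ (by decide)
  · simp only [Expr.eval, BinOp.eval_mul_ne_zero, BinOp.eval_add_ne_zero, BinOp.eval_eq_ne_zero,
      BinOp.eval_lt_ne_zero, hi, h11, h12, h7, hn'] at he he'
    simp only [Prog.wp, Expr.Small, Expr.eval, hi, true_and, Store.var_setVar, Nat.reduceEqDiff,
      reduceIte]
    refine Or.inr ⟨hk, he.1, Nat.pos_of_ne_zero he.2, fun v hv hv1 hv2 => ?_⟩
    by_cases hvk : v = k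
    · rw [hvk]
    rcases hinv with ⟨_, hall⟩ | ⟨hlt, -, -, hmax⟩
    · exact absurd (hall v (by omega) hv1) hv2.ne'
    · have h1 := hmax v (by omega) hv1 hv2
      have h2 := he'.resolve_left (by omega)
      omega
  · rw [← not_not (a := _ = 0), ← ne_eq] at he'
    simp only [Expr.eval, BinOp.eval_mul_ne_zero, BinOp.eval_add_ne_zero, BinOp.eval_eq_ne_zero,
      BinOp.eval_lt_ne_zero, hi, h11, h12, h7, hn', not_or] at he he'
    simp only [Prog.wp, Store.var_setVar, Nat.reduceEqDiff, reduceIte]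
    rcases hinv with ⟨he1, _⟩ | ⟨hlt, h1, h2, hmax⟩
    · exact absurd he1 he'.1
    · refine Or.inr ⟨hlt, h1, h2, fun v hv hv1 hv2 => ?_⟩
      by_cases hvk : v = k
      · rw [hvk]; omega
      · exact hmax v (by omega) hv1 hv2
  · rw [← not_not (a := _ = 0), ← ne_eq] at he
    simp only [Expr.eval, BinOp.eval_mul_ne_zero, BinOp.eval_eq_ne_zero, hi, h11, h12] at he
    simp only [Prog.wp, Store.var_setVar, Nat.reduceEqDiff, reduceIte]
    refine hinv.imp (fun ⟨h1, h2⟩ => ⟨h1, fun v hv hv1 => ?_⟩)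
      (fun ⟨h1, h2, h3, h4⟩ => ⟨h1, h2, h3, fun v hv hv1 hv2 => ?_⟩)
    · by_cases hvk : v = k
      · subst hvk
        by_contra hne
        exact he ⟨hv1, hne⟩
      · exact h2 v (by omega) hv1
    · by_cases hvk : v = k
      · subst hvk
        exact absurd ⟨hv1, hv2.ne'⟩ he
      · exact h4 v (by omega) hv1 hv2

theorem run_chooseOrigin {B n : ℕ} {s : Store} (hn : s.var 2 = n)
    (hex : ∃ a < n, 0 < s.mat n 6 a (s.var 10)) :
    Run B chooseOrigin s (30 * n + 10) fun s' =>
      s'.var 8 < n ∧ 0 < s.mat n 6 (s'.var 8) (s.var 10) := by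
  refine Run.mono (T := n * (12 + 8) + 6) (Run.forLoop (fun k s' =>
      (∃ a < k, 0 < s.mat n 6 a (s.var 10)) → s'.var 8 < n ∧ 0 < s.mat n 6 (s'.var 8) (s.var 10))
    hn rfl (by decide) rfl (by simp) ?_ (fun s' _ _ h => h hex)) (by omega) (fun _ _ _ h => h)
  intro k s' hk hb hf hi hinv
  have h6 : s'.arr 6 = s.arr 6 := hf.arr 6 rfl
  have h10 : s'.var 10 = s.var 10 := hf.var 10 rfl
  have hn' : s'.var 2 = n := (hf.var 2 rfl).trans hn
  have hev : (Expr.read 6 (entry 5 10)).eval s' = s.mat n 6 k (s.var 10) := by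
    simp only [entry, Expr.eval, BinOp.eval, hi, h10, h6, hn', Store.mat]
  refine Run.of_wp_le ⟨fun he => ?_, fun he => ?_⟩ (by decide)
  · rw [hev] at he
    simp only [Prog.wp, Expr.Small, Expr.eval, hi, true_and, Store.var_setVar, Nat.reduceEqDiff,
      reduceIte]
    exact fun _ => ⟨hk, Nat.pos_of_ne_zero he⟩
  · rw [hev] at he
    simp only [Prog.wp, Store.var_setVar, Nat.reduceEqDiff, reduceIte]
    rintro ⟨a, ha, hpos⟩
    refine hinv ⟨a, ?_, hpos⟩
    have : a ≠ k := by rintro rfl; omega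
    omega

theorem run_emit {B n c : ℕ} (hB : n * n + n + 2 ≤ B) {s : Store} (hn : s.var 2 = n)
    (hc : s.var 1 = c) (hcn : c ≤ n * n) :
    Run B emit s (25 * n + 15) fun s' =>
      s'.var 1 = c + 1 ∧ ∀ k, ∀ v < n, s'.arr 3 (k * n + v) =
        if k = c then s.arr 11 v else s.arr 3 (k * n + v) := by
  refine Run.mono (T := (n * (15 + 8) + 6) + 4) (Run.seq (Run.forLoop (fun j s' =>
      ∀ k, ∀ v < n, s'.arr 3 (k * n + v) =
        if k = c ∧ v < j then s.arr 11 v else s.arr 3 (k * n + v))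
    hn rfl (by decide) rfl (by simp) ?_ (fun s' _ _ h => h)) ?_) (by omega) (fun _ _ _ h => h)
  · intro j s' hj hb hf hi hinv
    have h11 : s'.arr 11 = s.arr 11 := hf.arr 11 rfl
    have h1 : s'.var 1 = c := (hf.var 1 rfl).trans hc
    have hn' : s'.var 2 = n := (hf.var 2 rfl).trans hn
    refine Run.of_wp_le ?_ (by decide)
    simp only [Prog.wp, entry, Expr.Small, Expr.eval, BinOp.eval, true_and, hi, h1, hn', h11]
    intro k v hv
    simp only [Store.arr_setVar, Store.arr_setArr, reduceIte]
    rw [update_entry _ hj hv, hinv k v hv]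
    by_cases hk : k = c
    · by_cases hvj : v = j
      · subst hvj; simp [hk]
      · have : v < j + 1 ↔ v < j := by omega
        simp only [hk, hvj, this, and_false, if_false]
    · simp [hk]
  · intro s1 hb1 hf1 hinv
    have h1 : s1.var 1 = c := (hf1.var 1 rfl).trans hc
    refine Run.of_wp_le ⟨?_, ?_⟩ (by decide)
    · simp only [Expr.Small, Expr.eval, h1]; omega
    · simp only [Expr.eval, BinOp.eval, h1, Store.var_setVar, Store.arr_setVar, reduceIte, true_and]
      intro k v hv
      rw [hinv k v hv]
      simp [hv]

end WordRAM

namespace WordRAM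

open TokenFlow TokenPlacement

/-- The memory holds a swapping sequence that starts from `f₀`, together with a flow of slack arcs
that would carry the current placement to the target placement. -/
structure IsRealizing {n : ℕ} (G : SimpleGraph (Fin n)) (f₀ : TokenPlacement (Fin n) 2)
    (s : Store) : Prop where
  tight : IsTight n (s.adj n) (s.arr 7) (s.mat n 6)
  cons : IsConserving n (s.arr 11) (s.arr 2) (s.mat n 6) (fun _ => 0) fun _ => 0
  inflow : ∀ v < n, s.arr 12 v = ∑ a ∈ Finset.range n, s.mat n 6 a v
  seq : ∃ (S : List (TokenPlacement (Fin n) 2)) (f : TokenPlacement (Fin n) 2),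
    IsSwappingSeq G f₀ f S ∧ HoldsPlacements s S ∧ (∀ v : Fin n, (f.color v : ℕ) = s.arr 11 v) ∧
    potential (fun v : Fin n => s.arr 7 v) f + seqLen S =
      potential (fun v : Fin n => s.arr 7 v) f₀

theorem IsRealizing.congr {n : ℕ} {G : SimpleGraph (Fin n)} {f₀ : TokenPlacement (Fin n) 2}
    {s s' : Store} (h : IsRealizing G f₀ s) (harr : s'.arr = s.arr) (h1 : s'.var 1 = s.var 1) :
    IsRealizing G f₀ s' := by
  have hmat : s'.mat n = s.mat n := by funext a x y; simp only [Store.mat, harr]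
  have hadj : s'.adj n = s.adj n := by funext x y; simp only [Store.adj, hmat]
  obtain ⟨a1, a2, a3, S, f, b1, ⟨b2, b3⟩, b4, b5⟩ := h
  refine ⟨?_, ?_, ?_, S, f, b1, ⟨?_, ?_⟩, ?_, ?_⟩
  · rwa [hadj, harr, hmat]
  · rwa [harr, hmat]
  · rwa [harr, hmat]
  · rwa [h1]
  · rwa [harr]
  · rwa [harr]
  · rwa [harr]

theorem potential_eq_sum_range {n : ℕ} {π occ : ℕ → ℕ} {f : TokenPlacement (Fin n) 2}
    (h : ∀ v : Fin n, (f.color v : ℕ) = occ v) :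
    potential (fun v : Fin n => π v) f = ∑ v ∈ Finset.range n, occ v * π v := by
  rw [← Fin.sum_univ_eq_sum_range (fun v => occ v * π v)]
  exact Finset.sum_congr rfl fun v _ => by rw [h]

theorem potential_le_sq {n : ℕ} {π : ℕ → ℕ} (hπ : ∀ v < n, π v ≤ n) (f : TokenPlacement (Fin n) 2) :
    potential (fun v : Fin n => π v) f ≤ n * n := by
  have h := Finset.sum_le_card_nsmul Finset.univ
    (fun v : Fin n => (f.color v : ℕ) * π v) n fun v _ => by
      have h1 : (f.color v : ℕ) ≤ 1 := by have := (f.color v).isLt; omega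
      calc (f.color v : ℕ) * π v ≤ 1 * n := Nat.mul_le_mul h1 (hπ v v.2)
        _ = n := one_mul n
  simpa [potential] using h

/-- Moving a token along flow to an unoccupied vertex is a swap that lowers the total potential by
one. -/
theorem run_moveToken {B n : ℕ} (hB : n * n + n + 2 ≤ B) {G : SimpleGraph (Fin n)}
    {f₀ : TokenPlacement (Fin n) 2} {s : Store} (hn : s.var 2 = n)
    (hadj : ∀ u v : Fin n, s.adj n u v → G.Adj u v)
    (hπ : ∀ v < n, s.arr 7 v ≤ n) (hr : IsRealizing G f₀ s) {u b : ℕ} (hu : s.var 8 = u)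
    (hb : s.var 10 = b) (hun : u < n) (hbn : b < n) (hg : 0 < s.mat n 6 u b)
    (hou : s.arr 11 u = 1) (hob : s.arr 11 b = 0) :
    Run B (.seq moveToken emit) s (25 * n + 60) fun s' =>
      IsRealizing G f₀ s' ∧
      ∑ v ∈ Finset.range n, s'.arr 11 v * s'.arr 7 v + 1 =
        ∑ v ∈ Finset.range n, s.arr 11 v * s.arr 7 v := by
  obtain ⟨S, f, hS, ⟨hlen, hhold⟩, hocc, hpot⟩ := hr.seq
  have hslack := hr.tight.slack u hun b hbn hg
  have hub : u ≠ b := by rintro rfl; omega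
  have hin : 0 < s.arr 12 b := by
    rw [hr.inflow b hbn]
    exact hg.trans_le (Finset.single_le_sum (f := fun a => s.mat n 6 a b)
      (fun _ _ => Nat.zero_le _) (Finset.mem_range.mpr hun))
  refine Run.mono (T := 40 + (25 * n + 15)) (Run.seq
    (R := fun s1 => s1 = (((s.setArr 6 (u * n + b) (s.mat n 6 u b - 1)).setArr 12 b
      (s.arr 12 b - 1)).setArr 11 u 0).setArr 11 b 1) (Run.of_wp_le ?_ (by decide)) ?_) (by omega)
    (fun _ _ _ h => h)
  · simp only [moveToken, entry, Prog.wp, Expr.Small, Expr.eval, BinOp.eval, true_and,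
      Store.var_setArr, Store.arr_setArr, Nat.reduceEqDiff, reduceIte, hu, hb, hn]
    rfl
  rintro s1 _ _ hs1
  have harr1 : ∀ a, a ≠ 6 → a ≠ 11 → a ≠ 12 → s1.arr a = s.arr a := fun a h6 h11 h12 => by
    simp [hs1, h6, h11, h12]
  have hvar1 : s1.var = s.var := by simp [hs1]
  have hmat : ∀ x < n, ∀ y < n, s1.mat n 6 x y =
      if x = u ∧ y = b then s.mat n 6 u b - 1 else s.mat n 6 x y := by
    intro x hx y hy
    have : s1.arr 6 = Function.update (s.arr 6) (u * n + b) (s.mat n 6 u b - 1) := by simp [hs1]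
    rw [Store.mat, this]
    exact update_entry _ hbn hy
  have hpush : IsPush n u b (s1.mat n 6) (s.mat n 6) := by
    intro x hx y hy
    rw [hmat x hx y hy]
    split_ifs with h
    · rw [h.1, h.2]; omega
    · omega
  have h11u : s1.arr 11 u = 0 := by simp [hs1, hub]
  have h11b : s1.arr 11 b = 1 := by simp [hs1]
  have h11 : ∀ v, v ≠ u → v ≠ b → s1.arr 11 v = s.arr 11 v := fun v h1 h2 => by
    simp [hs1, h1, h2]
  have h12 : ∀ v < n, s1.arr 12 v + (if v = b then 1 else 0) = s.arr 12 v := by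
    intro v hv
    have : s1.arr 12 = Function.update (s.arr 12) b (s.arr 12 b - 1) := by simp [hs1]
    rw [this]
    by_cases h : v = b
    · subst h; simp; omega
    · simp [h]
  -- the placement after the swap
  have hUB : G.Adj ⟨u, hun⟩ ⟨b, hbn⟩ := hadj ⟨u, hun⟩ ⟨b, hbn⟩ hslack.1
  have hcu : f.color ⟨u, hun⟩ = 1 := Fin.ext (by rw [hocc]; exact hou)
  have hcb : f.color ⟨b, hbn⟩ = 0 := Fin.ext (by rw [hocc]; exact hob)
  have hadjf : Adjacent G f (swapTokens f (⟨u, hun⟩, ⟨b, hbn⟩)) :=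
    adjacent_swapTokens hUB (by rw [hcu, hcb]; decide)
  have hocc' : ∀ v : Fin n, ((swapTokens f (⟨u, hun⟩, ⟨b, hbn⟩)).color v : ℕ) = s1.arr 11 v := by
    intro v
    by_cases h1 : (v : ℕ) = u
    · have : v = ⟨u, hun⟩ := Fin.ext h1
      rw [h1, h11u, this]
      simp [swapTokens, hcb]
    by_cases h2 : (v : ℕ) = b
    · have : v = ⟨b, hbn⟩ := Fin.ext h2
      rw [h2, h11b, this]
      simp [swapTokens, hcu]
    rw [h11 v h1 h2, ← hocc]
    have h1' : v ≠ ⟨u, hun⟩ := fun h => h1 (by rw [h])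
    have h2' : v ≠ ⟨b, hbn⟩ := fun h => h2 (by rw [h])
    simp [swapTokens, Equiv.swap_apply_of_ne_of_ne h1' h2']
  have hS' := hS.concat hadjf
  have hpot' := potential_swapTokens (π := fun v : Fin n => s.arr 7 v) hcu hcb hslack.2
  have hlen' := hS.length_eq
  have hsq := potential_le_sq hπ f₀
  refine Run.mono (run_emit hB (c := S.length) (by rw [hvar1, hn]) (by rw [hvar1, hlen]) (by omega))
    le_rfl ?_
  rintro s2 hb2 hf2 ⟨hv1, hout⟩
  have harr2 : ∀ a, a ≠ 3 → s2.arr a = s1.arr a := fun a ha =>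
    hf2.arr a (by simp [emit, forLoop, Prog.setsArr, ha.symm])
  have h7 : s2.arr 7 = s.arr 7 :=
    (harr2 7 (by decide)).trans (harr1 7 (by decide) (by decide) (by decide))
  have h2 : s2.arr 2 = s.arr 2 :=
    (harr2 2 (by decide)).trans (harr1 2 (by decide) (by decide) (by decide))
  have hadj2 : s2.adj n = s.adj n := by
    funext x y
    simp only [Store.adj, Store.mat, harr2 0 (by decide),
      harr1 0 (by decide) (by decide) (by decide)]
  have hg2 : s2.mat n 6 = s1.mat n 6 := by
    funext x y; simp only [Store.mat, harr2 6 (by decide)]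
  have h11' : s2.arr 11 = s1.arr 11 := harr2 11 (by decide)
  refine ⟨⟨?_, ?_, ?_, S ++ [swapTokens f (⟨u, hun⟩, ⟨b, hbn⟩)], _, hS', ⟨?_, ?_⟩, ?_, ?_⟩, ?_⟩
  · rw [hadj2, hg2, h7]; exact hr.tight.cancel hpush
  · rw [h11', h2, hg2]
    exact hr.cons.move hbn hun hub hpush hou hob h11u h11b fun v _ => h11 v
  · intro v hv
    rw [harr2 12 (by decide), hg2]
    have e1 := h12 v hv
    have e2 := hr.inflow v hv
    have e3 := hpush.inflow hun hv
    omega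
  · rw [hv1]; simp
  · intro k hk v
    rw [hout k v v.2]
    by_cases hkS : k = S.length
    · subst hkS
      rw [if_pos rfl, List.getElem_concat_length rfl]
      exact (hocc' v).symm
    · have hk' : k < S.length := by
        rw [List.length_append, List.length_singleton] at hk; omega
      rw [if_neg hkS, harr1 3 (by decide) (by decide) (by decide), List.getElem_append_left hk']
      exact hhold k hk' v
  · rw [h11']; exact hocc'
  · rw [h7]
    simp only [seqLen, List.length_append, List.length_singleton] at hpot ⊢
    omega
  · rw [h11', h7]
    rw [← potential_eq_sum_range hocc', ← potential_eq_sum_range hocc]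
    exact hpot'

/-- Each round but the last lowers the total potential of the current placement, which is at most
`n * n`, so it can be paid for by the potential. -/
theorem run_realize {B n : ℕ} (hB : n * n + n + 2 ≤ B) {G : SimpleGraph (Fin n)}
    {f₀ : TokenPlacement (Fin n) 2} {s : Store} (hn : s.var 2 = n)
    (hadj : ∀ u v : Fin n, s.adj n u v → G.Adj u v)
    (hπ : ∀ v < n, s.arr 7 v ≤ n) (hg : ∀ u < n, ∀ v < n, s.mat n 6 u v ≤ n)
    (hY : ∀ v < n, s.arr 2 v ≤ 1) (h0 : ∀ v < n, s.arr 12 v = 0)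
    (ht : IsTight n (s.adj n) (s.arr 7) (s.mat n 6))
    (hc : IsConserving n (s.arr 11) (s.arr 2) (s.mat n 6) (fun _ => 0) fun _ => 0)
    (hf₀ : ∀ v : Fin n, (f₀.color v : ℕ) = s.arr 11 v)
    (hout : ∀ v : Fin n, (f₀.color v : ℕ) = s.arr 3 v) (h1 : s.var 1 = 1) :
    Run B realize s ((30 * n * n + 20 * n + 10) + (2 + ((n * n + 1) * (100 * n + 100) + 2)))
      fun s' => ∃ (S : List (TokenPlacement (Fin n) 2)) (f : TokenPlacement (Fin n) 2),
        IsSwappingSeq G f₀ f S ∧ HoldsPlacements s' S ∧ (∀ v : Fin n, (f.color v : ℕ) = s.arr 2 v) ∧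
        potential (fun v : Fin n => s.arr 7 v) f + seqLen S =
          potential (fun v : Fin n => s.arr 7 v) f₀ := by
  refine Run.seq (run_sumInflow hB hn hg h0) ?_
  intro s1 hb1 hf1 h12
  refine Run.seq (R := fun s2 => s2 = s1.setVar 12 1) (Run.of_wp_le ⟨trivial, rfl⟩ (by decide)) ?_
  rintro s2 _ _ hs2
  have harr2 : ∀ a, a ≠ 12 → s2.arr a = s.arr a := fun a ha => by
    rw [hs2, Store.arr_setVar]
    exact hf1.arr a (by simp [sumInflow, forLoop, Prog.setsArr, ha.symm])
  have hadj2 : s2.adj n = s.adj n := by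
    funext x y; simp only [Store.adj, Store.mat, harr2 0 (by decide)]
  have hg2 : s2.mat n 6 = s.mat n 6 := by
    funext x y; simp only [Store.mat, harr2 6 (by decide)]
  have hn2 : s2.var 2 = n := by rw [hs2]; simp [hf1.var 2 rfl, hn]
  have hflag : s2.var 12 = 1 := by rw [hs2]; simp
  have hinit : IsRealizing G f₀ s2 := by
    refine ⟨?_, ?_, ?_, [f₀], f₀, ⟨rfl, rfl, by simp⟩, ⟨?_, ?_⟩, ?_, by simp [seqLen]⟩
    · rw [hadj2, hg2, harr2 7 (by decide)]; exact ht
    · rw [harr2 11 (by decide), harr2 2 (by decide), hg2]; exact hc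
    · rw [hg2, hs2]; exact h12
    · rw [hs2]; simp [hf1.var 1 rfl, h1]
    · intro k hk v
      have hk0 : k = 0 := by simpa using hk
      subst hk0
      rw [harr2 3 (by decide)]
      simpa using (hout v).symm
    · rw [harr2 11 (by decide)]; exact hf₀
  refine Run.mono (Run.loop
    (fun s' => IsRealizing G f₀ s' ∧ s'.var 12 ≤ 1 ∧
      (s'.var 12 = 0 → ∀ v < n, s'.arr 11 v = s.arr 2 v))
    (fun s' => (∑ v ∈ Finset.range n, s'.arr 11 v * s'.arr 7 v + s'.var 12) * (100 * n + 100))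
    ⟨hinit, by omega, by omega⟩ ?_ ?_) ?_ (fun _ _ _ h => h)
  · rintro s3 hb3 hf3 ⟨hr, hfl, -⟩ he
    have hfl1 : s3.var 12 = 1 := by
      have : s3.var 12 ≠ 0 := he
      omega
    have hn3 : s3.var 2 = n := (hf3.var 2 rfl).trans hn2
    have h73 : s3.arr 7 = s.arr 7 := (hf3.arr 7 rfl).trans (harr2 7 (by decide))
    have h23 : s3.arr 2 = s.arr 2 := (hf3.arr 2 rfl).trans (harr2 2 (by decide))
    have h03 : s3.arr 0 = s.arr 0 := (hf3.arr 0 rfl).trans (harr2 0 (by decide))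
    have hocc1 : ∀ v < n, s3.arr 11 v ≤ 1 := by
      obtain ⟨S, f, _, _, hocc, _⟩ := hr.seq
      intro v hv
      have h1 := hocc ⟨v, hv⟩
      have h2 := (f.color ⟨v, hv⟩).isLt
      simp only at h1
      omega
    refine ⟨(40 * n + 10) + (4 + ((30 * n + 10) + (25 * n + 60))), Run.seq
      (run_chooseTarget hn3) ?_⟩
    intro s4 hb4 hf4 htgt
    have harr4 : s4.arr = s3.arr := funext fun a => hf4.arr a rfl
    have hn4 : s4.var 2 = n := (hf4.var 2 rfl).trans hn3
    have hmat4 : s4.mat n 6 = s3.mat n 6 := by funext x y; simp only [Store.mat, harr4]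
    have hr4 : IsRealizing G f₀ s4 := hr.congr harr4 (hf4.var 1 rfl)
    refine Run.ite (fun he4 => ?_) fun he4 => ?_
    · simp only [Expr.eval, BinOp.eval_lt_ne_zero, hn4] at he4
      obtain ⟨hb, hob, hin, hmax⟩ := htgt.resolve_left fun h => by omega
      obtain ⟨b, hbb⟩ : ∃ b, s4.var 10 = b := ⟨_, rfl⟩
      rw [hbb] at hb hob hin hmax
      have hex : ∃ a < n, 0 < s4.mat n 6 a (s4.var 10) := by
        rw [hr.inflow b hb] at hin
        obtain ⟨a, ha, hpos⟩ := Finset.exists_ne_zero_of_sum_ne_zero hin.ne'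
        exact ⟨a, Finset.mem_range.mp ha, by
          rw [hmat4, hbb]; exact Nat.pos_of_ne_zero hpos⟩
      refine Run.seq (run_chooseOrigin hn4 hex) ?_
      rintro s5 hb5 hf5 ⟨hu, hgu⟩
      have harr5 : s5.arr = s4.arr := funext fun a => hf5.arr a rfl
      have hmat5 : s5.mat n 6 = s4.mat n 6 := by funext x y; simp only [Store.mat, harr5]
      have hr5 : IsRealizing G f₀ s5 := hr4.congr harr5 (hf5.var 1 rfl)
      rw [hbb] at hgu
      have hou : s5.arr 11 (s5.var 8) ≠ 0 := by
        refine occupied_of_flow hr5.tight hr5.cons hb hu ?_ (by rw [hmat5]; exact hgu)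
        intro v hv hv0 hvin
        rw [← hr5.inflow v hv] at hvin
        rw [harr5, harr4] at hv0 hvin ⊢
        exact hmax v hv hv0 hvin
      have hou1 : s5.arr 11 (s5.var 8) = 1 := by
        have := hocc1 _ hu
        rw [harr5, harr4] at hou ⊢
        omega
      refine (run_moveToken hB ((hf5.var 2 rfl).trans hn4) ?_ ?_ hr5 rfl
        ((hf5.var 10 rfl).trans hbb) hu hb (by rw [hmat5]; exact hgu) hou1
        (by rw [harr5, harr4]; exact hob)).mono le_rfl ?_
      · intro x y hxy
        refine hadj x y ?_
        simpa only [Store.adj, Store.mat, harr5, harr4, h03] using hxy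
      · rw [harr5, harr4, h73]; exact hπ
      · rintro s6 _ hf6 ⟨hr6, hsum⟩
        have h126 : s6.var 12 = 1 := by
          rw [hf6.var 12 rfl, hf5.var 12 rfl, hf4.var 12 rfl, hfl1]
        refine ⟨⟨hr6, by omega, by omega⟩, ?_⟩
        rw [harr5, harr4] at hsum
        rw [← hsum, h126, hfl1]
        simp only [Expr.cost]
        have : (∑ v ∈ Finset.range n, s6.arr 11 v * s6.arr 7 v + 1 + 1) * (100 * n + 100) =
          (∑ v ∈ Finset.range n, s6.arr 11 v * s6.arr 7 v + 1) * (100 * n + 100) +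
            (100 * n + 100) := by ring
        omega
    · rw [← not_not (a := _ = 0), ← ne_eq] at he4
      simp only [Expr.eval, BinOp.eval_lt_ne_zero, hn4] at he4
      have hnone := (htgt.resolve_right fun h => he4 h.1).2
      refine Run.of_wp_le ⟨trivial, ⟨?_, by simp [Expr.eval], fun _ => ?_⟩, ?_⟩
        (by simp only [Prog.cost, Expr.cost]; omega)
      · exact hr4.congr rfl (by simp)
      · rw [Store.arr_setVar, harr4, ← h23]
        refine eq_of_no_inflow hr.cons (by rw [h23]; exact hY) fun v hv hv0 => ?_
        rw [← hr.inflow v hv]; exact hnone v hv hv0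
      · simp only [Store.arr_setVar, Store.var_setVar, reduceIte, Expr.eval, hfl1, harr4, Expr.cost]
        have : (∑ v ∈ Finset.range n, s3.arr 11 v * s3.arr 7 v + 1) * (100 * n + 100) =
          (∑ v ∈ Finset.range n, s3.arr 11 v * s3.arr 7 v + 0) * (100 * n + 100) +
            (100 * n + 100) := by ring
        omega
  · rintro s3 hb3 hf3 ⟨hr, -, hdone⟩ he
    have h73 : s3.arr 7 = s.arr 7 := (hf3.arr 7 rfl).trans (harr2 7 (by decide))
    obtain ⟨S, f, b1, b2, b3, b4⟩ := hr.seq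
    rw [h73] at b4
    exact ⟨S, f, b1, b2, fun v => by rw [b3 v, hdone he v v.2], b4⟩
  · rw [hflag, harr2 11 (by decide), harr2 7 (by decide), ← potential_eq_sum_range hf₀]
    have := Nat.mul_le_mul_right (100 * n + 100)
      (Nat.add_le_add_right (potential_le_sq hπ f₀) 1)
    simp only [Expr.cost]
    omega

end WordRAM

namespace WordRAM

open TokenFlow TokenPlacement

/-! ### The algorithm -/

/-- Initialize the remaining supply and demand and write down the initial placement. -/
def setup : Prog :=
  .seq (.seq (.assign 2 (.var 0)) (.assign 1 (.const 1)))
    (forLoop 5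
      (.seq (.write 4 (.var 5) (.op .sub (.read 1 (.var 5)) (.read 2 (.var 5))))
        (.seq (.write 5 (.var 5) (.op .sub (.read 2 (.var 5)) (.read 1 (.var 5))))
          (.seq (.write 11 (.var 5) (.read 1 (.var 5)))
            (.seq (.write 3 (.var 5) (.read 1 (.var 5)))
              (.seq (.assign 3 (.op .add (.var 3) (.read 4 (.var 5))))
                (.assign 11 (.op .add (.var 11) (.read 5 (.var 5))))))))))

/-- Construct a swapping sequence of minimum length. -/
def construct : Prog :=
  .seq setup (.ite (.op .eq (.var 3) (.var 11))
    (.seq primalDual (.ite (.var 3) (.assign 0 (.const 0)) (.seq realize (.assign 0 (.const 1)))))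
    (.assign 0 (.const 0)))

/-- What the memory holds before the primal-dual method. -/
structure IsSetUp (n : ℕ) (s₀ s : Store) (k : ℕ) : Prop where
  src : ∀ v < k, s.arr 4 v = s₀.arr 1 v - s₀.arr 2 v
  dem : ∀ v < k, s.arr 5 v = s₀.arr 2 v - s₀.arr 1 v
  occ : ∀ v < k, s.arr 11 v = s₀.arr 1 v
  out : ∀ v < k, s.arr 3 v = s₀.arr 1 v
  sum_src : s.var 3 = ∑ v ∈ Finset.range k, (s₀.arr 1 v - s₀.arr 2 v)
  sum_dem : s.var 11 = ∑ v ∈ Finset.range k, (s₀.arr 2 v - s₀.arr 1 v)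

theorem run_setup {B n : ℕ} (hB : n * n + n + 2 ≤ B) {s : Store} (hn : s.var 0 = n)
    (h3 : s.var 3 = 0) (h11 : s.var 11 = 0) (hX : ∀ v < n, s.arr 1 v ≤ 1)
    (hY : ∀ v < n, s.arr 2 v ≤ 1) :
    Run B setup s (60 * n + 20) fun s' => s'.var 1 = 1 ∧ s'.var 2 = n ∧ IsSetUp n s s' n := by
  refine Run.mono (T := 4 + (n * (50 + 8) + 6)) (Run.seq
    (R := fun s1 => s1 = (s.setVar 2 n).setVar 1 1) (Run.of_wp_le ?_ (by decide)) ?_) (by omega)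
    (fun _ _ _ h => h)
  · simp [Prog.wp, Expr.Small, Expr.eval, hn]
  rintro s1 _ _ hs1
  have harr1 : s1.arr = s.arr := by simp [hs1]
  have hn1 : s1.var 2 = n := by simp [hs1]
  refine Run.forLoop (fun k s' => IsSetUp n s s' k) hn1 rfl (by decide) rfl ?_ ?_ ?_
  · refine ⟨by simp, by simp, by simp, by simp, ?_, ?_⟩
    · simp [hs1, h3]
    · simp [hs1, h11]
  · intro k s2 hk hb hf hi hinv
    have e1 : s2.arr 1 = s.arr 1 := (hf.arr 1 rfl).trans (by rw [harr1])
    have e2 : s2.arr 2 = s.arr 2 := (hf.arr 2 rfl).trans (by rw [harr1])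
    have hsum1 : s2.var 3 ≤ k := by
      rw [hinv.sum_src]
      have := Finset.sum_le_card_nsmul (Finset.range k) (fun v => s.arr 1 v - s.arr 2 v) 1
        fun v hv => by
          have := hX v ((Finset.mem_range.mp hv).trans hk)
          omega
      simpa using this
    have hsum2 : s2.var 11 ≤ k := by
      rw [hinv.sum_dem]
      have := Finset.sum_le_card_nsmul (Finset.range k) (fun v => s.arr 2 v - s.arr 1 v) 1
        fun v hv => by
          have := hY v ((Finset.mem_range.mp hv).trans hk)
          omega
      simpa using this
    have hXk := hX k hk
    have hYk := hY k hk
    refine Run.of_wp_le ?_ (by decide)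
    simp only [Prog.wp, Expr.Small, Expr.eval, BinOp.eval, true_and, Store.var_setVar,
      Store.arr_setVar, Store.arr_setArr, Store.var_setArr, Nat.reduceEqDiff, reduceIte, hi, e1, e2,
      Function.update_self]
    refine ⟨by omega, by omega, ?_, ?_, ?_, ?_, ?_, ?_⟩
    · intro v hv
      by_cases hvk : v = k
      · simp [hvk]
      · simpa [hvk] using hinv.src v (by omega)
    · intro v hv
      by_cases hvk : v = k
      · simp [hvk]
      · simpa [hvk] using hinv.dem v (by omega)
    · intro v hv
      by_cases hvk : v = k
      · simp [hvk]
      · simpa [hvk] using hinv.occ v (by omega)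
    · intro v hv
      by_cases hvk : v = k
      · simp [hvk]
      · simpa [hvk] using hinv.out v (by omega)
    · simp [hinv.sum_src, Finset.sum_range_succ]
    · simp [hinv.sum_dem, Finset.sum_range_succ]
  · intro s2 hb hf hinv
    exact ⟨(hf.var 1 rfl).trans (by simp [hs1]), (hf.var 2 rfl).trans hn1, hinv⟩

section Input

variable {n : ℕ} (G : SimpleGraph (Fin n)) (f₀ fₜ : TokenPlacement (Fin n) 2)

theorem inputStore_adj (u v : Fin n) : (inputStore G f₀ fₜ).adj n u v ↔ G.Adj u v := by
  classical
  simp only [Store.adj, Store.mat, inputStore, reduceIte]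
  have hn : 0 < n := u.pos
  constructor
  · intro h
    by_contra hc
    apply h
    rw [if_neg]
    rintro ⟨i, j, he, ha⟩
    have h1 : ((u : ℕ) * n + v) / n = (i * n + j) / n := by rw [he]
    rw [mul_comm, Nat.mul_add_div hn, Nat.div_eq_of_lt v.2, mul_comm (i : ℕ), Nat.mul_add_div hn,
      Nat.div_eq_of_lt j.2] at h1
    have h2 : u = i := Fin.ext (by omega)
    subst h2
    have h3 : v = j := Fin.ext (by omega)
    subst h3
    exact hc ha
  · intro h
    rw [if_pos ⟨u, v, rfl, h⟩]
    exact one_ne_zero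

theorem inputStore_initial (v : Fin n) : (inputStore G f₀ fₜ).arr 1 v = f₀.color v := by
  simp [inputStore]

theorem inputStore_target (v : Fin n) : (inputStore G f₀ fₜ).arr 2 v = fₜ.color v := by
  simp [inputStore]

theorem inputStore_bounded {B : ℕ} (hB : n * n + n + 2 ≤ B) : Bounded B (inputStore G f₀ fₜ) := by
  refine ⟨fun x => ?_, fun a i => ?_⟩
  · simp only [inputStore]; split_ifs <;> omega
  · simp only [inputStore]
    split_ifs
    all_goals omega

/-- If, on a set that is closed under adjacency, one color occurs differently often, then there is
no swapping sequence. -/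
theorem not_exists_isSwappingSeq {S : Finset ℕ} (hS : S ⊆ Finset.range n)
    (hcl : ∀ u ∈ S, ∀ v < n, ((inputStore G f₀ fₜ).adj n u v → v ∈ S))
    (hne : ∑ v ∈ S, (inputStore G f₀ fₜ).arr 1 v ≠ ∑ v ∈ S, (inputStore G f₀ fₜ).arr 2 v) :
    ¬ ∃ L, IsSwappingSeq G f₀ fₜ L := by
  rintro ⟨L, hL⟩
  have hlt : ∀ m ∈ S, m < n := fun m hm => Finset.mem_range.mp (hS hm)
  have hmap : (S.attachFin hlt).map Fin.valEmbedding = S := Finset.map_valEmbedding_attachFin hlt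
  have h := hL.sum_eq_of_closed (D := S.attachFin hlt) fun u hu v huv => by
    rw [Finset.mem_attachFin] at hu ⊢
    exact hcl u hu v v.2 ((inputStore_adj G f₀ fₜ u v).mpr huv)
  apply hne
  rw [← hmap, Finset.sum_map, Finset.sum_map]
  simp only [Fin.valEmbedding_apply, inputStore_initial, inputStore_target]
  exact h

/-- The result of the algorithm: either there is no swapping sequence, or the memory holds one of
minimum length. -/
def IsSolution (s : Store) : Prop :=
  (s.var 0 = 0 ∧ ¬ ∃ S, IsSwappingSeq G f₀ fₜ S) ∨
    (s.var 0 = 1 ∧ ∃ S, IsSwappingSeq G f₀ fₜ S ∧ (seqLen S : ℕ∞) = opt G f₀ fₜ ∧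
      HoldsPlacements s S)

/-- The algorithm is correct. Its time bound is the sum of those of its parts. -/
theorem run_construct {B : ℕ} (hB : n * n + n + 2 ≤ B) :
    Run B construct (inputStore G f₀ fₜ)
      ((60 * n + 20) + (4 + ((2 * n * (80 * n * n + 200 * n + 110) + 10) + (2 +
        (((30 * n * n + 20 * n + 10) + (2 + ((n * n + 1) * (100 * n + 100) + 2))) + 2)))))
      (IsSolution G f₀ fₜ) := by
  set s := inputStore G f₀ fₜ with hs
  have hX : ∀ v < n, s.arr 1 v ≤ 1 := fun v hv => by
    have := inputStore_initial G f₀ fₜ ⟨v, hv⟩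
    rw [← hs] at this
    simp only at this
    have := (f₀.color ⟨v, hv⟩).isLt
    omega
  have hY : ∀ v < n, s.arr 2 v ≤ 1 := fun v hv => by
    have := inputStore_target G f₀ fₜ ⟨v, hv⟩
    rw [← hs] at this
    simp only at this
    have := (fₜ.color ⟨v, hv⟩).isLt
    omega
  refine Run.seq (run_setup hB (by simp [hs, inputStore]) (by simp [hs, inputStore])
    (by simp [hs, inputStore]) hX hY) ?_
  rintro s1 hb1 hf1 ⟨hcnt, hn1, hset⟩
  have hsums : ∑ v ∈ Finset.range n, s.arr 1 v + ∑ v ∈ Finset.range n, (s.arr 2 v - s.arr 1 v) =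
      ∑ v ∈ Finset.range n, s.arr 2 v + ∑ v ∈ Finset.range n, (s.arr 1 v - s.arr 2 v) := by
    rw [← Finset.sum_add_distrib, ← Finset.sum_add_distrib]
    exact Finset.sum_congr rfl fun v _ => by omega
  have hadj1 : s1.adj n = s.adj n := by
    funext x y; simp only [Store.adj, Store.mat, hf1.arr 0 rfl]
  have hg1 : ∀ u v, s1.mat n 6 u v = 0 := fun u v => by
    simp only [Store.mat, hf1.arr 6 rfl, hs, inputStore]; simp
  have h71 : ∀ v, s1.arr 7 v = 0 := fun v => by
    simp only [hf1.arr 7 rfl, hs, inputStore]; simp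
  have h41 : s1.var 4 = 0 := by simp only [hf1.var 4 rfl, hs, inputStore]; simp
  have h11 : s1.arr 1 = s.arr 1 := hf1.arr 1 rfl
  have h21 : s1.arr 2 = s.arr 2 := hf1.arr 2 rfl
  refine Run.ite (fun he => ?_) fun he => ?_
  swap
  · -- the numbers of tokens differ
    rw [← not_not (a := _ = 0), ← ne_eq] at he
    simp only [Expr.eval, BinOp.eval_eq_ne_zero, hset.sum_src, hset.sum_dem] at he
    refine Run.of_wp_le ⟨trivial, Or.inl ⟨by simp [Expr.eval], ?_⟩⟩
      (by simp only [Prog.cost, Expr.cost]; omega)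
    refine not_exists_isSwappingSeq G f₀ fₜ (S := Finset.range n) subset_rfl
      (fun u _ v hv _ => Finset.mem_range.mpr hv) ?_
    rw [← hs]
    omega
  simp only [Expr.eval, BinOp.eval_eq_ne_zero, hset.sum_src, hset.sum_dem] at he
  have hXY : ∑ v ∈ Finset.range n, s.arr 1 v = ∑ v ∈ Finset.range n, s.arr 2 v := by omega
  have h31 : s1.var 3 ≤ n := by
    rw [hset.sum_src]
    have := Finset.sum_le_card_nsmul (Finset.range n) (fun v => s.arr 1 v - s.arr 2 v) 1
      fun v hv => by
        have := hX v (Finset.mem_range.mp hv)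
        omega
    simpa using this
  have hflow1 : HoldsFlow n s1 := by
    refine ⟨⟨⟨fun u _ v _ _ => ?_, fun u _ v _ h => ?_⟩, fun v hv => ?_, fun v _ => ?_,
      fun v _ _ => ?_, fun v _ _ => ?_, fun v hv => ?_, fun v hv => ?_⟩, fun u hu v hv h => ?_, ?_,
      fun u _ v _ => ?_, ?_⟩
    · rw [h71]; omega
    · rw [hg1] at h; omega
    · simp only [hg1, Finset.sum_const_zero, h11, h21, hset.src v hv, hset.dem v hv]
      omega
    · rw [h71]; omega
    · rw [h71, h41]
    · exact h71 v
    · rw [hset.src v hv]; have := hX v hv; omega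
    · rw [hset.dem v hv]; have := hY v hv; omega
    · rw [hadj1] at h ⊢
      exact (inputStore_adj G f₀ fₜ ⟨v, hv⟩ ⟨u, hu⟩).mpr
        ((inputStore_adj G f₀ fₜ ⟨u, hu⟩ ⟨v, hv⟩).mp h).symm
    · rw [hset.sum_src]
      exact Finset.sum_congr rfl fun v hv => (hset.src v (Finset.mem_range.mp hv)).symm
    · rw [hg1]; omega
    · omega
  refine Run.seq (run_primalDual hB hn1 hflow1 h31) ?_
  rintro s2 hb2 hf2 ⟨hflow2, hdone⟩
  have hn2 : s2.var 2 = n := (hf2.var 2 rfl).trans hn1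
  have h12 : s2.arr 1 = s.arr 1 := (hf2.arr 1 rfl).trans h11
  have h22 : s2.arr 2 = s.arr 2 := (hf2.arr 2 rfl).trans h21
  have hadj2 : s2.adj n = s.adj n := by
    funext x y; simp only [Store.adj, Store.mat, hf2.arr 0 rfl, hf1.arr 0 rfl]
  have hcount := hflow2.count
  refine Run.ite (fun he3 => ?_) fun he3 => ?_
  · -- some supply cannot be sent to the remaining demand
    simp only [Expr.eval] at he3
    have hK := hdone.resolve_left he3
    obtain ⟨x, hx, hxs⟩ := Finset.exists_ne_zero_of_sum_ne_zero (hcount ▸ he3)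
    obtain ⟨S, hS, hcl, hlt⟩ := hflow2.flow.exists_closed (by omega) (Finset.mem_range.mp hx)
      (Nat.pos_of_ne_zero hxs)
    rw [h12, h22] at hlt
    rw [hadj2] at hcl
    refine Run.of_wp_le ⟨trivial, Or.inl ⟨by simp [Expr.eval], ?_⟩⟩
      (by simp only [Prog.cost, Expr.cost]; omega)
    exact not_exists_isSwappingSeq G f₀ fₜ hS hcl hlt.ne'
  simp only [Expr.eval] at he3
  have hsrc0 : ∀ v < n, s2.arr 4 v = 0 := fun v hv =>
    Finset.sum_eq_zero_iff.mp (hcount ▸ he3) v (Finset.mem_range.mpr hv)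
  have hdem0 : ∀ v < n, s2.arr 5 v = 0 := by
    have h := hflow2.flow.cons.sum_eq
    rw [h12, h22, ← hcount, he3] at h
    intro v hv
    exact Finset.sum_eq_zero_iff.mp (show ∑ v ∈ Finset.range n, s2.arr 5 v = 0 by omega) v
      (Finset.mem_range.mpr hv)
  have hocc : ∀ v < n, s2.arr 11 v = s.arr 1 v := fun v hv => by
    rw [hf2.arr 11 rfl]; exact hset.occ v hv
  have hfin := run_realize hB (G := G) (f₀ := f₀) (s := s2) hn2
    (fun u v h => by rw [hadj2] at h; exact (inputStore_adj G f₀ fₜ u v).mp h)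
    (fun v hv => (hflow2.flow.le v hv).trans hflow2.le)
    (fun u hu v hv => by have := hflow2.bound u hu v hv; omega)
    (by rw [h22]; exact hY)
    (fun v _ => by rw [hf2.arr 12 rfl, hf1.arr 12 rfl, hs]; simp [inputStore])
    hflow2.flow.tight
    (fun v hv => by
      have := hflow2.flow.cons v hv
      rw [hsrc0 v hv, hdem0 v hv, h12] at this
      simp only [hocc v hv]
      exact this)
    (fun v => by rw [hocc v v.2, hs, inputStore_initial])
    (fun v => by rw [hf2.arr 3 rfl, hset.out v v.2, hs, inputStore_initial])
    ((hf2.var 1 rfl).trans hcnt)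
  refine Run.seq hfin ?_
  rintro s3 hb3 hf3 ⟨S, f, hS, hhold, hcol, hpot⟩
  have hf : f = fₜ := by
    ext v
    rw [hcol, h22, hs, inputStore_target]
  subst hf
  refine Run.of_wp_le ⟨trivial, Or.inr ⟨by simp [Expr.eval], S, hS, ?_, ?_⟩⟩ (by decide)
  · refine hS.seqLen_eq_opt (π := fun v : Fin n => s2.arr 7 v) (fun u v huv => ?_) hpot.le
    refine hflow2.flow.tight.lip u u.2 v v.2 ?_
    rw [hadj2]; exact (inputStore_adj G f₀ f u v).mpr huv
  · obtain ⟨h1, h2⟩ := hhold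
    exact ⟨by simpa using h1, h2⟩

end Input

end WordRAM

namespace WordRAM

open TokenPlacement

/-! ### Cubic time -/

theorem Expr.Fits.mono {W W' : ℕ} (hW : W ≤ W') {s : Store} {e : Expr} (h : e.Fits W s) :
    e.Fits W' s := by
  induction e with
  | const k => exact le_trans h hW
  | var x => exact le_trans h hW
  | read a i ih => exact ⟨ih h.1, h.2.trans hW⟩
  | op o e₁ e₂ ih₁ ih₂ => exact ⟨ih₁ h.1, ih₂ h.2.1, h.2.2.trans hW⟩

theorem Exec.mono {W W' : ℕ} (hW : W ≤ W') {p : Prog} {s s' : Store} {t : ℕ}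
    (h : Exec W p s t s') : Exec W' p s t s' := by
  induction h with
  | skip s => exact .skip s
  | assign x e s he => exact .assign x e s (he.mono hW)
  | write a i e s hi he => exact .write a i e s (hi.mono hW) (he.mono hW)
  | seq p q s s' s'' t t' _ _ ihp ihq => exact .seq p q s s' s'' t t' ihp ihq
  | ite_true e p q s s' t he h _ ih => exact .ite_true e p q s s' t (he.mono hW) h ih
  | ite_false e p q s s' t he h _ ih => exact .ite_false e p q s s' t (he.mono hW) h ih
  | loop_true e p s s' s'' t t' he h _ _ ihp ihl =>
    exact .loop_true e p s s' s'' t t' (he.mono hW) h ihp ihl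
  | loop_false e p s he h => exact .loop_false e p s (he.mono hW) h

/-- The expression does not mention the variable `x`. -/
def Expr.avoids (x : ℕ) : Expr → Bool
  | .const _ => true
  | .var y => y != x
  | .read _ i => i.avoids x
  | .op _ e₁ e₂ => e₁.avoids x && e₂.avoids x

/-- The program does not mention the variable `x`. -/
def Prog.avoids (x : ℕ) : Prog → Bool
  | .skip => true
  | .assign y e => y != x && e.avoids x
  | .write _ i e => i.avoids x && e.avoids x
  | .seq p q => p.avoids x && q.avoids x
  | .ite e p q => e.avoids x && p.avoids x && q.avoids x
  | .loop e p => e.avoids x && p.avoids x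

theorem Expr.eval_setVar_of_avoids {x k : ℕ} {s : Store} {e : Expr} (h : e.avoids x = true) :
    e.eval (s.setVar x k) = e.eval s := by
  induction e with
  | const k => rfl
  | var y =>
    have : y ≠ x := by simpa [Expr.avoids] using h
    simp [Expr.eval, this]
  | read a i ih => simp only [Expr.eval, Store.arr_setVar, ih h]
  | op o e₁ e₂ ih₁ ih₂ =>
    simp only [Expr.avoids, Bool.and_eq_true] at h
    simp only [Expr.eval, ih₁ h.1, ih₂ h.2]

theorem Expr.Fits.setVar_of_avoids {x k W : ℕ} {s : Store} {e : Expr} (h : e.avoids x = true)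
    (hf : e.Fits W s) : e.Fits W (s.setVar x k) := by
  induction e with
  | const k => exact hf
  | var y =>
    have : y ≠ x := by simpa [Expr.avoids] using h
    simpa [Expr.Fits, this] using hf
  | read a i ih =>
    refine ⟨ih h hf.1, ?_⟩
    rw [Expr.eval_setVar_of_avoids (e := i) h]
    exact hf.2
  | op o e₁ e₂ ih₁ ih₂ =>
    simp only [Expr.avoids, Bool.and_eq_true] at h
    refine ⟨ih₁ h.1 hf.1, ih₂ h.2 hf.2.1, ?_⟩
    rw [Expr.eval_setVar_of_avoids h.1, Expr.eval_setVar_of_avoids h.2]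
    exact hf.2.2

theorem Store.setVar_comm {x y k l : ℕ} (s : Store) (h : x ≠ y) :
    (s.setVar x k).setVar y l = (s.setVar y l).setVar x k := by
  simp only [Store.setVar, Function.update_comm h]

/-- The value of a variable that the program does not mention is irrelevant. -/
theorem Exec.setVar_of_avoids {W x k t : ℕ} {p : Prog} {s s' : Store} (h : Exec W p s t s')
    (hp : p.avoids x = true) : Exec W p (s.setVar x k) t (s'.setVar x k) := by
  induction h with
  | skip s => exact .skip _
  | assign y e s he =>
    simp only [Prog.avoids, Bool.and_eq_true, bne_iff_ne] at hp
    have := Exec.assign y e (s.setVar x k) (he.setVar_of_avoids hp.2)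
    rwa [Expr.eval_setVar_of_avoids hp.2, Store.setVar_comm _ (Ne.symm hp.1)] at this
  | write a i e s hi he =>
    simp only [Prog.avoids, Bool.and_eq_true] at hp
    have := Exec.write a i e (s.setVar x k) (hi.setVar_of_avoids hp.1) (he.setVar_of_avoids hp.2)
    rwa [Expr.eval_setVar_of_avoids hp.1, Expr.eval_setVar_of_avoids hp.2] at this
  | seq p q s s' s'' t t' _ _ ihp ihq =>
    simp only [Prog.avoids, Bool.and_eq_true] at hp
    exact .seq p q _ _ _ t t' (ihp hp.1) (ihq hp.2)
  | ite_true e p q s s' t he h _ ih =>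
    simp only [Prog.avoids, Bool.and_eq_true] at hp
    exact .ite_true e p q _ _ t (he.setVar_of_avoids hp.1.1)
      (by rwa [Expr.eval_setVar_of_avoids hp.1.1]) (ih hp.1.2)
  | ite_false e p q s s' t he h _ ih =>
    simp only [Prog.avoids, Bool.and_eq_true] at hp
    exact .ite_false e p q _ _ t (he.setVar_of_avoids hp.1.1)
      (by rwa [Expr.eval_setVar_of_avoids hp.1.1]) (ih hp.2)
  | loop_true e p s s' s'' t t' he h _ _ ihp ihl =>
    have hp' := hp
    simp only [Prog.avoids, Bool.and_eq_true] at hp'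
    exact .loop_true e p _ _ _ t t' (he.setVar_of_avoids hp'.1)
      (by rwa [Expr.eval_setVar_of_avoids hp'.1]) (ihp hp'.2) (ihl hp)
  | loop_false e p s he h =>
    simp only [Prog.avoids, Bool.and_eq_true] at hp
    exact .loop_false e p _ (he.setVar_of_avoids hp.1)
      (by rwa [Expr.eval_setVar_of_avoids hp.1])

/-- The algorithm needs cubic time and words of logarithmic length. -/
theorem exists_exec_construct : ∃ C : ℕ, ∀ C' : ℕ, C ≤ C' →
    ∀ (n : ℕ) (G : SimpleGraph (Fin n)) (f₀ fₜ : TokenPlacement (Fin n) 2),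
    ∃ (t : ℕ) (s : Store), Exec (C' * (n + 1) ^ C') construct (inputStore G f₀ fₜ) t s ∧
      1 ≤ n ∧ t ≤ C * n ^ 3 ∧ s.var 1 ≤ C' * (n + 1) ^ C' ∧ IsSolution G f₀ fₜ s := by
  -- `2 ^ 30` comes from `(2 * (n + 1) ^ 2) ^ 30` and exceeds the coefficients of the time bound
  refine ⟨2 ^ 30, fun C hC n G f₀ fₜ => ?_⟩
  -- there is no surjection from the empty set to the colors
  have hn : 1 ≤ n := by
    obtain ⟨v, _⟩ := f₀.surj 0
    have := v.pos
    omega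
  obtain ⟨t, s, hex, ht, hb, -, hsol⟩ := run_construct G f₀ fₜ (B := n * n + n + 2) le_rfl
    (by omega) (by decide) (inputStore_bounded G f₀ fₜ le_rfl)
  have hB : (n * n + n + 2) ^ 30 ≤ C * (n + 1) ^ C := by
    have h1 : n * n + n + 2 ≤ 2 * (n + 1) ^ 2 := by ring_nf; omega
    have h60 : 60 ≤ C := le_trans (by norm_num) hC
    calc (n * n + n + 2) ^ 30 ≤ (2 * (n + 1) ^ 2) ^ 30 := Nat.pow_le_pow_left h1 30
      _ = 2 ^ 30 * (n + 1) ^ 60 := by rw [mul_pow, ← pow_mul]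
      _ ≤ C * (n + 1) ^ C := Nat.mul_le_mul hC (Nat.pow_le_pow_right (by omega) h60)
  refine ⟨t, s, hex.mono hB, hn, ht.trans ?_,
    (hb.var 1).trans ((Nat.le_self_pow (by norm_num) _).trans hB), hsol⟩
  have e1 : n ≤ n ^ 3 := Nat.le_self_pow (by norm_num) _
  have e2 : n ^ 2 ≤ n ^ 3 := Nat.pow_le_pow_right hn (by norm_num)
  ring_nf
  omega

theorem exists_constructsInCubicTime : ∃ (p : Prog) (C : ℕ), ConstructsInCubicTime p C := by
  obtain ⟨C, hC⟩ := exists_exec_construct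
  refine ⟨construct, C, fun n G f₀ fₜ => ?_⟩
  obtain ⟨t, s, hex, -, ht, -, hsol⟩ := hC C le_rfl n G f₀ fₜ
  exact ⟨t, s, hex, ht, hsol⟩

/-- Save the number `ℓ` in variable `20`, which `construct` does not mention, construct an
optimal swapping sequence and compare its length with `ℓ`. -/
def decideProg : Prog :=
  .seq (.assign 20 (.var 1)) (.seq (.assign 1 (.const 0)) (.seq construct
    (.ite (.var 0) (.assign 0 (.op .sub (.const 1)
      (.op .lt (.var 20) (.op .sub (.var 1) (.const 1))))) .skip)))

theorem exists_decidesInCubicTime : ∃ (p : Prog) (C : ℕ), DecidesInCubicTime p C := by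
  obtain ⟨C, hC⟩ := exists_exec_construct
  refine ⟨decideProg, C + 20, fun n G f₀ fₜ ℓ => ?_⟩
  obtain ⟨t, s, hex, hn, ht, h1, hsol⟩ := hC (C + 20) (by omega) n G f₀ fₜ
  set W := (C + 20) * (n + 1) ^ (C + 20) + ℓ with hW
  have hpos : 1 ≤ (n + 1) ^ (C + 20) := Nat.one_le_pow _ _ (by omega)
  have hW20 : 20 + ℓ ≤ W := by
    have := Nat.mul_le_mul (show 20 ≤ C + 20 by omega) hpos
    omega
  have hn3 : 1 ≤ n ^ 3 := Nat.one_le_pow _ _ hn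
  have hbound : C * n ^ 3 + 20 ≤ (C + 20) * n ^ 3 := by
    rw [Nat.add_mul]; omega
  have hstart : (((inputStore G f₀ fₜ).setVar 1 ℓ).setVar 20 ℓ).setVar 1 0 =
      (inputStore G f₀ fₜ).setVar 20 ℓ := by
    ext x
    · simp only [Store.var_setVar]
      by_cases h : x = 1
      · subst h; simp [inputStore]
      · simp [h]
    · rfl
  have hex' : Exec W construct ((inputStore G f₀ fₜ).setVar 20 ℓ) t (s.setVar 20 ℓ) :=
    (hex.mono (by omega)).setVar_of_avoids (by decide)
  have hfirst : Exec W (.assign 20 (.var 1)) ((inputStore G f₀ fₜ).setVar 1 ℓ) 2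
      (((inputStore G f₀ fₜ).setVar 1 ℓ).setVar 20 ℓ) := by
    have h := Exec.assign (W := W) 20 (.var 1) ((inputStore G f₀ fₜ).setVar 1 ℓ)
      (by simp only [Expr.Fits, Store.var_setVar, reduceIte]; omega)
    simpa [Expr.eval, Expr.cost] using h
  have hsecond : Exec W (.assign 1 (.const 0)) (((inputStore G f₀ fₜ).setVar 1 ℓ).setVar 20 ℓ) 2
      ((inputStore G f₀ fₜ).setVar 20 ℓ) := by
    have h := Exec.assign (W := W) 1 (.const 0) (((inputStore G f₀ fₜ).setVar 1 ℓ).setVar 20 ℓ)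
      (Nat.zero_le _)
    simp only [Expr.eval, Expr.cost] at h
    rwa [hstart] at h
  rcases hsol with ⟨h0, hno⟩ | ⟨h0, S, hS, hlen, hhold, -⟩
  · have hopt : opt G f₀ fₜ = ⊤ := by
      rw [opt, iInf₂_eq_top]
      exact fun S hS => absurd ⟨S, hS⟩ hno
    have hlast := Exec.ite_false (W := W) (.var 0) (.assign 0 (.op .sub (.const 1)
      (.op .lt (.var 20) (.op .sub (.var 1) (.const 1))))) .skip (s.setVar 20 ℓ) (s.setVar 20 ℓ) 1
      (by simp [Expr.Fits, h0]) (by simp [Expr.eval, h0]) (.skip _)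
    refine ⟨_, _, .seq _ _ _ _ _ _ _ hfirst (.seq _ _ _ _ _ _ _ hsecond
      (.seq _ _ _ _ _ _ _ hex' hlast)), ?_, ?_⟩
    · simp only [Expr.cost]; omega
    · rw [hopt, if_neg (by simp)]
      simpa using h0
  · have hiff : opt G f₀ fₜ ≤ (ℓ : ℕ∞) ↔ s.var 1 - 1 ≤ ℓ := by
      rw [← hlen, Nat.cast_le, seqLen, hhold]
    have hval : (Expr.op .sub (.const 1) (.op .lt (.var 20) (.op .sub (.var 1) (.const 1)))).eval
        (s.setVar 20 ℓ) = if s.var 1 - 1 ≤ ℓ then 1 else 0 := by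
      simp only [Expr.eval, BinOp.eval, Store.var_setVar, Nat.reduceEqDiff, reduceIte]
      split_ifs <;> omega
    have hlast := Exec.ite_true (W := W) (.var 0) (.assign 0 (.op .sub (.const 1)
      (.op .lt (.var 20) (.op .sub (.var 1) (.const 1))))) .skip (s.setVar 20 ℓ) _ _
      (by simp only [Expr.Fits, Store.var_setVar, Nat.reduceEqDiff, reduceIte, h0]; omega)
      (by simp [Expr.eval, h0]) (Exec.assign 0 _ _ (by
        simp only [Expr.Fits, Expr.eval, BinOp.eval, Store.var_setVar, Nat.reduceEqDiff, reduceIte]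
        refine ⟨by omega, ⟨by omega, ⟨by omega, by omega, by omega⟩, ?_⟩, ?_⟩
        · split_ifs <;> omega
        · omega))
    refine ⟨_, _, .seq _ _ _ _ _ _ _ hfirst (.seq _ _ _ _ _ _ _ hsecond
      (.seq _ _ _ _ _ _ _ hex' hlast)), ?_, ?_⟩
    · simp only [Expr.cost]; omega
    · rw [hval, Store.var_setVar, if_pos rfl]
      by_cases h : s.var 1 - 1 ≤ ℓ
      · rw [if_pos h, if_pos (hiff.mpr h)]
      · rw [if_neg h, if_neg fun h' => h (hiff.mp h')]

end WordRAM

theorem theorem2 :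
    -- the decision problem is solvable in cubic time
    (∃ (p : WordRAM.Prog) (C : ℕ), WordRAM.DecidesInCubicTime p C) ∧
    -- a shortest swapping sequence can be constructed in cubic time
    (∃ (p : WordRAM.Prog) (C : ℕ), WordRAM.ConstructsInCubicTime p C) ∧
    -- the minimum number of swaps is the minimum weight of a perfect matching,
    -- and it is attained by color shifts along shortest paths
    (∀ (V : Type*) [Fintype V] [DecidableEq V] (G : SimpleGraph V) (f₀ fₜ : TokenPlacement V 2),
      TokenPlacement.opt G f₀ fₜ =
        (⨅ M : TokenPlacement.ColorOneMatching f₀ fₜ, TokenPlacement.matchingWeight G M) ∧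
      (TokenPlacement.SameColorCounts G f₀ fₜ →
        TokenPlacement.opt G f₀ fₜ ≠ ⊤ ∧
        (∃ M : TokenPlacement.ColorOneMatching f₀ fₜ, TokenPlacement.IsMinWeight G M) ∧
        ∀ M : TokenPlacement.ColorOneMatching f₀ fₜ, TokenPlacement.IsMinWeight G M →
          TokenPlacement.opt G f₀ fₜ = TokenPlacement.matchingWeight G M ∧
          -- for some order of the edges of `M` and every choice of shortest paths
          ∃ L : List (TokenPlacement.ColorOne f₀), L.Nodup ∧ (∀ x, x ∈ L) ∧
            ∀ P : (x : TokenPlacement.ColorOne f₀) → G.Walk (M x : V) (x : V),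
              (∀ x, ((P x).length : ℕ∞) = G.edist (x : V) (M x : V)) →
              let S := TokenPlacement.placements f₀
                (TokenPlacement.colorShifts f₀ (L.map fun x => (P x).support))
              TokenPlacement.IsSwappingSeq G f₀ fₜ S ∧
                (TokenPlacement.seqLen S : ℕ∞) = TokenPlacement.matchingWeight G M)) := by
  refine ⟨WordRAM.exists_decidesInCubicTime, WordRAM.exists_constructsInCubicTime, ?_⟩
  intro V _ _ G f₀ fₜ
  have hopt := TokenPlacement.opt_eq_iInf_matchingWeight G f₀ fₜ
  refine ⟨hopt, fun hsame => ?_⟩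
  obtain ⟨N, hN⟩ := hsame.exists_matching
  have hfin : TokenPlacement.opt G f₀ fₜ ≠ ⊤ := by
    rw [hopt]
    exact ne_top_of_le_ne_top hN (iInf_le _ N)
  have : Nonempty (TokenPlacement.ColorOneMatching f₀ fₜ) := ⟨N⟩
  refine ⟨hfin, Finite.exists_min fun M : TokenPlacement.ColorOneMatching f₀ fₜ =>
    TokenPlacement.matchingWeight G M, fun M hM => ?_⟩
  have hMopt := hopt.trans hM.matchingWeight_eq_iInf.symm
  exact ⟨hMopt, hM.exists_order (hMopt ▸ hfin)⟩
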